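/- **Setting.** A *deterministic quantum primitive* consists, for each security parameter $\lambda$, of a finite key set $\mathcal K_\lambda\neq\emptyset$, unitaries $U_k$ ($k\in\mathcal K_\lambda$) on $n(\lambda)$ qubits (dimension $D=2^{n(\lambda)}$, with $2^{-n(\lambda)}$ negligible), a quantum test $\mathcal T_\lambda$ and numbers of copies $\kappa_1(\lambda),\kappa_2(\lambda)$ with $\kappa_1$ polynomially bounded. Setup draws $k$ uniformly, the evaluation oracle applies $U_k$. A *quantum test* is a two-outcome measurement on $\rho^{\otimes\kappa_1}\otimes\sigma^{\otimes\kappa_2}$ ($\rho$ an arbitrary state, $\sigma$ a pure reference state) which accepts with a probability $f(\kappa_1,\kappa_2,F(\rho,\sigma))$ depending only on the Uhlmann fidelity, where for all $\kappa_1,\kappa_2\ge1$ one has $f\to1$ as $F\to1$, $f$ converges as $F\to0$, and $f(\kappa_1,\kappa_2,F)\to F$ as $\kappa_1,\kappa_2\to\infty$. An *efficient (QPT) algorithm* is a family of polynomial-size quantum circuits (possibly non-uniform) made of gates on at most three qubits, computational basis measurements and oracle queries. The family $\{U_k\}$ is a *pseudorandom unitary* (PRU) if for every such algorithm $\mathcal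 B$ with one output bit $$\Big|\Pr_{k\leftarrow\mathcal K_\lambda}[\mathcal B^{U_k}=1]-\Pr_{U\leftarrow\mathrm{Haar}}[\mathcal B^{U}=1]\Big|$$ is negligible in $\lambda$. **Game.** For $0<\mu\le1$ a QPT adversary $\mathcal A$ with oracle $U_k$ (i) makes queries; (ii) submits a classical description (produced by a measurement, so possibly dependent on everything seen so far) of an efficiently preparable pure challenge state $|\psi\rangle$ on $n$ qubits; (iii) makes further queries; (iv) outputs a tag state $\rho_t$ on $n$ qubits. Queries may be entangled with the internal memory of $\mathcal A$; $\rho^{in}_i$ denotes the state of the $i$-th query register, at the time of the query and given the measurement outcomes obtained by then. If $F(|\psi\rangle\langle\psi|,\rho^{in}_i)\le1-\mu$ for every query $i$ (for $\mu=1$: the challenge is orthogonal to all queries), then the challenger outputs the result of $\mathcal T_\lambda$ on $\rho_t^{\otimes\kappa_1}$ and $(U_k|\psi\rangle\langle\psi|U_k^\dagger)^{\otimes\kappa_2}$; otherwise $\mathcal A$ loses. In the *selective* game there are no queries in step (i). Put $P_{ov}(\mu)=f(\kappa_1,\kappa_2,1-\mu)$, the probability that the test accepts a state of fidelity $1-\mu$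 with the correct answer. The primitive is *$\mu$-qGSU* if every QPT $\mathcal A$ wins the selective game with probability at most $P_{ov}(\mu)+negl(\lambda)$, and *$\mu$-qGEU* if every QPT $\mathcal A$ wins the (existential) game with probability at most $negl(\lambda)$. **Theorem.** Let the evaluation unitaries $\{U_k\}$ of a deterministic quantum primitive be a PRU. Then the primitive is $1$-qGSU secure; and if the error $P_{ov}(1)$ of its verification test on orthogonal states is negligible, then it is also $1$-qGEU secure. -/

import Mathlib

noncomputable section

namespace QUnf

open scoped ComplexOrder

/-! ## Qubits, kets and density matrices -/

/-- A (not necessarily normalised) pure state of the qubits indexed by `ι`, given by its amplitudes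
in the computational basis. -/
abbrev Ket (ι : Type) := (ι → Bool) → ℂ

/-- Operators on the qubits indexed by `ι`, as matrices in the computational basis. -/
abbrev Op (ι : Type) := Matrix (ι → Bool) (ι → Bool) ℂ

/-- The unitary group of `n` qubits (dimension `D = 2 ^ n`). -/
abbrev QUnitary (n : ℕ) := Matrix.unitaryGroup (Fin n → Bool) ℂ

section States

variable {ι : Type} [Fintype ι] [DecidableEq ι]

/-- The computational basis state `|b⟩`. -/
def basisKet (b : ι → Bool) : Ket ι := fun x => if x = b then 1 else 0

/-- The squared Euclidean norm of a ket. -/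
def weight (ψ : Ket ι) : ℝ := ∑ x, ‖ψ x‖ ^ 2

/-- The rank one operator `|ψ⟩⟨ψ|`. -/
def pureState (ψ : Ket ι) : Op ι := Matrix.vecMulVec ψ (star ψ)

/-- Density matrices. -/
def IsDensity (ρ : Op ι) : Prop := ρ.PosSemidef ∧ ρ.trace = 1

/-- The matrix `V` applied to the `k` wires selected by `f`, and the identity on all other wires. -/
def applyOn {k : ℕ} (f : Fin k ↪ ι) (V : Op (Fin k)) (ψ : Ket ι) : Ket ι :=
  fun x => ∑ y : Fin k → Bool, V (x ∘ f) y * ψ (Function.extend f y x)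

/-- The (unnormalised) projection of `ψ` onto the outcome `s` of a computational basis measurement
of the wires selected by `f`. -/
def projectOn {k : ℕ} (f : Fin k ↪ ι) (s : Fin k → Bool) (ψ : Ket ι) : Ket ι :=
  fun x => if x ∘ f = s then ψ x else 0

/-- The state of the wires selected by `f` (partial trace over all other wires), normalised. -/
def reducedState {k : ℕ} (f : Fin k ↪ ι) (ψ : Ket ι) : Op (Fin k) :=
  fun a b => ((weight ψ)⁻¹ : ℂ) *
    ∑ x : ι → Bool, if x ∘ f = a then ψ x * star (ψ (Function.extend f b x)) else 0

end States

section Fidelity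

open scoped MatrixOrder

variable {ι : Type} [Fintype ι] [DecidableEq ι]

/-- The Uhlmann fidelity `F(ρ, σ) = (Tr √(√ρ σ √ρ))²`. -/
def fidelity (ρ σ : Op ι) : ℝ :=
  (CFC.sqrt (CFC.sqrt ρ * σ * CFC.sqrt ρ)).trace.re ^ 2

/-- `μ`-distinguishability of two states. -/
def Distinguishable (μ : ℝ) (ρ σ : Op ι) : Prop :=
  0 ≤ fidelity ρ σ ∧ fidelity ρ σ ≤ 1 - μ

end Fidelity

/-! ## The Haar probability measure -/

instance (n : ℕ) : MeasurableSpace (QUnitary n) := borel _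

instance (n : ℕ) : BorelSpace (QUnitary n) := ⟨rfl⟩

instance (n : ℕ) : CompactSpace (QUnitary n) := by
  apply isCompact_iff_compactSpace.mp
  have hb : IsCompact (Set.univ.pi fun _ : Fin n → Bool =>
      Set.univ.pi fun _ : Fin n → Bool => Metric.closedBall (0 : ℂ) 1) :=
    isCompact_univ_pi fun _ => isCompact_univ_pi fun _ => isCompact_closedBall _ _
  have hc : IsClosed {A : Op (Fin n) | A ∈ Matrix.unitaryGroup (Fin n → Bool) ℂ} := by
    have : {A : Op (Fin n) | A ∈ Matrix.unitaryGroup (Fin n → Bool) ℂ}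
        = {A : Op (Fin n) | A * star A = 1} := by
      ext A
      exact Matrix.mem_unitaryGroup_iff
    rw [this]
    exact isClosed_eq (continuous_id.mul continuous_star) continuous_const
  refine hb.of_isClosed_subset hc ?_
  intro A hA i _ j _
  simpa using entry_norm_bound_of_unitary hA i j

/-- The Haar measure on the unitary group, normalised to be a probability measure. -/
def haarUnitary (n : ℕ) : MeasureTheory.Measure (QUnitary n) :=
  MeasureTheory.Measure.haarMeasure ⊤

/-! ## Quantum circuits with oracle queries and intermediate measurements -/

/-- An elementary gate: a unitary acting on at most three wires. -/
structure Gate (ι : Type) where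
  arity : ℕ
  arity_le : arity ≤ 3
  wires : Fin arity ↪ ι
  mat : QUnitary arity

/-- An instruction: an elementary gate, a query to an oracle acting on `n` qubits (the wires on
which the oracle acts are given), or a measurement of one wire in the computational basis. -/
inductive Instr (n : ℕ) (ι : Type) where
  | gate (g : Gate ι)
  | query (e : Fin n ↪ ι)
  | measure (i : ι)

/-- One branch of a run, i.e. one sequence of measurement outcomes: the unnormalised state, whose
weight is the probability of the branch, and the list of the states `ρᵢⁱⁿ` of the query register
at the queries made so far. -/
structure Branch (n : ℕ) (ι : Type) where
  state : Ket ι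
  queries : List (Op (Fin n))

section Runs

variable {n : ℕ} {ι : Type} [Fintype ι] [DecidableEq ι]

def Gate.apply (g : Gate ι) (ψ : Ket ι) : Ket ι := applyOn g.wires g.mat.1 ψ

/-- The action of a circuit of elementary gates. -/
def applyGates (c : List (Gate ι)) (ψ : Ket ι) : Ket ι := c.foldl (fun φ g => g.apply φ) ψ

/-- All branches of the run of a circuit with oracle `U`, started in a given branch. -/
def run (U : QUnitary n) : List (Instr n ι) → Branch n ι → List (Branch n ι)
  | [], b => [b]
  | .gate g :: c, b => run U c { b with state := g.apply b.state }
  | .query e :: c, b =>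
      run U c
        { state := applyOn e U.1 b.state
          queries := b.queries ++ [reducedState e b.state] }
  | .measure i :: c, b =>
      run U c { b with state := fun x => if x i = false then b.state x else 0 } ++
      run U c { b with state := fun x => if x i = true then b.state x else 0 }

/-- The initial branch: all wires are in the state `|0⟩`, and no query has been made. -/
def initBranch (n : ℕ) (ι : Type) [Fintype ι] [DecidableEq ι] : Branch n ι :=
  { state := basisKet fun _ => false
    queries := [] }

def Instr.IsQuery : Instr n ι → Prop
  | .query _ => True
  | _ => False

end Runs

/-! ## Negligible functions -/

def IsNegligible (ε : ℕ → ℝ) : Prop :=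
  (∀ lam, 0 ≤ ε lam) ∧ ∀ c : ℕ, ∀ᶠ lam : ℕ in Filter.atTop, ε lam ≤ 1 / (lam : ℝ) ^ c

def PolyBounded (f : ℕ → ℕ) : Prop := ∃ p : Polynomial ℕ, ∀ lam, f lam ≤ p.eval lam

/-! ## Pseudorandom unitaries -/

/-- An oracle circuit with one output bit. -/
structure Distinguisher (n : ℕ) where
  Wire : Type
  [fintypeWire : Fintype Wire]
  [decEqWire : DecidableEq Wire]
  circuit : List (Instr n Wire)
  out : Wire

attribute [instance] Distinguisher.fintypeWire Distinguisher.decEqWire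

namespace Distinguisher

variable {n : ℕ}

def size (A : Distinguisher n) : ℕ := Fintype.card A.Wire + A.circuit.length

/-- `Pr[A^U = 1]`. -/
def acceptProb (A : Distinguisher n) (U : QUnitary n) : ℝ :=
  ((run U A.circuit (initBranch n A.Wire)).map fun b =>
    ∑ x : A.Wire → Bool, if x A.out = true then ‖b.state x‖ ^ 2 else 0).sum

end Distinguisher

/-- Pseudorandomness of a keyed family of unitaries on `n lam` qubits: for a uniformly random key it
cannot be told apart from a Haar random unitary by oracle circuits of polynomial size. -/
def IsPRU (n : ℕ → ℕ) (Key : ℕ → Type) [∀ lam, Fintype (Key lam)]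
    (U : ∀ lam, Key lam → QUnitary (n lam)) : Prop :=
  ∀ A : ∀ lam, Distinguisher (n lam), PolyBounded (fun lam => (A lam).size) →
    IsNegligible fun lam =>
      |(∑ k : Key lam, (A lam).acceptProb (U lam k)) / (Fintype.card (Key lam) : ℝ) -
        ∫ V, (A lam).acceptProb V ∂(haarUnitary (n lam))|

/-! ## Quantum test algorithms -/

/-- `ρ^{⊗κ}`. -/
def tensorPow {X : Type} (κ : ℕ) (ρ : Matrix X X ℂ) : Matrix (Fin κ → X) (Fin κ → X) ℂ :=
  fun a b => ∏ i, ρ (a i) (b i)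

/-- A quantum equality test for states of `n` qubits. On `κ₁` copies of `ρ` and `κ₂` copies of `σ`
it performs the two-outcome measurement with effects `effect κ₁ κ₂` (equal) and
`1 - effect κ₁ κ₂` (different). The reference state `σ` is pure, as is the case for the correct
answers in the unforgeability game; the tested state `ρ` is arbitrary. The acceptance
probability is a function `f κ₁ κ₂` of the fidelity (which is symmetric). -/
structure QuantumTest (n : ℕ) where
  effect : ∀ κ₁ κ₂ : ℕ,
    Matrix ((Fin κ₁ → Fin n → Bool) × (Fin κ₂ → Fin n → Bool))
      ((Fin κ₁ → Fin n → Bool) × (Fin κ₂ → Fin n → Bool)) ℂ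
  effect_nonneg : ∀ κ₁ κ₂, (effect κ₁ κ₂).PosSemidef
  effect_le_one : ∀ κ₁ κ₂, (1 - effect κ₁ κ₂).PosSemidef
  f : ℕ → ℕ → ℝ → ℝ
  err : ℕ → ℕ → ℝ
  accept_eq : ∀ (κ₁ κ₂ : ℕ) (ρ : Op (Fin n)) (ψ : Ket (Fin n)), IsDensity ρ → weight ψ = 1 →
    (effect κ₁ κ₂ * Matrix.kronecker (tensorPow κ₁ ρ) (tensorPow κ₂ (pureState ψ))).trace =
      ((f κ₁ κ₂ (fidelity (pureState ψ) ρ) : ℝ) : ℂ)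
  tendsto_one : ∀ κ₁ κ₂ : ℕ, 0 < κ₁ → 0 < κ₂ →
    Filter.Tendsto (f κ₁ κ₂) (nhdsWithin 1 (Set.Iio 1)) (nhds 1)
  tendsto_copies : ∀ F ∈ Set.Icc (0 : ℝ) 1,
    Filter.Tendsto (fun κ : ℕ × ℕ => f κ.1 κ.2 F) Filter.atTop (nhds F)
  tendsto_zero : ∀ κ₁ κ₂ : ℕ, 0 < κ₁ → 0 < κ₂ →
    Filter.Tendsto (f κ₁ κ₂) (nhdsWithin 0 (Set.Ioi 0)) (nhds (err κ₁ κ₂))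

/-- `Pr[1 ← T(ρ^{⊗κ₁}, σ^{⊗κ₂})]`. -/
def QuantumTest.acceptProb {n : ℕ} (T : QuantumTest n) (κ₁ κ₂ : ℕ) (ρ σ : Op (Fin n)) : ℝ :=
  (T.effect κ₁ κ₂ * Matrix.kronecker (tensorPow κ₁ ρ) (tensorPow κ₂ σ)).trace.re

/-! ## Quantum primitives and the unforgeability games -/

/-- A deterministic quantum primitive. Setup draws a uniformly random key, evaluation under the key
`k` is the unitary `eval lam k`, and verification runs the test on `copies₁` copies of the
submitted tag and `copies₂` copies of the correct answer. -/
structure QuantumPrimitive where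
  qubits : ℕ → ℕ
  Key : ℕ → Type
  [fintypeKey : ∀ lam, Fintype (Key lam)]
  [nonemptyKey : ∀ lam, Nonempty (Key lam)]
  eval : ∀ lam, Key lam → QUnitary (qubits lam)
  test : ∀ lam, QuantumTest (qubits lam)
  copies₁ : ℕ → ℕ
  copies₂ : ℕ → ℕ

attribute [instance] QuantumPrimitive.fintypeKey QuantumPrimitive.nonemptyKey

/-- A forger against an oracle on `n` qubits. It runs `phase₁`; then the wires `desc` are measured,
and the outcome `s` is submitted as the classical description of the challenge: the pure state
which the circuit `prep` prepares from `|s⟩|0…0⟩`. Then it runs `phase₂` and submits as its tag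
the state of the wires `tag`. -/
structure Adversary (n : ℕ) where
  Wire : Type
  [fintypeWire : Fintype Wire]
  [decEqWire : DecidableEq Wire]
  Anc : Type
  [fintypeAnc : Fintype Anc]
  [decEqAnc : DecidableEq Anc]
  descLen : ℕ
  desc : Fin descLen ↪ Wire
  prep : List (Gate ((Fin descLen ⊕ Fin n) ⊕ Anc))
  phase₁ : List (Instr n Wire)
  phase₂ : List (Instr n Wire)
  tag : Fin n ↪ Wire

attribute [instance] Adversary.fintypeWire Adversary.decEqWire Adversary.fintypeAnc
  Adversary.decEqAnc

namespace Adversary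

variable {n : ℕ}

def size (A : Adversary n) : ℕ :=
  Fintype.card A.Wire + Fintype.card A.Anc + A.prep.length + A.phase₁.length + A.phase₂.length

/-- The basis label `(s, x, 0…0)` of the wires of the preparation circuit. -/
def prepLabel (A : Adversary n) (s : Fin A.descLen → Bool) (x : Fin n → Bool) :
    (Fin A.descLen ⊕ Fin n) ⊕ A.Anc → Bool :=
  Sum.elim (Sum.elim s x) fun _ => false

/-- The challenge state described by `s`: the vector `ψ` with
`⟨s, x, 0| prep |s, 0, 0⟩ = ψ x`. If `ψ` is a unit vector, then `prep` maps `|s⟩|0⟩|0⟩` to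
`|s⟩|ψ⟩|0⟩`; otherwise `s` is not the description of a pure state. -/
def challenge (A : Adversary n) (s : Fin A.descLen → Bool) : Ket (Fin n) :=
  fun x => applyGates A.prep (basisKet (A.prepLabel s fun _ => false)) (A.prepLabel s x)

/-- The challenge is committed to before the first query. -/
def Selective (A : Adversary n) : Prop := ∀ i ∈ A.phase₁, ¬ i.IsQuery

/-- In the final branch `b`, in which `s` was submitted, the description is valid and the challenge
is `μ`-distinguishable from every query made in this branch, before and after the challenge. -/
def ChallengeOK (A : Adversary n) (μ : ℝ) (s : Fin A.descLen → Bool) (b : Branch n A.Wire) :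
    Prop :=
  weight (A.challenge s) = 1 ∧ ∀ ρ ∈ b.queries, Distinguishable μ (pureState (A.challenge s)) ρ

open Classical in
/-- The probability that the forger wins the game against the oracle `U` with verification by the
test `T` on `κ₁` copies of the tag and `κ₂` copies of the correct answer: the sum over all
branches in which the condition on the challenge is met of the probability of the branch times
the probability that the tag is accepted. -/
def winProb (A : Adversary n) (μ : ℝ) (T : QuantumTest n) (κ₁ κ₂ : ℕ) (U : QUnitary n) : ℝ :=
  ((run U A.phase₁ (initBranch n A.Wire)).map fun b₁ =>
    ∑ s : Fin A.descLen → Bool,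
      ((run U A.phase₂ { b₁ with state := projectOn A.desc s b₁.state }).map fun b =>
        if A.ChallengeOK μ s b then
          weight b.state *
            T.acceptProb κ₁ κ₂ (reducedState A.tag b.state)
              (pureState (U.1.mulVec (A.challenge s)))
        else 0).sum).sum

end Adversary

namespace QuantumPrimitive

variable (P : QuantumPrimitive)

/-- The winning probability in the game with parameter `μ`, over the choice of the key. -/
def gameProb (μ : ℝ) (lam : ℕ) (A : Adversary (P.qubits lam)) : ℝ :=
  (∑ k : P.Key lam,
      A.winProb μ (P.test lam) (P.copies₁ lam) (P.copies₂ lam) (P.eval lam k)) /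
    (Fintype.card (P.Key lam) : ℝ)

/-- The overlap probability: the probability that the test accepts, in place of the correct answer,
the answer to a query of the maximal fidelity `1 - μ` with the challenge. -/
def overlapProb (μ : ℝ) (lam : ℕ) : ℝ :=
  (P.test lam).f (P.copies₁ lam) (P.copies₂ lam) (1 - μ)

/-- Quantum generalised existential unforgeability. -/
def QGEU (μ : ℝ) : Prop :=
  ∀ A : ∀ lam, Adversary (P.qubits lam), PolyBounded (fun lam => (A lam).size) →
    ∃ ε : ℕ → ℝ, IsNegligible ε ∧ ∀ lam, P.gameProb μ lam (A lam) ≤ ε lam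

/-- Quantum generalised selective unforgeability. -/
def QGSU (μ : ℝ) : Prop :=
  ∀ A : ∀ lam, Adversary (P.qubits lam), PolyBounded (fun lam => (A lam).size) →
    (∀ lam, (A lam).Selective) →
    ∃ ε : ℕ → ℝ, IsNegligible ε ∧
      ∀ lam, P.gameProb μ lam (A lam) ≤ P.overlapProb μ lam + ε lam

end QuantumPrimitive

end QUnf

end

/-! Let D = 2^n and let the adversary make q queries. Along a fixed sequence of measurement outcomes
the unnormalised final state is multilinear in the q answers, so its amplitudes are forms X_z(U, …,
U), where z is the label of the tag register. The overlap of the tag with the correct answer Uψ is Y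
= ∑_z conj((Uψ)_z) X_z. What can be gained by having queried ψ itself is, to leading order, 1/D
times the divergence ∑_z ∑_k X_z(…, |z⟩⟨ψ|, …), where the k-th answer is replaced by |z⟩⟨ψ|. The
`residual` is Y minus this correction, and `leakage` is the sum of |residual|² over all paths. If ψ
is orthogonal to every query of a path, then ⟨ψ| annihilates the query registers, the correction
vanishes and the residual is Y (`Adversary.contract_eq_residual`). Since the leakage is defined
without any orthogonality condition, no distinguisher has to check the condition of the game.

Test: evaluated on commuting states, the acceptance probability is a polynomial in the fidelity F
with f(F) ≤ f(0) + κ₁ F (`QuantumTest.f_zero_eq`). Hence the winning probability is at most f(0) +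
κ₁ · leakage (`Adversary.winProb_le`), with f(0) = P_ov(1).

Haar average: differentiating left invariance along one-parameter groups gives an integration by
parts formula for holomorphic functions on the unitary group (`integral_conj_mul_fderiv`). Two
applications turn the second moment of Y − divergence/D into three terms, all mixed moments
cancelling (`integral_sub_divergence`). These terms are bounded by Cauchy–Schwarz, because for fixed
y the operators |y⟩⟨w|U, with w running over all labels, conserve total probability. The average
leakage is at most 1/D + (q + q²)/√D (`Adversary.integral_leakage_le`).

From Haar to keys: the residual is 1/D times a signed sum of (q + 1)D amplitudes, one for each pair
of a query or none and a label y. Hence the leakage is D⁻² times a signed sum of inner products,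
each of which is read off from a Hadamard test of polynomial size (`Adversary.leakage_eq`). The
number of pairs of terms is (q + 1)² D², so the factor D⁻² absorbs their exponential number, and the
averages over keys and over the Haar measure differ by at most 2(q + 1)² times the largest
distinguishing advantage (`Adversary.average_leakage_le`). Pseudorandomness makes this negligible.
The resulting bound (`gameProb_le_overlapProb_add`) serves both games. -/

noncomputable section
namespace QUnf

open Matrix

set_option linter.unusedSectionVars false

/-! ### Splitting basis labels into selected and remaining wires. -/

section Splitting

variable {ι : Type} {k : ℕ}

/-- Labels of the wires not selected by `f`. -/
abbrev Rest (f : Fin k ↪ ι) : Type := {w : ι // w ∉ Set.range f} → Bool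

open Classical in
/-- A basis label splits into its values on the selected wires and on the remaining ones. -/
def split (f : Fin k ↪ ι) : (ι → Bool) ≃ (Fin k → Bool) × Rest f where
  toFun x := (x ∘ f, fun w => x w)
  invFun p := Function.extend f p.1 fun i => if h : i ∈ Set.range f then false else p.2 ⟨i, h⟩
  left_inv x := by
    funext i
    by_cases h : ∃ a, f a = i
    · obtain ⟨a, rfl⟩ := h
      exact f.injective.extend_apply _ _ a
    · refine (Function.extend_apply' _ _ _ h).trans ?_
      exact dif_neg h
  right_inv p := by
    refine Prod.ext ?_ ?_
    · funext a
      dsimp only [Function.comp_apply]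
      exact f.injective.extend_apply p.1 _ a
    · funext w
      dsimp only
      refine (Function.extend_apply' _ _ _ w.2).trans ?_
      exact dif_neg w.2

/-- The basis label with given values on the selected wires and on the remaining ones. -/
def join (f : Fin k ↪ ι) (a : Fin k → Bool) (r : Rest f) : ι → Bool := (split f).symm (a, r)

@[simp] lemma join_comp (f : Fin k ↪ ι) (a : Fin k → Bool) (r : Rest f) : join f a r ∘ f = a :=
  congrArg Prod.fst ((split f).apply_symm_apply (a, r))

lemma extend_eq_join (f : Fin k ↪ ι) (b : Fin k → Bool) (x : ι → Bool) :
    Function.extend f b x = join f b (split f x).2 := by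
  apply (split f).injective
  rw [join, Equiv.apply_symm_apply]
  refine Prod.ext (Function.extend_comp f.injective b x) ?_
  funext w
  exact Function.extend_apply' _ _ _ w.2

@[simp] lemma extend_join (f : Fin k ↪ ι) (a b : Fin k → Bool) (r : Rest f) :
    Function.extend f b (join f a r) = join f b r := by
  rw [extend_eq_join, join, join, Equiv.apply_symm_apply]
  rfl

lemma join_split (f : Fin k ↪ ι) (x : ι → Bool) : join f (x ∘ f) (split f x).2 = x :=
  (split f).symm_apply_apply x

instance [Fintype ι] (f : Fin k ↪ ι) : Fintype (Rest f) := by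
  classical exact inferInstance

lemma sum_join [Fintype ι] [DecidableEq ι] {M : Type*} [AddCommMonoid M] (f : Fin k ↪ ι)
    (F : (ι → Bool) → M) : ∑ x, F x = ∑ r : Rest f, ∑ a, F (join f a r) := by
  rw [← (split f).symm.sum_comp, Fintype.sum_prod_type, Finset.sum_comm]
  rfl

end Splitting

/-! ### Operators acting on selected wires. -/

section Local

variable {ι : Type} [Fintype ι] [DecidableEq ι] {k : ℕ}

lemma applyOn_join (f : Fin k ↪ ι) (V : Op (Fin k)) (φ : Ket ι) (a : Fin k → Bool) (r : Rest f) :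
    applyOn f V φ (join f a r) = ∑ y, V a y * φ (join f y r) := by
  simp [applyOn]

lemma weight_join (f : Fin k ↪ ι) (φ : Ket ι) :
    weight φ = ∑ r : Rest f, ∑ a, ‖φ (join f a r)‖ ^ 2 := sum_join f _

lemma weight_nonneg (φ : Ket ι) : 0 ≤ weight φ := Finset.sum_nonneg fun _ _ => by positivity

lemma weight_eq_zero {φ : Ket ι} : weight φ = 0 ↔ φ = 0 := by
  rw [weight, Finset.sum_eq_zero_iff_of_nonneg (fun _ _ => by positivity)]
  simp [funext_iff]

lemma weight_smul (c : ℂ) (φ : Ket ι) : weight (c • φ) = ‖c‖ ^ 2 * weight φ := by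
  simp [weight, Finset.mul_sum, mul_pow]

lemma ofReal_weight (φ : Ket ι) : (weight φ : ℂ) = star φ ⬝ᵥ φ := by
  simp only [weight, dotProduct, Complex.ofReal_sum, Pi.star_apply, RCLike.star_def]
  exact Finset.sum_congr rfl fun x _ => by
    rw [Complex.conj_mul']; norm_cast

lemma weight_basisKet (b : ι → Bool) : weight (basisKet b) = 1 := by
  simp [weight, basisKet, apply_ite, ite_pow]

lemma weight_mulVec {V : Op ι} (hV : V ∈ Matrix.unitaryGroup (ι → Bool) ℂ) (φ : Ket ι) :
    weight (V *ᵥ φ) = weight φ := by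
  have h : (weight (V *ᵥ φ) : ℂ) = weight φ := by
    rw [ofReal_weight, ofReal_weight, star_mulVec, ← dotProduct_mulVec, mulVec_mulVec]
    have := Matrix.mem_unitaryGroup_iff'.1 hV
    rw [star_eq_conjTranspose] at this
    rw [this, one_mulVec]
  exact_mod_cast h

lemma weight_applyOn (f : Fin k ↪ ι) {V : Op (Fin k)}
    (hV : V ∈ Matrix.unitaryGroup (Fin k → Bool) ℂ) (φ : Ket ι) :
    weight (applyOn f V φ) = weight φ := by
  rw [weight_join f, weight_join f]
  refine Finset.sum_congr rfl fun r _ => ?_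
  have := weight_mulVec hV fun y => φ (join f y r)
  simpa only [weight, applyOn_join, mulVec, dotProduct] using this

lemma applyOn_add (f : Fin k ↪ ι) (V : Op (Fin k)) (φ ψ : Ket ι) :
    applyOn f V (φ + ψ) = applyOn f V φ + applyOn f V ψ := by
  funext x; simp [applyOn, mul_add, Finset.sum_add_distrib]

lemma applyOn_smul (f : Fin k ↪ ι) (V : Op (Fin k)) (c : ℂ) (φ : Ket ι) :
    applyOn f V (c • φ) = c • applyOn f V φ := by
  funext x; simp [applyOn, mul_left_comm, Finset.mul_sum]

lemma add_applyOn (f : Fin k ↪ ι) (V W : Op (Fin k)) (φ : Ket ι) :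
    applyOn f (V + W) φ = applyOn f V φ + applyOn f W φ := by
  funext x; simp [applyOn, add_mul, Finset.sum_add_distrib]

lemma smul_applyOn (f : Fin k ↪ ι) (c : ℂ) (V : Op (Fin k)) (φ : Ket ι) :
    applyOn f (c • V) φ = c • applyOn f V φ := by
  funext x; simp [applyOn, mul_assoc, Finset.mul_sum]

lemma sum_weight_projectOn (f : Fin k ↪ ι) (φ : Ket ι) :
    ∑ s, weight (projectOn f s φ) = weight φ := by
  simp only [weight, projectOn]
  rw [Finset.sum_comm]
  refine Finset.sum_congr rfl fun x _ => ?_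
  simp [apply_ite, ite_pow]

/-- The operator `|y⟩⟨w| V`. -/
def rowOp (V : Op (Fin k)) (y w : Fin k → Bool) : Op (Fin k) := fun a b => if a = y then V w b else 0

/-- For fixed y the operators |y⟩⟨w|V are the Kraus operators of a channel: apply V, measure, and
reset the wires to y. Total probability is therefore conserved. All later norm bounds for rank one
insertions rest on this. -/
lemma sum_weight_rowOp (f : Fin k ↪ ι) {V : Op (Fin k)}
    (hV : V ∈ Matrix.unitaryGroup (Fin k → Bool) ℂ) (y : Fin k → Bool) (φ : Ket ι) :
    ∑ w, weight (applyOn f (rowOp V y w) φ) = weight φ := by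
  rw [← weight_applyOn f hV, weight_join f (applyOn f V φ)]
  simp only [weight_join f]
  rw [Finset.sum_comm]
  refine Finset.sum_congr rfl fun r _ => Finset.sum_congr rfl fun w _ => ?_
  rw [Finset.sum_eq_single y]
  · simp [applyOn_join, rowOp]
  · intro a _ ha
    simp [applyOn_join, rowOp, ha]
  · simp

end Local

/-! ### Evolution along a fixed sequence of measurement outcomes. -/

section Paths

variable {n : ℕ} {ι : Type}

/-- The possible sequences of measurement outcomes of a circuit. -/
@[reducible] def Hist : List (Instr n ι) → Type
  | [] => Unit
  | .gate _ :: c => Hist c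
  | .query _ :: c => Hist c
  | .measure _ :: c => Bool × Hist c

@[reducible] def Hist.fintype : (c : List (Instr n ι)) → Fintype (Hist c)
  | [] => inferInstanceAs (Fintype Unit)
  | .gate _ :: c => Hist.fintype c
  | .query _ :: c => Hist.fintype c
  | .measure _ :: c => @instFintypeProd Bool (Hist c) _ (Hist.fintype c)

instance (c : List (Instr n ι)) : Fintype (Hist c) := Hist.fintype c

/-- The number of queries of a circuit. -/
def numQueries : List (Instr n ι) → ℕ
  | [] => 0
  | .gate _ :: c => numQueries c
  | .query _ :: c => numQueries c + 1
  | .measure _ :: c => numQueries c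

lemma numQueries_le (c : List (Instr n ι)) : numQueries c ≤ c.length := by
  induction c with
  | nil => rfl
  | cons a c ih => cases a <;> simp only [numQueries, List.length_cons] <;> omega

variable [Fintype ι] [DecidableEq ι]

/-- The projection onto one outcome of the measurement of one wire. -/
def projWire (i : ι) (b : Bool) (φ : Ket ι) : Ket ι := fun x => if x i = b then φ x else 0

/-- The unnormalised final state given the measurement outcomes, when the `k`-th query is
answered with the matrix `O k`. -/
def evolve : (c : List (Instr n ι)) → (O : ℕ → Op (Fin n)) → Hist c → Ket ι → Ket ι
  | [], _, _, φ => φ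
  | .gate g :: c, O, h, φ => evolve c O h (g.apply φ)
  | .query e :: c, O, h, φ => evolve c (fun k => O (k + 1)) h (applyOn e (O 0) φ)
  | .measure i :: c, O, h, φ => evolve c O h.2 (projWire i h.1 φ)

lemma weight_projWire (i : ι) (φ : Ket ι) :
    weight (projWire i false φ) + weight (projWire i true φ) = weight φ := by
  rw [weight, weight, weight, ← Finset.sum_add_distrib]
  refine Finset.sum_congr rfl fun x _ => ?_
  cases h : x i <;> simp [projWire, h]

lemma projWire_add (i : ι) (b : Bool) (φ ψ : Ket ι) :
    projWire i b (φ + ψ) = projWire i b φ + projWire i b ψ := by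
  funext x; by_cases h : x i = b <;> simp [projWire, h]

lemma projWire_smul (i : ι) (b : Bool) (c : ℂ) (φ : Ket ι) :
    projWire i b (c • φ) = c • projWire i b φ := by
  funext x; by_cases h : x i = b <;> simp [projWire, h]

lemma evolve_add (c : List (Instr n ι)) (O : ℕ → Op (Fin n)) (h : Hist c) (φ ψ : Ket ι) :
    evolve c O h (φ + ψ) = evolve c O h φ + evolve c O h ψ := by
  induction c generalizing O φ ψ with
  | nil => rfl
  | cons a c ih =>
    cases a with
    | gate g => simp only [evolve, Gate.apply, applyOn_add]; exact ih ..
    | query e => simp only [evolve, applyOn_add]; exact ih ..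
    | measure i => simp only [evolve, projWire_add]; exact ih ..

lemma evolve_smul (c : List (Instr n ι)) (O : ℕ → Op (Fin n)) (h : Hist c) (z : ℂ) (φ : Ket ι) :
    evolve c O h (z • φ) = z • evolve c O h φ := by
  induction c generalizing O φ with
  | nil => rfl
  | cons a c ih =>
    cases a with
    | gate g => simp only [evolve, Gate.apply, applyOn_smul]; exact ih ..
    | query e => simp only [evolve, applyOn_smul]; exact ih ..
    | measure i => simp only [evolve, projWire_smul]; exact ih ..

lemma update_tail_succ {α : Type*} (O : ℕ → α) (k : ℕ) (A : α) :
    (fun j => Function.update O (k + 1) A (j + 1)) = Function.update (fun j => O (j + 1)) k A := by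
  funext j; simp [Function.update_apply]

lemma update_tail_zero {α : Type*} (O : ℕ → α) (A : α) :
    (fun j => Function.update O 0 A (j + 1)) = fun j => O (j + 1) := by
  funext j; simp

lemma evolve_query_update_zero (e : Fin n ↪ ι) (c : List (Instr n ι)) (O : ℕ → Op (Fin n))
    (h : Hist c) (φ : Ket ι) (A : Op (Fin n)) :
    evolve (.query e :: c) (Function.update O 0 A) h φ =
      evolve c (fun j => O (j + 1)) h (applyOn e A φ) := by
  simp only [evolve, update_tail_zero, Function.update_self]

lemma evolve_query_update_succ (e : Fin n ↪ ι) (c : List (Instr n ι)) (O : ℕ → Op (Fin n))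
    (h : Hist c) (φ : Ket ι) (k : ℕ) (A : Op (Fin n)) :
    evolve (.query e :: c) (Function.update O (k + 1) A) h φ =
      evolve c (Function.update (fun j => O (j + 1)) k A) h (applyOn e (O 0) φ) := by
  simp only [evolve, update_tail_succ]
  rw [Function.update_of_ne (by omega)]

/-- Each answer enters exactly once, and linearly; this yields the multilinearity of the final
amplitudes. The bound on `k` is essential: an index beyond the last query does not enter at all, and
additivity would fail. -/
lemma evolve_update_add (c : List (Instr n ι)) (O : ℕ → Op (Fin n)) (h : Hist c) (φ : Ket ι)
    (k : ℕ) (hk : k < numQueries c) (A B : Op (Fin n)) :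
    evolve c (Function.update O k (A + B)) h φ =
      evolve c (Function.update O k A) h φ + evolve c (Function.update O k B) h φ := by
  induction c generalizing O φ k with
  | nil => simp [numQueries] at hk
  | cons a c ih =>
    cases a with
    | gate g => exact ih _ _ _ _ hk
    | query e =>
      cases k with
      | zero => simp only [evolve_query_update_zero, add_applyOn, evolve_add]
      | succ k =>
        simp only [evolve_query_update_succ]
        exact ih _ _ _ _ (by simpa [numQueries] using hk)
    | measure i => exact ih _ _ _ _ hk

lemma evolve_update_smul (c : List (Instr n ι)) (O : ℕ → Op (Fin n)) (h : Hist c) (φ : Ket ι)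
    (k : ℕ) (hk : k < numQueries c) (z : ℂ) (A : Op (Fin n)) :
    evolve c (Function.update O k (z • A)) h φ = z • evolve c (Function.update O k A) h φ := by
  induction c generalizing O φ k with
  | nil => simp [numQueries] at hk
  | cons a c ih =>
    cases a with
    | gate g => exact ih _ _ _ _ hk
    | query e =>
      cases k with
      | zero => simp only [evolve_query_update_zero, smul_applyOn, evolve_smul]
      | succ k =>
        simp only [evolve_query_update_succ]
        exact ih _ _ _ _ (by simpa [numQueries] using hk)
    | measure i => exact ih _ _ _ _ hk

lemma evolve_congr (c : List (Instr n ι)) (O O' : ℕ → Op (Fin n)) (h : Hist c) (φ : Ket ι)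
    (hO : ∀ k < numQueries c, O k = O' k) : evolve c O h φ = evolve c O' h φ := by
  induction c generalizing O O' φ with
  | nil => rfl
  | cons a c ih =>
    cases a with
    | gate g => exact ih _ _ _ _ hO
    | query e =>
      simp only [evolve]
      rw [hO 0 (by simp [numQueries])]
      exact ih _ _ _ _ fun k hk => hO _ (by simpa [numQueries] using hk)
    | measure i => exact ih _ _ _ _ hO

lemma sum_hist_measure {M : Type*} [AddCommMonoid M] (i : ι) (c : List (Instr n ι))
    (F : Hist (.measure i :: c) → M) :
    ∑ h, F h = ∑ h : Hist c, F (false, h) + ∑ h : Hist c, F (true, h) := by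
  rw [show (∑ h, F h) = ∑ h : Bool × Hist c, F h from rfl, Fintype.sum_prod_type, Fintype.sum_bool,
    add_comm]

lemma sum_weight_evolve_measure (i : ι) (c : List (Instr n ι))
    (O : ℕ → Op (Fin n)) (φ : Ket ι) :
    ∑ h, weight (evolve (.measure i :: c) O h φ) =
      ∑ h, weight (evolve c O h (projWire i false φ)) + ∑ h, weight (evolve c O h (projWire i true φ)) :=
  sum_hist_measure i c _

lemma sum_weight_evolve (c : List (Instr n ι)) {O : ℕ → Op (Fin n)}
    (hO : ∀ k, O k ∈ Matrix.unitaryGroup (Fin n → Bool) ℂ) (φ : Ket ι) :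
    ∑ h, weight (evolve c O h φ) = weight φ := by
  induction c generalizing O φ with
  | nil => exact Fintype.sum_unique (ι := Unit) _
  | cons a c ih =>
    cases a with
    | gate g => exact (ih hO _).trans (weight_applyOn _ g.mat.2 _)
    | query e => exact (ih (fun k => hO _) _).trans (weight_applyOn _ (hO 0) _)
    | measure i =>
      rw [sum_weight_evolve_measure, ih hO, ih hO, weight_projWire]

/-- The k-th query is replaced by the channel "apply V, measure, reset to y", and everything before
and after it conserves the total weight. -/
lemma sum_weight_evolve_one (c : List (Instr n ι)) {O : ℕ → Op (Fin n)}
    (hO : ∀ k, O k ∈ Matrix.unitaryGroup (Fin n → Bool) ℂ) (φ : Ket ι)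
    (k : ℕ) (hk : k < numQueries c) {V : Op (Fin n)}
    (hV : V ∈ Matrix.unitaryGroup (Fin n → Bool) ℂ) (y : Fin n → Bool) :
    ∑ w, ∑ h, weight (evolve c (Function.update O k (rowOp V y w)) h φ) = weight φ := by
  induction c generalizing O φ k with
  | nil => simp [numQueries] at hk
  | cons a c ih =>
    cases a with
    | gate g => exact (ih hO _ _ hk).trans (weight_applyOn _ g.mat.2 _)
    | query e =>
      cases k with
      | zero =>
        simp only [evolve_query_update_zero]
        rw [← sum_weight_rowOp e hV y φ]
        exact Finset.sum_congr rfl fun w _ => sum_weight_evolve c (fun k => hO _) _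
      | succ k =>
        simp only [evolve_query_update_succ]
        exact (ih (fun k => hO _) _ _ (by simpa [numQueries] using hk)).trans
          (weight_applyOn _ (hO 0) _)
    | measure i =>
      refine (Finset.sum_congr rfl fun w _ => sum_weight_evolve_measure ..).trans ?_
      rw [Finset.sum_add_distrib, ih hO _ _ hk, ih hO _ _ hk, weight_projWire]

/-- The same with two reset channels at different queries. Whichever query is met first, the
remaining circuit contains only one replacement. -/
lemma sum_weight_evolve_two (c : List (Instr n ι)) {O : ℕ → Op (Fin n)}
    (hO : ∀ k, O k ∈ Matrix.unitaryGroup (Fin n → Bool) ℂ) (φ : Ket ι)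
    (k l : ℕ) (hk : k < numQueries c) (hl : l < numQueries c) (hkl : k ≠ l) {V W : Op (Fin n)}
    (hV : V ∈ Matrix.unitaryGroup (Fin n → Bool) ℂ)
    (hW : W ∈ Matrix.unitaryGroup (Fin n → Bool) ℂ) (y z : Fin n → Bool) :
    ∑ w, ∑ w', ∑ h, weight (evolve c (Function.update (Function.update O k (rowOp V y w))
      l (rowOp W z w')) h φ) = weight φ := by
  induction c generalizing O φ k l with
  | nil => simp [numQueries] at hk
  | cons a c ih =>
    cases a with
    | gate g => exact (ih hO _ _ _ hk hl hkl).trans (weight_applyOn _ g.mat.2 _)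
    | query e =>
      rcases k with _ | k <;> rcases l with _ | l
      · exact absurd rfl hkl
      · simp only [evolve_query_update_succ, update_tail_zero, Function.update_self]
        rw [← sum_weight_rowOp e hV y φ]
        exact Finset.sum_congr rfl fun w _ => sum_weight_evolve_one c (fun k => hO _) _ _
          (by simpa [numQueries] using hl) hW z
      · rw [Finset.sum_comm]
        simp only [evolve_query_update_zero, update_tail_succ]
        rw [← sum_weight_rowOp e hW z φ]
        exact Finset.sum_congr rfl fun w _ => sum_weight_evolve_one c (fun k => hO _) _ _
          (by simpa [numQueries] using hk) hV y
      · simp only [evolve_query_update_succ, update_tail_succ]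
        simp only [Function.update_of_ne (Nat.succ_ne_zero k).symm]
        exact (ih (fun k => hO _) _ _ _ (by simpa [numQueries] using hk)
          (by simpa [numQueries] using hl) (by simpa using hkl)).trans (weight_applyOn _ (hO 0) _)
    | measure i =>
      refine (Finset.sum_congr rfl fun w _ => Finset.sum_congr rfl fun w' _ =>
        sum_weight_evolve_measure ..).trans ?_
      simp only [Finset.sum_add_distrib]
      rw [ih hO _ _ _ hk hl hkl, ih hO _ _ _ hk hl hkl, weight_projWire]

end Paths

end QUnf

end

noncomputable section
namespace QUnf

open Matrix MeasureTheory
open scoped ComplexConjugate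

set_option linter.unusedSectionVars false

/-! ### Integration by parts for the Haar measure. -/

section Haar

variable {n : ℕ}

instance : IsProbabilityMeasure (haarUnitary n) :=
  ⟨by rw [haarUnitary]; simpa using Measure.haarMeasure_self (K₀ := (⊤ : TopologicalSpace.PositiveCompacts (QUnitary n)))⟩

instance : (haarUnitary n).IsMulLeftInvariant := by
  unfold haarUnitary; infer_instance

lemma integrable_haar {E : Type*} [NormedAddCommGroup E] [SecondCountableTopology E]
    {f : QUnitary n → E} (hf : Continuous f) : Integrable f (haarUnitary n) :=
  hf.integrable_of_hasCompactSupport (HasCompactSupport.of_compactSpace f)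

attribute [local instance] Matrix.linftyOpNormedRing Matrix.linftyOpNormedAlgebra

lemma exp_mem_unitaryGroup {H : Op (Fin n)} (hH : Hᴴ = -H) (t : ℝ) :
    NormedSpace.exp (t • H) ∈ Matrix.unitaryGroup (Fin n → Bool) ℂ := by
  let _ : NormedAlgebra ℚ (Op (Fin n)) := NormedAlgebra.restrictScalars ℚ ℂ _
  have : @ContinuousStar (Op (Fin n)) PseudoMetricSpace.toUniformSpace.toTopologicalSpace _ := ⟨continuous_id.matrix_conjTranspose⟩
  apply NormedSpace.exp_mem_unitary_of_mem_skewAdjoint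
  rw [skewAdjoint.mem_iff, star_eq_conjTranspose, conjTranspose_smul, hH]
  simp

lemma hasDerivAt_exp (H : Op (Fin n)) (t : ℝ) :
    HasDerivAt (fun t : ℝ => NormedSpace.exp (t • H)) (H * NormedSpace.exp (t • H)) t := by
  let _ : NormedAlgebra ℚ (Op (Fin n)) := NormedAlgebra.restrictScalars ℚ ℂ _
  exact hasDerivAt_exp_smul_const' H t

lemma continuous_fderiv_comp {K : Op (Fin n) → ℂ} (hK : ContDiff ℂ 1 K)
    {f : QUnitary n → Op (Fin n)} (hf : Continuous f) :
    Continuous fun U : QUnitary n => fderiv ℂ K U.1 (f U) :=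
  (hK.continuous_fderiv_apply one_ne_zero).comp (continuous_subtype_val.prodMk hf)

/-- By left invariance the integral of conj(G)·K at exp(tH)U does not depend on t, and the integrand
here is its derivative at t = 0. Differentiation under the integral is legitimate because the group
is compact: one constant bounds the derivative for all t and U. -/
lemma integral_skew {G K : Op (Fin n) → ℂ} (hG : ContDiff ℂ 1 G) (hK : ContDiff ℂ 1 K)
    {H : Op (Fin n)} (hH : Hᴴ = -H) :
    ∫ U : QUnitary n, (conj (fderiv ℂ G U.1 (H * U.1)) * K U.1 +
      conj (G U.1) * fderiv ℂ K U.1 (H * U.1)) ∂haarUnitary n = 0 := by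
  set Φ : QUnitary n → ℂ := fun U => conj (fderiv ℂ G U.1 (H * U.1)) * K U.1 +
      conj (G U.1) * fderiv ℂ K U.1 (H * U.1) with hΦ
  have hmul : Continuous fun U : QUnitary n => H * U.1 :=
    continuous_const.mul continuous_subtype_val
  have hKc : Continuous fun U : QUnitary n => K U.1 := hK.continuous.comp continuous_subtype_val
  have hGc : Continuous fun U : QUnitary n => G U.1 := hG.continuous.comp continuous_subtype_val
  have hΦc : Continuous Φ :=
    ((Complex.continuous_conj.comp (continuous_fderiv_comp hG hmul)).mul hKc).add
      ((Complex.continuous_conj.comp hGc).mul (continuous_fderiv_comp hK hmul))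
  obtain ⟨M, hM⟩ : ∃ M, ∀ U, ‖Φ U‖ ≤ M := by
    obtain ⟨M, hM⟩ := (isCompact_range hΦc).isBounded.exists_norm_le
    exact ⟨M, fun U => hM _ ⟨U, rfl⟩⟩
  let g : ℝ → QUnitary n := fun t => ⟨NormedSpace.exp (t • H), exp_mem_unitaryGroup hH t⟩
  have hderiv : ∀ (L : Op (Fin n) → ℂ), ContDiff ℂ 1 L → ∀ (U : QUnitary n) (t : ℝ),
      HasDerivAt (fun t => L (g t * U).1) (fderiv ℂ L (g t * U).1 (H * (g t * U).1)) t := by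
    intro L hL U t
    have h1 : HasDerivAt (fun t => (g t * U).1) (H * (g t * U).1) t := by
      have := (hasDerivAt_exp H t).mul_const U.1
      simp only [mul_assoc] at this
      exact this
    have h2 := ((hL.differentiable one_ne_zero) (g t * U).1).hasFDerivAt.restrictScalars ℝ
    exact h2.comp_hasDerivAt t h1
  have key := hasDerivAt_integral_of_dominated_loc_of_deriv_le (μ := haarUnitary n) (𝕜 := ℝ)
    (F := fun t U => conj (G (g t * U).1) * K (g t * U).1) (F' := fun t U => Φ (g t * U))
    (x₀ := 0) (s := Set.univ) (bound := fun _ => M) Filter.univ_mem ?_ ?_ ?_ ?_ ?_ ?_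
  · have hconst : (fun t => ∫ U, conj (G (g t * U).1) * K (g t * U).1 ∂haarUnitary n) =
        fun _ => ∫ U : QUnitary n, conj (G U.1) * K U.1 ∂haarUnitary n := by
      funext t
      exact integral_mul_left_eq_self (fun U : QUnitary n => conj (G U.1) * K U.1) (g t)
    have h := key.2
    rw [hconst] at h
    have h0 := h.unique (hasDerivAt_const _ _)
    rwa [integral_mul_left_eq_self Φ (g 0)] at h0
  · exact .of_forall fun t => (((Complex.continuous_conj.comp hGc).mul hKc).comp
      (continuous_const.mul continuous_id)).aestronglyMeasurable
  · exact integrable_haar (((Complex.continuous_conj.comp hGc).mul hKc).comp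
      (continuous_const.mul continuous_id))
  · exact (hΦc.comp (continuous_const.mul continuous_id)).aestronglyMeasurable
  · exact .of_forall fun U t _ => hM _
  · exact integrable_const _
  · refine .of_forall fun U t _ => ?_
    exact ((hderiv G hG U t).star.mul (hderiv K hK U t))

/-- Integration by parts on the unitary group for holomorphic functions. -/
lemma integral_conj_mul_fderiv {G K : Op (Fin n) → ℂ} (hG : ContDiff ℂ 1 G) (hK : ContDiff ℂ 1 K)
    (E : Op (Fin n)) :
    ∫ U : QUnitary n, conj (G U.1) * fderiv ℂ K U.1 (E * U.1) ∂haarUnitary n =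
      ∫ U : QUnitary n, conj (fderiv ℂ G U.1 (Eᴴ * U.1)) * K U.1 ∂haarUnitary n := by
  have hmul : ∀ A : Op (Fin n), Continuous fun U : QUnitary n => A * U.1 :=
    fun A => continuous_const.mul continuous_subtype_val
  have hKc : Continuous fun U : QUnitary n => K U.1 := hK.continuous.comp continuous_subtype_val
  have hGc : Continuous fun U : QUnitary n => G U.1 := hG.continuous.comp continuous_subtype_val
  have i1 : ∀ A : Op (Fin n), Integrable
      (fun U : QUnitary n => conj (fderiv ℂ G U.1 (A * U.1)) * K U.1) (haarUnitary n) := fun A =>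
    integrable_haar ((Complex.continuous_conj.comp (continuous_fderiv_comp hG (hmul A))).mul hKc)
  have i2 : ∀ A : Op (Fin n), Integrable
      (fun U : QUnitary n => conj (G U.1) * fderiv ℂ K U.1 (A * U.1)) (haarUnitary n) := fun A =>
    integrable_haar ((Complex.continuous_conj.comp hGc).mul (continuous_fderiv_comp hK (hmul A)))
  have hs : ∀ A : Op (Fin n), Aᴴ = -A →
      ∫ U : QUnitary n, conj (G U.1) * fderiv ℂ K U.1 (A * U.1) ∂haarUnitary n =
        ∫ U : QUnitary n, conj (fderiv ℂ G U.1 (Aᴴ * U.1)) * K U.1 ∂haarUnitary n := by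
    intro A hA
    have h := integral_skew hG hK hA
    rw [integral_add (i1 A) (i2 A)] at h
    simp only [hA, neg_mul, map_neg, integral_neg]
    linear_combination h
  -- Every matrix is A + iB with A and B skew-Hermitian. The formula is known for A and B, and
  -- extends because i comes out of the holomorphic derivative on one side, while on the other side
  -- conjugation compensates the sign in Eᴴ = Aᴴ − iBᴴ.
  set A : Op (Fin n) := (1 / 2 : ℂ) • (E - Eᴴ) with hA
  set B : Op (Fin n) := (-Complex.I / 2 : ℂ) • (E + Eᴴ) with hB
  have hE : E = A + Complex.I • B := by
    rw [hA, hB, smul_smul]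
    have : Complex.I * (-Complex.I / 2) = 1 / 2 := by
      linear_combination (-1 / 2 : ℂ) * Complex.I_mul_I
    rw [this, ← smul_add]
    rw [show E - Eᴴ + (E + Eᴴ) = (2 : ℂ) • E by rw [two_smul]; abel, smul_smul]
    norm_num
  have hA' : Aᴴ = -A := by
    rw [hA, conjTranspose_smul, conjTranspose_sub, conjTranspose_conjTranspose, ← smul_neg,
      neg_sub]
    simp
  have hB' : Bᴴ = -B := by
    rw [hB, conjTranspose_smul, conjTranspose_add, conjTranspose_conjTranspose, ← neg_smul,
      add_comm]
    congr 1
    simp [neg_div]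
  have e1 := hs A hA'
  have e2 := hs B hB'
  have hE' : Eᴴ = Aᴴ - Complex.I • Bᴴ := by
    rw [hE, conjTranspose_add, conjTranspose_smul]; simp [sub_eq_add_neg]
  rw [hE']
  conv_lhs => rw [hE]
  simp only [add_mul, sub_mul, smul_mul_assoc, map_add, map_sub, map_smul, smul_eq_mul, map_mul,
    Complex.conj_I, mul_add]
  calc _ = ∫ U : QUnitary n, (conj (G U.1) * fderiv ℂ K U.1 (A * U.1) +
        Complex.I * (conj (G U.1) * fderiv ℂ K U.1 (B * U.1))) ∂haarUnitary n := by
        congr 1; funext U; ring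
    _ = ∫ U : QUnitary n, (conj (fderiv ℂ G U.1 (Aᴴ * U.1)) * K U.1 +
        Complex.I * (conj (fderiv ℂ G U.1 (Bᴴ * U.1)) * K U.1)) ∂haarUnitary n := by
        rw [integral_add (i2 A) ((i2 B).const_mul _), integral_add (i1 _) ((i1 _).const_mul _),
          integral_const_mul, integral_const_mul, e1, e2]
    _ = _ := by congr 1; funext U; ring

end Haar

end QUnf

end

noncomputable section
namespace QUnf

open Matrix MeasureTheory
open scoped ComplexConjugate

set_option linter.unusedSectionVars false

/-! ### The second moment of the overlap minus the divergence. -/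

section Core

variable {n : ℕ}

attribute [local instance] Matrix.linftyOpNormedRing Matrix.linftyOpNormedAlgebra

/-- The operator `|w⟩⟨ψ|`. -/
def ketBra (w : Fin n → Bool) (ψ : Ket (Fin n)) : Op (Fin n) :=
  fun a b => if a = w then conj (ψ b) else 0

lemma vecMulVec_eq_sum_rowOp (u : Ket (Fin n)) (V : Op (Fin n)) (w : Fin n → Bool) :
    vecMulVec u (V w) = ∑ y, u y • rowOp V y w := by
  ext a b
  simp [vecMulVec_apply, Matrix.sum_apply, rowOp]

lemma ketBra_eq_sum_rowOp (ψ : Ket (Fin n)) (z : Fin n → Bool) :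
    ketBra z ψ = ∑ w, conj (ψ w) • rowOp 1 z w := by
  ext a b
  simp [Matrix.sum_apply, rowOp, ketBra, Matrix.one_apply]

/-- Unitarity gives ⟨ψ| = ⟨Uψ|U. So |w⟩⟨ψ| has the form E·U to which integration by parts applies,
with coefficients that depend on U. -/
lemma ketBra_eq_sum (U : QUnitary n) (ψ : Ket (Fin n)) (w : Fin n → Bool) :
    ketBra w ψ = ∑ y, conj ((U.1 *ᵥ ψ) y) • (Matrix.single w y (1 : ℂ) * U.1) := by
  have h : star (U.1 *ᵥ ψ) ᵥ* U.1 = star ψ := by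
    rw [star_mulVec, vecMul_vecMul, ← star_eq_conjTranspose, Unitary.coe_star_mul_self, vecMul_one]
  ext a b
  have hb := congrFun h b
  simp only [vecMul, dotProduct, Pi.star_apply, RCLike.star_def] at hb
  simp only [Matrix.sum_apply, Matrix.smul_apply, smul_eq_mul, ketBra]
  split_ifs with ha
  · subst ha
    simpa using hb.symm
  · refine (Finset.sum_eq_zero fun y _ => ?_).symm
    rw [Matrix.single_mul_apply_of_ne (h := ha)]
    simp

lemma vecMulVec_eq_sum_single (u : Ket (Fin n)) (V : Op (Fin n)) (w : Fin n → Bool) :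
    vecMulVec u (V w) = ∑ y, u y • (Matrix.single y w (1 : ℂ) * V) := by
  ext a b
  simp only [Matrix.sum_apply, Matrix.smul_apply, smul_eq_mul, vecMulVec_apply]
  rw [Finset.sum_eq_single a]
  · simp
  · intro y _ hy
    rw [Matrix.single_mul_apply_of_ne (h := hy.symm)]
    simp
  · simp

/-- The coordinates of the image of a fixed vector, as a linear form. -/
def mulVecCoord (ψ : Ket (Fin n)) (y : Fin n → Bool) : Op (Fin n) →L[ℂ] ℂ :=
  LinearMap.toContinuousLinearMap
    { toFun := fun M => (M *ᵥ ψ) y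
      map_add' := fun A B => by simp [add_mulVec]
      map_smul' := fun c A => by simp [smul_mulVec] }

lemma contDiff_mulVecCoord_mul {K : Op (Fin n) → ℂ} {m : ℕ} (hK : ContDiff ℂ m K)
    (ψ : Ket (Fin n)) (y : Fin n → Bool) : ContDiff ℂ m fun M => (M *ᵥ ψ) y * K M :=
  (mulVecCoord ψ y).contDiff.mul hK

lemma fderiv_mulVecCoord_mul {K : Op (Fin n) → ℂ} (hK : ContDiff ℂ 1 K) (ψ : Ket (Fin n))
    (y : Fin n → Bool) (M A : Op (Fin n)) :
    fderiv ℂ (fun M => (M *ᵥ ψ) y * K M) M A =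
      (A *ᵥ ψ) y * K M + (M *ᵥ ψ) y * fderiv ℂ K M A := by
  have h := (mulVecCoord ψ y).hasFDerivAt (x := M) |>.mul
    ((hK.differentiable one_ne_zero) M).hasFDerivAt
  have h' : fderiv ℂ (fun M => (M *ᵥ ψ) y * K M) M = _ := h.fderiv
  rw [h']
  refine Eq.trans (b := (M *ᵥ ψ) y * fderiv ℂ K M A + K M * (A *ᵥ ψ) y) rfl ?_
  ring

lemma continuous_mulVec (ψ : Ket (Fin n)) (y : Fin n → Bool) :
    Continuous fun U : QUnitary n => (U.1 *ᵥ ψ) y :=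
  (mulVecCoord ψ y).continuous.comp continuous_subtype_val

lemma continuous_vecMulVec_row (ψ : Ket (Fin n)) (w : Fin n → Bool) :
    Continuous fun U : QUnitary n => vecMulVec (U.1 *ᵥ ψ) (U.1 w) := by
  refine continuous_matrix fun a b => ?_
  exact (continuous_mulVec ψ a).mul (continuous_subtype_val.matrix_elem w b)

/-- Write |w⟩⟨ψ| = ∑_y conj(v_y) |w⟩⟨y|U with v = Uψ, and integrate by parts with v_y G in place of
G. The derivative of v_y along |y⟩⟨w|U is v_w for every y, which produces the factor D = 2^n; the
derivative of G collects to the direction |v⟩⟨w|U. -/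
lemma integral_conj_mul_fderiv_ketBra {G K : Op (Fin n) → ℂ} (hG : ContDiff ℂ 1 G)
    (hK : ContDiff ℂ 1 K) (ψ : Ket (Fin n)) (w : Fin n → Bool) :
    ∫ U : QUnitary n, conj (G U.1) * fderiv ℂ K U.1 (ketBra w ψ) ∂haarUnitary n =
      2 ^ n * ∫ U : QUnitary n, conj ((U.1 *ᵥ ψ) w * G U.1) * K U.1 ∂haarUnitary n +
      ∫ U : QUnitary n, conj (fderiv ℂ G U.1 (vecMulVec (U.1 *ᵥ ψ) (U.1 w))) * K U.1
        ∂haarUnitary n := by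
  have hKc : Continuous fun U : QUnitary n => K U.1 := hK.continuous.comp continuous_subtype_val
  have hGc : Continuous fun U : QUnitary n => G U.1 := hG.continuous.comp continuous_subtype_val
  have hmul : ∀ A : Op (Fin n), Continuous fun U : QUnitary n => A * U.1 :=
    fun A => continuous_const.mul continuous_subtype_val
  have hvG : ∀ y, ContDiff ℂ 1 fun M : Op (Fin n) => (M *ᵥ ψ) y * G M := fun y =>
    contDiff_mulVecCoord_mul (m := 1) hG ψ y
  calc _ = ∫ U : QUnitary n, ∑ y, conj ((U.1 *ᵥ ψ) y * G U.1) *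
        fderiv ℂ K U.1 (Matrix.single w y (1 : ℂ) * U.1) ∂haarUnitary n := by
        congr 1; funext U
        rw [ketBra_eq_sum U ψ w, map_sum, Finset.mul_sum]
        refine Finset.sum_congr rfl fun y _ => ?_
        rw [map_smul, smul_eq_mul, map_mul conj]; ring
    _ = ∑ y, ∫ U : QUnitary n, conj (fderiv ℂ (fun M => (M *ᵥ ψ) y * G M) U.1
          (Matrix.single y w (1 : ℂ) * U.1)) * K U.1 ∂haarUnitary n := by
        rw [integral_finsetSum]
        · refine Finset.sum_congr rfl fun y _ => ?_
          rw [integral_conj_mul_fderiv (hvG y) hK]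
          simp [conjTranspose_single]
        · intro y _
          exact integrable_haar ((Complex.continuous_conj.comp ((continuous_mulVec ψ y).mul hGc)).mul
            (continuous_fderiv_comp hK (hmul _)))
    _ = ∫ U : QUnitary n, ∑ y, conj (fderiv ℂ (fun M => (M *ᵥ ψ) y * G M) U.1
          (Matrix.single y w (1 : ℂ) * U.1)) * K U.1 ∂haarUnitary n := by
        rw [integral_finsetSum]
        intro y _
        exact integrable_haar ((Complex.continuous_conj.comp
          (continuous_fderiv_comp (hvG y) (hmul _))).mul hKc)
    _ = ∫ U : QUnitary n, (2 ^ n * (conj ((U.1 *ᵥ ψ) w * G U.1) * K U.1) +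
          conj (fderiv ℂ G U.1 (vecMulVec (U.1 *ᵥ ψ) (U.1 w))) * K U.1) ∂haarUnitary n := by
        congr 1; funext U
        simp only [fderiv_mulVecCoord_mul hG]
        rw [← Finset.sum_mul, ← map_sum, ← mul_assoc, ← add_mul]
        congr 1
        rw [vecMulVec_eq_sum_single, Finset.sum_add_distrib, map_add]
        congr 1
        · have : ∀ y : Fin n → Bool, ((Matrix.single y w (1 : ℂ) * U.1) *ᵥ ψ) y = (U.1 *ᵥ ψ) w := by
            intro y
            have h := mulVec_mulVec ψ (Matrix.single y w (1 : ℂ)) U.1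
            rw [← h, single_mulVec]; simp
          simp only [this, Finset.sum_const, Finset.card_univ, nsmul_eq_mul, map_mul, map_natCast]
          simp
        · simp [map_sum, map_smul]
    _ = _ := by
        rw [integral_add, integral_const_mul]
        · exact (integrable_haar ((Complex.continuous_conj.comp
            ((continuous_mulVec ψ w).mul hGc)).mul hKc)).const_mul _
        · exact integrable_haar ((Complex.continuous_conj.comp
            (continuous_fderiv_comp hG (continuous_vecMulVec_row ψ w))).mul hKc)

/-- The divergence of the family `X` in the image of the vector `ψ`. -/
def divergence (ψ : Ket (Fin n)) (X : (Fin n → Bool) → Op (Fin n) → ℂ) (M : Op (Fin n)) : ℂ :=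
  ∑ z, fderiv ℂ (X z) M (ketBra z ψ)

lemma contDiff_divergence (ψ : Ket (Fin n)) {X : (Fin n → Bool) → Op (Fin n) → ℂ}
    (hX : ∀ z, ContDiff ℂ 2 (X z)) : ContDiff ℂ 1 (divergence ψ X) := by
  unfold divergence
  refine ContDiff.sum fun z _ => ?_
  exact ((hX z).fderiv_right (m := 1) (by norm_num)).clm_apply contDiff_const

/-- The second moment of `∑ z, conj v z * X z - divergence / D` for `v = U ψ`. -/
lemma integral_sub_divergence {ψ : Ket (Fin n)} (hψ : weight ψ = 1)
    {X : (Fin n → Bool) → Op (Fin n) → ℂ} (hX : ∀ z, ContDiff ℂ 2 (X z)) :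
    ∫ U : QUnitary n, ((‖∑ z, conj ((U.1 *ᵥ ψ) z) * X z U.1 - (2 ^ n)⁻¹ * divergence ψ X U.1‖ ^ 2 :
        ℝ) : ℂ) ∂haarUnitary n =
      (2 ^ n)⁻¹ * ∫ U : QUnitary n, ∑ z, ((‖X z U.1‖ ^ 2 : ℝ) : ℂ) ∂haarUnitary n
      - (2 ^ n)⁻¹ * ∫ U : QUnitary n, ∑ z, ∑ w,
        conj (fderiv ℂ (X z) U.1 (vecMulVec (U.1 *ᵥ ψ) (U.1 w))) * ((U.1 *ᵥ ψ) z * X w U.1)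
          ∂haarUnitary n
      + (2 ^ n)⁻¹ ^ 2 * ∫ U : QUnitary n, ∑ w,
        conj (fderiv ℂ (divergence ψ X) U.1 (vecMulVec (U.1 *ᵥ ψ) (U.1 w))) * X w U.1
          ∂haarUnitary n := by
  have hX1 : ∀ z, ContDiff ℂ 1 (X z) := fun z => (hX z).of_le (by norm_num)
  have hδ := contDiff_divergence ψ hX
  have cX : ∀ z, Continuous fun U : QUnitary n => X z U.1 := fun z =>
    (hX z).continuous.comp continuous_subtype_val
  have cδ : Continuous fun U : QUnitary n => divergence ψ X U.1 :=
    hδ.continuous.comp continuous_subtype_val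
  have cv := continuous_mulVec (n := n) ψ
  have cf : ∀ {K : Op (Fin n) → ℂ}, ContDiff ℂ 1 K → ∀ w, Continuous fun U : QUnitary n =>
      fderiv ℂ K U.1 (vecMulVec (U.1 *ᵥ ψ) (U.1 w)) := fun hK w =>
    continuous_fderiv_comp hK (continuous_vecMulVec_row ψ w)
  have ck : ∀ {K : Op (Fin n) → ℂ}, ContDiff ℂ 1 K → ∀ w, Continuous fun U : QUnitary n =>
      fderiv ℂ K U.1 (ketBra w ψ) := fun hK w => continuous_fderiv_comp hK continuous_const
  have cc : ∀ {f : QUnitary n → ℂ}, Continuous f → Continuous fun U => conj (f U) :=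
    fun hf => Complex.continuous_conj.comp hf
  set D : ℂ := 2 ^ n with hD
  have hD0 : D ≠ 0 := pow_ne_zero _ two_ne_zero
  set a := ∫ U : QUnitary n, conj (∑ z, conj ((U.1 *ᵥ ψ) z) * X z U.1) *
    ∑ z, conj ((U.1 *ᵥ ψ) z) * X z U.1 ∂haarUnitary n with ha
  set b := ∫ U : QUnitary n, conj (divergence ψ X U.1) *
    ∑ z, conj ((U.1 *ᵥ ψ) z) * X z U.1 ∂haarUnitary n with hb
  set c := ∫ U : QUnitary n, conj (divergence ψ X U.1) * divergence ψ X U.1 ∂haarUnitary n with hc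
  set x := ∫ U : QUnitary n, ∑ z, ((‖X z U.1‖ ^ 2 : ℝ) : ℂ) ∂haarUnitary n with hx
  set e1 := ∫ U : QUnitary n, ∑ z, ∑ w,
        conj (fderiv ℂ (X z) U.1 (vecMulVec (U.1 *ᵥ ψ) (U.1 w))) * ((U.1 *ᵥ ψ) z * X w U.1)
          ∂haarUnitary n with he1
  set e2 := ∫ U : QUnitary n, ∑ w,
        conj (fderiv ℂ (divergence ψ X) U.1 (vecMulVec (U.1 *ᵥ ψ) (U.1 w))) * X w U.1
          ∂haarUnitary n with he2
  have cY : Continuous fun U : QUnitary n => ∑ z, conj ((U.1 *ᵥ ψ) z) * X z U.1 :=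
    continuous_finsetSum _ fun z _ => (cc (cv z)).mul (cX z)
  -- Integration by parts with G the divergence and K = X_w, summed over w.
  have eq1 : c = D * b + e2 := by
    have h : ∀ w, _ := fun w => integral_conj_mul_fderiv_ketBra hδ (hX1 w) ψ w
    have h' := Finset.sum_congr (s₁ := Finset.univ) rfl fun w _ => h w
    rw [Finset.sum_add_distrib, ← Finset.mul_sum, ← integral_finsetSum, ← integral_finsetSum,
      ← integral_finsetSum] at h'
    · rw [hc, hb, he2]
      convert h' using 3
      · rw [divergence, Finset.mul_sum]
      · congr 1; funext U
        rw [Finset.mul_sum]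
        refine Finset.sum_congr rfl fun w _ => ?_
        rw [map_mul]; ring
    · exact fun w _ => integrable_haar ((cc (cf hδ w)).mul (cX w))
    · exact fun w _ => integrable_haar ((cc ((cv w).mul cδ)).mul (cX w))
    · exact fun w _ => integrable_haar ((cc cδ).mul (ck (hX1 w) w))
  have hdot : ∑ z, ψ z * conj (ψ z) = 1 := by
    have := ofReal_weight ψ
    rw [hψ] at this
    simp only [dotProduct, Pi.star_apply, RCLike.star_def, Complex.ofReal_one] at this
    rw [this]
    exact Finset.sum_congr rfl fun z _ => mul_comm _ _
  have hkb : ∀ z w, (ketBra w ψ *ᵥ ψ) z = if z = w then 1 else 0 := by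
    intro z w
    simp only [mulVec, dotProduct, ketBra]
    split_ifs
    · rw [← hdot]; exact Finset.sum_congr rfl fun z _ => mul_comm _ _
    · simp
  -- Integration by parts with G = X_z and K = v_z X_w, summed over z and w. Differentiating v_z
  -- along |w⟩⟨ψ| gives the Kronecker delta since ψ is a unit vector; this is the source of x.
  have eq2 : x + conj b = D * a + e1 := by
    have h : ∀ z w, _ := fun z w => integral_conj_mul_fderiv_ketBra (hX1 z)
      (contDiff_mulVecCoord_mul (m := 1) (hX1 w) ψ z) ψ w
    have h' := Finset.sum_congr (s₁ := Finset.univ) rfl fun z _ =>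
      Finset.sum_congr (s₁ := Finset.univ) rfl fun w _ => h z w
    simp only [fderiv_mulVecCoord_mul (hX1 _), hkb] at h'
    have i1 : ∀ z w, Integrable (fun U : QUnitary n => conj (X z U.1) *
        ((if z = w then 1 else 0) * X w U.1 + (U.1 *ᵥ ψ) z * fderiv ℂ (X w) U.1 (ketBra w ψ)))
        (haarUnitary n) := fun z w => integrable_haar
      ((cc (cX z)).mul ((continuous_const.mul (cX w)).add ((cv z).mul (ck (hX1 w) w))))
    have i2 : ∀ z w, Integrable (fun U : QUnitary n =>
        conj ((U.1 *ᵥ ψ) w * X z U.1) * ((U.1 *ᵥ ψ) z * X w U.1)) (haarUnitary n) :=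
      fun z w => integrable_haar ((cc ((cv w).mul (cX z))).mul ((cv z).mul (cX w)))
    have i3 : ∀ z w, Integrable (fun U : QUnitary n =>
        conj (fderiv ℂ (X z) U.1 (vecMulVec (U.1 *ᵥ ψ) (U.1 w))) * ((U.1 *ᵥ ψ) z * X w U.1))
        (haarUnitary n) :=
      fun z w => integrable_haar ((cc (cf (hX1 z) w)).mul ((cv z).mul (cX w)))
    simp only [Finset.sum_add_distrib, ← Finset.mul_sum] at h'
    simp only [← integral_finsetSum _ fun w _ => i1 _ w, ← integral_finsetSum _ fun w _ => i2 _ w,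
      ← integral_finsetSum _ fun w _ => i3 _ w] at h'
    rw [← integral_finsetSum _ fun z _ => integrable_finsetSum _ fun w _ => i1 z w,
      ← integral_finsetSum _ fun z _ => integrable_finsetSum _ fun w _ => i2 z w,
      ← integral_finsetSum _ fun z _ => integrable_finsetSum _ fun w _ => i3 z w] at h'
    rw [he1, ha]
    have hl : x + conj b = ∫ U : QUnitary n, ∑ z, ∑ w, conj (X z U.1) *
        ((if z = w then 1 else 0) * X w U.1 + (U.1 *ᵥ ψ) z * fderiv ℂ (X w) U.1 (ketBra w ψ))
        ∂haarUnitary n := by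
      rw [hx, hb, ← integral_conj, ← integral_add]
      · congr 1; funext U
        simp only [map_mul, map_sum, Complex.conj_conj]
        rw [Finset.mul_sum, ← Finset.sum_add_distrib]
        refine Finset.sum_congr rfl fun z _ => ?_
        simp only [mul_add, Finset.sum_add_distrib, ← Finset.mul_sum]
        congr 1
        · simp [Complex.conj_mul']
        · rw [divergence]; ring
      · exact integrable_haar (continuous_finsetSum _ fun z _ =>
          Complex.continuous_ofReal.comp ((cX z).norm.pow 2))
      · exact integrable_haar (cc ((cc cδ).mul cY))
    rw [hl]
    refine h'.trans ?_
    congr 2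
    congr 1; funext U
    rw [map_sum, Finset.sum_mul_sum]
    refine Finset.sum_congr rfl fun z _ => Finset.sum_congr rfl fun w _ => ?_
    simp only [map_mul, Complex.conj_conj]; ring
  have eq3 : ∫ U : QUnitary n, ((‖∑ z, conj ((U.1 *ᵥ ψ) z) * X z U.1 -
      D⁻¹ * divergence ψ X U.1‖ ^ 2 : ℝ) : ℂ) ∂haarUnitary n =
      a - D⁻¹ * b - D⁻¹ * conj b + D⁻¹ ^ 2 * c := by
    rw [ha, hb, hc, ← integral_conj, ← integral_const_mul, ← integral_const_mul,
      ← integral_const_mul, ← integral_sub, ← integral_sub, ← integral_add]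
    · congr 1; funext U
      have hDc : conj D = D := by rw [hD, map_pow, map_ofNat]
      rw [Complex.ofReal_pow, ← Complex.conj_mul']
      simp only [map_sub, map_mul, map_inv₀, hDc, Complex.conj_conj]
      ring
    · exact integrable_haar ((((cc cY).mul cY).sub (continuous_const.mul ((cc cδ).mul cY))).sub
        (continuous_const.mul (cc ((cc cδ).mul cY))))
    · exact integrable_haar (continuous_const.mul ((cc cδ).mul cδ))
    · exact integrable_haar (((cc cY).mul cY).sub (continuous_const.mul ((cc cδ).mul cY)))
    · exact integrable_haar (continuous_const.mul (cc ((cc cδ).mul cY)))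
    · exact integrable_haar ((cc cY).mul cY)
    · exact integrable_haar (continuous_const.mul ((cc cδ).mul cY))
  rw [eq3]
  -- After a and c are eliminated, b and its conjugate cancel. The coefficient 1/D of the divergence
  -- is chosen for this.
  have ea : a = D⁻¹ * (x + conj b - e1) := by field_simp; linear_combination -eq2
  rw [ea, eq1]
  field_simp
  ring

end Core

end QUnf

end

noncomputable section
namespace QUnf

open Matrix MeasureTheory
open scoped ComplexConjugate

set_option linter.unusedSectionVars false

lemma norm_sum_mul_sq_le {J : Type*} [Fintype J] (a b : J → ℂ) :
    ‖∑ j, a j * b j‖ ^ 2 ≤ (∑ j, ‖a j‖ ^ 2) * ∑ j, ‖b j‖ ^ 2 := by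
  calc ‖∑ j, a j * b j‖ ^ 2 ≤ (∑ j, ‖a j‖ * ‖b j‖) ^ 2 := by
        gcongr
        exact (norm_sum_le _ _).trans (le_of_eq (by simp))
    _ ≤ _ := Finset.sum_mul_sq_le_sq_mul_sq _ _ _

/-! ### Derivatives of multilinear forms on matrices. -/

section Multilinear

variable {n : ℕ} {I : Type} [Fintype I] [DecidableEq I]

attribute [local instance] Matrix.linftyOpNormedRing Matrix.linftyOpNormedAlgebra

lemma continuous_multilinear (f : MultilinearMap ℂ (fun _ : I => Op (Fin n)) ℂ) :
    Continuous f := by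
  have h : ∀ m, f m = ∑ p : I → (Fin n → Bool) × (Fin n → Bool),
      (∏ i, m i (p i).1 (p i).2) * f fun i => Matrix.single (p i).1 (p i).2 (1 : ℂ) := by
    intro m
    have hm : m = fun i => ∑ p : (Fin n → Bool) × (Fin n → Bool),
        m i p.1 p.2 • Matrix.single p.1 p.2 (1 : ℂ) := by
      funext i
      conv_lhs => rw [matrix_eq_sum_single (m i)]
      rw [Fintype.sum_prod_type]
      exact Finset.sum_congr rfl fun a _ => Finset.sum_congr rfl fun b _ => by simp
    conv_lhs => rw [hm]
    rw [f.map_sum]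
    exact Finset.sum_congr rfl fun p _ => by rw [f.map_smul_univ, smul_eq_mul]
  rw [funext h]
  refine continuous_finsetSum _ fun p _ => Continuous.mul ?_ continuous_const
  exact continuous_finsetProd _ fun i _ => (continuous_apply i).matrix_elem _ _

/-- A multilinear form on matrices as a continuous one. -/
def contMultilinear (f : MultilinearMap ℂ (fun _ : I => Op (Fin n)) ℂ) :
    ContinuousMultilinearMap ℂ (fun _ : I => Op (Fin n)) ℂ :=
  { f with cont := continuous_multilinear f }

lemma contMultilinear_apply (f : MultilinearMap ℂ (fun _ : I => Op (Fin n)) ℂ)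
    (m : I → Op (Fin n)) : contMultilinear f m = f m := rfl

lemma contDiff_multilinear_diag (f : MultilinearMap ℂ (fun _ : I => Op (Fin n)) ℂ) {m : ℕ} :
    ContDiff ℂ m fun M => f fun _ => M :=
  (contMultilinear f).contDiff.comp (contDiff_pi.2 fun _ => contDiff_id)

lemma fderiv_multilinear_diag (f : MultilinearMap ℂ (fun _ : I => Op (Fin n)) ℂ)
    (M A : Op (Fin n)) :
    fderiv ℂ (fun M => f fun _ => M) M A = ∑ k, f (Function.update (fun _ => M) k A) := by
  have h1 : HasFDerivAt (fun M : Op (Fin n) => fun _ : I => M)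
      (ContinuousLinearMap.pi fun _ => ContinuousLinearMap.id ℂ (Op (Fin n))) M :=
    hasFDerivAt_pi.2 fun _ => hasFDerivAt_id M
  have h2 := ((contMultilinear f).hasFDerivAt fun _ => M).comp M h1
  have h3 : fderiv ℂ (fun M => f fun _ => M) M = _ := h2.fderiv
  rw [h3]
  exact ContinuousMultilinearMap.linearDeriv_apply (contMultilinear f) (fun _ => M) fun _ => A

/-- The slot `i` is frozen at `B` and does not vary with `M`. For this reason only pairs of
different queries occur in the derivative of the divergence. -/
lemma fderiv_multilinear_update (f : MultilinearMap ℂ (fun _ : I => Op (Fin n)) ℂ) (i : I)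
    (B M A : Op (Fin n)) :
    fderiv ℂ (fun M => f (Function.update (fun _ => M) i B)) M A =
      ∑ k, if k = i then 0 else
        f (Function.update (Function.update (fun _ => M) i B) k A) := by
  have h1 : HasFDerivAt (fun M : Op (Fin n) => Function.update (fun _ : I => M) i B)
      (ContinuousLinearMap.pi fun k =>
        if k = i then 0 else ContinuousLinearMap.id ℂ (Op (Fin n))) M := by
    refine hasFDerivAt_pi.2 fun k => ?_
    by_cases hk : k = i
    · subst hk
      simp only [Function.update_self, if_true]
      exact hasFDerivAt_const _ _
    · simp only [Function.update_of_ne hk, if_neg hk]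
      exact hasFDerivAt_id M
  have h2 := ((contMultilinear f).hasFDerivAt (Function.update (fun _ => M) i B)).comp M h1
  have h3 : fderiv ℂ (fun M => f (Function.update (fun _ => M) i B)) M = _ := h2.fderiv
  rw [h3]
  refine (ContinuousMultilinearMap.linearDeriv_apply (contMultilinear f)
    (Function.update (fun _ => M) i B) fun k =>
      (if k = i then 0 else ContinuousLinearMap.id ℂ (Op (Fin n))) A).trans
    (Finset.sum_congr rfl fun k _ => ?_)
  rw [contMultilinear_apply]
  split_ifs with hk
  · exact f.map_update_zero _ _
  · rfl

lemma contDiff_multilinear_update (f : MultilinearMap ℂ (fun _ : I => Op (Fin n)) ℂ) (i : I)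
    (B : Op (Fin n)) {m : ℕ} :
    ContDiff ℂ m fun M => f (Function.update (fun _ => M) i B) := by
  refine (contMultilinear f).contDiff.comp (contDiff_pi.2 fun k => ?_)
  by_cases hk : k = i
  · subst hk; simpa using contDiff_const
  · simp only [Function.update_of_ne hk]; exact contDiff_id

lemma divergence_multilinear (f : (Fin n → Bool) → MultilinearMap ℂ (fun _ : I => Op (Fin n)) ℂ)
    (ψ : Ket (Fin n)) (M : Op (Fin n)) :
    divergence ψ (fun z M => f z fun _ => M) M =
      ∑ z, ∑ k, f z (Function.update (fun _ => M) k (ketBra z ψ)) :=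
  Finset.sum_congr rfl fun _ _ => fderiv_multilinear_diag _ _ _

lemma fderiv_divergence_multilinear
    (f : (Fin n → Bool) → MultilinearMap ℂ (fun _ : I => Op (Fin n)) ℂ)
    (ψ : Ket (Fin n)) (M A : Op (Fin n)) :
    fderiv ℂ (divergence ψ fun z M => f z fun _ => M) M A =
      ∑ z, ∑ i, ∑ k, if k = i then 0 else
        f z (Function.update (Function.update (fun _ => M) i (ketBra z ψ)) k A) := by
  have h : divergence ψ (fun z M => f z fun _ => M) = fun M =>
      ∑ z, ∑ k, f z (Function.update (fun _ => M) k (ketBra z ψ)) :=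
    funext fun M => divergence_multilinear f ψ M
  have hd : ∀ z i, DifferentiableAt ℂ
      (fun M => f z (Function.update (fun _ => M) i (ketBra z ψ))) M := fun z i =>
    ((contDiff_multilinear_update (m := 1) (f z) i _).differentiable one_ne_zero) M
  rw [h]
  refine (DFunLike.congr_fun (fderiv_fun_sum fun z _ =>
    DifferentiableAt.fun_sum fun i _ => hd z i) A).trans ?_
  refine (_root_.sum_apply _ _ _).trans (Finset.sum_congr rfl fun z _ => ?_)
  refine (DFunLike.congr_fun (fderiv_fun_sum fun i _ => hd z i) A).trans ?_
  refine (_root_.sum_apply _ _ _).trans (Finset.sum_congr rfl fun i _ => ?_)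
  exact fderiv_multilinear_update _ _ _ _ _

end Multilinear

/-! ### Cauchy–Schwarz bounds for the error terms. -/

section CoreBound

variable {n : ℕ} {H R I : Type} [Fintype H] [Fintype R] [Fintype I] [DecidableEq I]

/-- The overlap of the family `X` with the answer to `ψ`, minus the contributions in which the
answer to a query is handed through. -/
def residual (X : (Fin n → Bool) → MultilinearMap ℂ (fun _ : I => Op (Fin n)) ℂ)
    (ψ : Ket (Fin n)) (M : Op (Fin n)) : ℂ :=
  ∑ z, conj ((M *ᵥ ψ) z) * X z (fun _ => M) -
    (2 ^ n)⁻¹ * ∑ z, ∑ k, X z (Function.update (fun _ => M) k (ketBra z ψ))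

/-- Cauchy–Schwarz splits off the factors X_w, of total square at most 1. For the other factor,
|v⟩⟨w|U is expanded as ∑_y v_y |y⟩⟨w|U. Each pair (k, y) contributes at most 1 by conservation of
probability, so with q queries the sum over y costs D and the two sums over k cost q²: the square is
at most q²D. -/
lemma norm_fst_error_le
    {X : H → (Fin n → Bool) → R → MultilinearMap ℂ (fun _ : I => Op (Fin n)) ℂ} (U : QUnitary n)
    (hB0 : ∑ h, ∑ r, ∑ z, ‖X h z r fun _ => U.1‖ ^ 2 ≤ 1)
    (hB1 : ∀ k y, ∑ w, ∑ h, ∑ r, ∑ z,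
      ‖X h z r (Function.update (fun _ => U.1) k (rowOp U.1 y w))‖ ^ 2 ≤ 1)
    {v : H → Ket (Fin n)} (hv : ∀ h, weight (v h) = 1) :
    ‖∑ h, ∑ r, ∑ z, ∑ w, conj (∑ k, X h z r (Function.update (fun _ => U.1) k
      (vecMulVec (v h) (U.1 w)))) * (v h z * X h w r fun _ => U.1)‖ ≤
      Fintype.card I * √(2 ^ n) := by
  set N : H × R × (Fin n → Bool) → ℂ := fun p => ∑ z, conj (∑ k, X p.1 z p.2.1
    (Function.update (fun _ => U.1) k (vecMulVec (v p.1) (U.1 p.2.2)))) * v p.1 z with hN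
  have h1 : ∑ h, ∑ r, ∑ z, ∑ w, conj (∑ k, X h z r (Function.update (fun _ => U.1) k
      (vecMulVec (v h) (U.1 w)))) * (v h z * X h w r fun _ => U.1) =
      ∑ p, N p * X p.1 p.2.2 p.2.1 fun _ => U.1 := by
    simp only [Fintype.sum_prod_type, hN]
    refine Finset.sum_congr rfl fun h _ => Finset.sum_congr rfl fun r _ => ?_
    rw [Finset.sum_comm]
    refine Finset.sum_congr rfl fun w _ => ?_
    rw [Finset.sum_mul]
    exact Finset.sum_congr rfl fun z _ => (mul_assoc _ _ _).symm
  have h2 : ∀ h z r w, ‖∑ k, X h z r (Function.update (fun _ => U.1) k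
      (vecMulVec (v h) (U.1 w)))‖ ^ 2 ≤ Fintype.card I *
        ∑ k, ∑ y, ‖X h z r (Function.update (fun _ => U.1) k (rowOp U.1 y w))‖ ^ 2 := by
    intro h z r w
    have e : ∑ k, X h z r (Function.update (fun _ => U.1) k (vecMulVec (v h) (U.1 w))) =
        ∑ p : I × (Fin n → Bool), v h p.2 *
          X h z r (Function.update (fun _ => U.1) p.1 (rowOp U.1 p.2 w)) := by
      rw [Fintype.sum_prod_type]
      refine Finset.sum_congr rfl fun k _ => ?_
      rw [vecMulVec_eq_sum_rowOp, MultilinearMap.map_update_sum]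
      exact Finset.sum_congr rfl fun y _ => by rw [MultilinearMap.map_update_smul, smul_eq_mul]
    rw [e]
    refine (norm_sum_mul_sq_le _ _).trans (le_of_eq ?_)
    simp only [Fintype.sum_prod_type]
    congr 1
    have hv' : ∑ y, ‖v h y‖ ^ 2 = 1 := hv h
    simp [hv']
  have h3 : ∑ p, ‖N p‖ ^ 2 ≤ (Fintype.card I : ℝ) ^ 2 * 2 ^ n := by
    calc ∑ p, ‖N p‖ ^ 2 ≤ ∑ p : H × R × (Fin n → Bool), ∑ z, Fintype.card I *
          ∑ k, ∑ y, ‖X p.1 z p.2.1 (Function.update (fun _ => U.1) k (rowOp U.1 y p.2.2))‖ ^ 2 := by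
          refine Finset.sum_le_sum fun p _ => ?_
          refine (norm_sum_mul_sq_le _ _).trans ?_
          rw [show ∑ z, ‖v p.1 z‖ ^ 2 = 1 from hv p.1, mul_one]
          refine Finset.sum_le_sum fun z _ => ?_
          rw [RCLike.norm_conj]
          exact h2 ..
      _ = Fintype.card I * ∑ k, ∑ y, ∑ w, ∑ h, ∑ r, ∑ z,
          ‖X h z r (Function.update (fun _ => U.1) k (rowOp U.1 y w))‖ ^ 2 := by
          simp only [Finset.mul_sum, Fintype.sum_prod_type]
          simp_rw [Finset.sum_comm (s := (Finset.univ : Finset (Fin n → Bool))) (t := (Finset.univ : Finset I)),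
            Finset.sum_comm (s := (Finset.univ : Finset R)) (t := (Finset.univ : Finset I)),
            Finset.sum_comm (s := (Finset.univ : Finset H)) (t := (Finset.univ : Finset I))]
          refine Finset.sum_congr rfl fun k _ => ?_
          calc _ = ∑ h, ∑ r, ∑ y, ∑ w, ∑ z, (Fintype.card I : ℝ) *
                ‖X h z r (Function.update (fun _ => U.1) k (rowOp U.1 y w))‖ ^ 2 := by
                refine Finset.sum_congr rfl fun h _ => Finset.sum_congr rfl fun r _ => ?_
                rw [Finset.sum_congr rfl fun w _ => Finset.sum_comm, Finset.sum_comm]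
            _ = _ := by
                rw [Finset.sum_congr rfl fun h _ => Finset.sum_comm, Finset.sum_comm]
                refine Finset.sum_congr rfl fun y _ => ?_
                rw [Finset.sum_congr rfl fun h _ => Finset.sum_comm, Finset.sum_comm]
      _ ≤ Fintype.card I * ∑ k : I, ∑ y : Fin n → Bool, 1 := by
          gcongr with k _ y _
          exact hB1 k y
      _ = _ := by simp; ring
  have h4 := norm_sum_mul_sq_le N fun p => X p.1 p.2.2 p.2.1 fun _ => U.1
  rw [← h1] at h4
  refine abs_le_of_sq_le_sq' (h4.trans ?_) (by positivity) |>.2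
  rw [mul_pow, Real.sq_sqrt (by positivity)]
  have h5 : ∑ p : H × R × (Fin n → Bool), ‖X p.1 p.2.2 p.2.1 fun _ => U.1‖ ^ 2 ≤ 1 := by
    simpa only [Fintype.sum_prod_type] using hB0
  calc _ ≤ (Fintype.card I : ℝ) ^ 2 * 2 ^ n * 1 := by gcongr
    _ = _ := mul_one _

/-- As in `norm_fst_error_le`, now with |z⟩⟨ψ| expanded as well, into ∑_w' conj(ψ_w') |z⟩⟨w'|. For q
queries the coefficients have total square q²D. The amplitudes have total square at most q²D², one
unit for each (z, i, k, y). The product q⁴D³ is the square of the bound. -/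
lemma norm_snd_error_le
    {X : H → (Fin n → Bool) → R → MultilinearMap ℂ (fun _ : I => Op (Fin n)) ℂ} (U : QUnitary n)
    (hB0 : ∑ h, ∑ r, ∑ z, ‖X h z r fun _ => U.1‖ ^ 2 ≤ 1)
    (hB2 : ∀ i k, k ≠ i → ∀ x y, ∑ w', ∑ h, ∑ r, ∑ w, ∑ z, ‖X h z r (Function.update
      (Function.update (fun _ => U.1) i (rowOp 1 x w')) k (rowOp U.1 y w))‖ ^ 2 ≤ 1)
    {v ψ : H → Ket (Fin n)} (hv : ∀ h, weight (v h) = 1) (hψ : ∀ h, weight (ψ h) = 1) :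
    ‖∑ h, ∑ r, ∑ w, conj (∑ z, ∑ i, ∑ k, if k = i then 0 else X h z r (Function.update
      (Function.update (fun _ => U.1) i (ketBra z (ψ h))) k (vecMulVec (v h) (U.1 w)))) *
        X h w r fun _ => U.1‖ ≤ (Fintype.card I : ℝ) ^ 2 * (2 ^ n * √(2 ^ n)) := by
  set N : H × R × (Fin n → Bool) → ℂ := fun p => ∑ z, ∑ i, ∑ k, if k = i then 0 else
    X p.1 z p.2.1 (Function.update (Function.update (fun _ => U.1) i (ketBra z (ψ p.1))) k
      (vecMulVec (v p.1) (U.1 p.2.2))) with hN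
  set b : H × R × (Fin n → Bool) → (Fin n → Bool) × I × I × (Fin n → Bool) × (Fin n → Bool) → ℂ :=
    fun p t => if t.2.2.1 = t.2.1 then 0 else X p.1 t.1 p.2.1 (Function.update
      (Function.update (fun _ => U.1) t.2.1 (rowOp 1 t.1 t.2.2.2.2)) t.2.2.1
        (rowOp U.1 t.2.2.2.1 p.2.2)) with hb
  have hN' : ∀ p, N p = ∑ t, (v p.1 t.2.2.2.1 * conj (ψ p.1 t.2.2.2.2)) * b p t := by
    intro p
    simp only [hN, hb, Fintype.sum_prod_type]
    refine Finset.sum_congr rfl fun z _ => Finset.sum_congr rfl fun i _ =>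
      Finset.sum_congr rfl fun k _ => ?_
    split_ifs with hk
    · simp
    · rw [vecMulVec_eq_sum_rowOp, MultilinearMap.map_update_sum]
      refine Finset.sum_congr rfl fun y _ => ?_
      rw [MultilinearMap.map_update_smul, Function.update_comm (Ne.symm hk), ketBra_eq_sum_rowOp,
        MultilinearMap.map_update_sum, smul_eq_mul, Finset.mul_sum]
      refine Finset.sum_congr rfl fun w _ => ?_
      rw [MultilinearMap.map_update_smul, smul_eq_mul, Function.update_comm hk]
      ring
  have hcoef : ∀ h, ∑ t : (Fin n → Bool) × I × I × (Fin n → Bool) × (Fin n → Bool),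
      ‖v h t.2.2.2.1 * conj (ψ h t.2.2.2.2)‖ ^ 2 = 2 ^ n * (Fintype.card I : ℝ) ^ 2 := by
    intro h
    have hv' : ∑ y, ‖v h y‖ ^ 2 = 1 := hv h
    have hψ' : ∑ y, ‖ψ h y‖ ^ 2 = 1 := hψ h
    simp only [Fintype.sum_prod_type, norm_mul, RCLike.norm_conj, mul_pow, ← Finset.mul_sum, hψ',
      mul_one, hv']
    simp
    ring
  have h3 : ∑ p, ‖N p‖ ^ 2 ≤ ((Fintype.card I : ℝ) ^ 2 * (2 ^ n * √(2 ^ n))) ^ 2 := by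
    calc ∑ p, ‖N p‖ ^ 2 ≤ ∑ p, 2 ^ n * (Fintype.card I : ℝ) ^ 2 * ∑ t, ‖b p t‖ ^ 2 := by
          refine Finset.sum_le_sum fun p _ => ?_
          rw [hN', ← hcoef p.1]
          exact norm_sum_mul_sq_le _ _
      _ = 2 ^ n * (Fintype.card I : ℝ) ^ 2 * ∑ z, ∑ i, ∑ k, ∑ y, ∑ w', ∑ h, ∑ r, ∑ w,
            ‖b (h, r, w) (z, i, k, y, w')‖ ^ 2 := by
          rw [← Finset.mul_sum, Finset.sum_comm]
          simp only [Fintype.sum_prod_type]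
      _ ≤ 2 ^ n * (Fintype.card I : ℝ) ^ 2 * ∑ z : Fin n → Bool, ∑ i : I, ∑ k : I,
            ∑ y : Fin n → Bool, 1 := by
          gcongr with z _ i _ k _ y _
          simp only [hb]
          split_ifs with hk
          · simp
          · refine le_trans ?_ (hB2 i k hk z y)
            gcongr with w' _ h _ r _ w _
            -- The tag label equals the label z to which query i is reset. One term of the sum over
            -- all tag labels is therefore enough, and the bound is used with x = z.
            exact Finset.single_le_sum (f := fun z' => ‖X h z' r (Function.update
              (Function.update (fun _ => U.1) i (rowOp 1 z w')) k (rowOp U.1 y w))‖ ^ 2)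
              (fun _ _ => by positivity) (Finset.mem_univ z)
      _ = _ := by
          simp only [Finset.sum_const, Finset.card_univ, nsmul_eq_mul, mul_one]
          rw [mul_pow, mul_pow, Real.sq_sqrt (by positivity)]
          simp
          ring
  have h4 := norm_sum_mul_sq_le (fun p => conj (N p)) fun p => X p.1 p.2.2 p.2.1 fun _ => U.1
  have h5 : ∑ p : H × R × (Fin n → Bool), ‖X p.1 p.2.2 p.2.1 fun _ => U.1‖ ^ 2 ≤ 1 := by
    simpa only [Fintype.sum_prod_type] using hB0
  simp only [RCLike.norm_conj] at h4
  have h6 := h4.trans ((mul_le_of_le_one_right (by positivity) h5).trans h3)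
  simp only [Fintype.sum_prod_type] at h6
  exact abs_le_of_sq_le_sq' h6 (by positivity) |>.2

attribute [local instance] Matrix.linftyOpNormedRing Matrix.linftyOpNormedAlgebra in
/-- For a Haar random oracle the residuals are small. -/
theorem integral_residual_le
    {X : H → (Fin n → Bool) → R → MultilinearMap ℂ (fun _ : I => Op (Fin n)) ℂ}
    (hB0 : ∀ U : QUnitary n, ∑ h, ∑ r, ∑ z, ‖X h z r fun _ => U.1‖ ^ 2 ≤ 1)
    (hB1 : ∀ (U : QUnitary n) k y, ∑ w, ∑ h, ∑ r, ∑ z,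
      ‖X h z r (Function.update (fun _ => U.1) k (rowOp U.1 y w))‖ ^ 2 ≤ 1)
    (hB2 : ∀ (U : QUnitary n) i k, k ≠ i → ∀ x y, ∑ w', ∑ h, ∑ r, ∑ w, ∑ z, ‖X h z r
      (Function.update (Function.update (fun _ => U.1) i (rowOp 1 x w')) k (rowOp U.1 y w))‖ ^ 2
        ≤ 1)
    {ψ : H → Ket (Fin n)} (hψ : ∀ h, weight (ψ h) = 1) :
    ∫ U : QUnitary n, ∑ h, ∑ r, ‖residual (X h · r) (ψ h) U.1‖ ^ 2 ∂haarUnitary n ≤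
      (2 ^ n)⁻¹ + (Fintype.card I + (Fintype.card I : ℝ) ^ 2) / √(2 ^ n) := by
  have cU : ∀ h z r, ContDiff ℂ 2 fun M => X h z r fun _ => M := fun h z r =>
    contDiff_multilinear_diag (m := 2) _
  have cU1 : ∀ h z r, ContDiff ℂ 1 fun M => X h z r fun _ => M := fun h z r =>
    contDiff_multilinear_diag (m := 1) _
  have cX : ∀ h z r, Continuous fun U : QUnitary n => X h z r fun _ => U.1 := fun h z r =>
    (cU h z r).continuous.comp continuous_subtype_val
  have cc : ∀ {f : QUnitary n → ℂ}, Continuous f → Continuous fun U => conj (f U) :=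
    fun hf => Complex.continuous_conj.comp hf
  have hres : ∀ h r M, residual (X h · r) (ψ h) M = ∑ z, conj ((M *ᵥ ψ h) z) * X h z r (fun _ => M) -
      (2 ^ n)⁻¹ * divergence (ψ h) (fun z M => X h z r fun _ => M) M := by
    intro h r M
    rw [residual, divergence_multilinear (fun z => X h z r)]
  have cdiv : ∀ h r, ContDiff ℂ 1 (divergence (ψ h) fun z M => X h z r fun _ => M) := fun h r =>
    contDiff_divergence _ fun z => cU h z r
  have cres : ∀ h r, Continuous fun U : QUnitary n => residual (X h · r) (ψ h) U.1 := by
    intro h r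
    simp only [hres]
    exact (continuous_finsetSum _ fun z _ => (cc (continuous_mulVec _ z)).mul (cX h z r)).sub
      (continuous_const.mul ((cdiv h r).continuous.comp continuous_subtype_val))
  set A : H → R → QUnitary n → ℂ := fun h r U => ∑ z, ((‖X h z r fun _ => U.1‖ ^ 2 : ℝ) : ℂ) with hA
  set B : H → R → QUnitary n → ℂ := fun h r U => ∑ z, ∑ w,
    conj (fderiv ℂ (fun M => X h z r fun _ => M) U.1 (vecMulVec (U.1 *ᵥ ψ h) (U.1 w))) *
      ((U.1 *ᵥ ψ h) z * X h w r fun _ => U.1) with hB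
  set C : H → R → QUnitary n → ℂ := fun h r U => ∑ w,
    conj (fderiv ℂ (divergence (ψ h) fun z M => X h z r fun _ => M) U.1
      (vecMulVec (U.1 *ᵥ ψ h) (U.1 w))) * X h w r fun _ => U.1 with hC
  have cA : ∀ h r, Continuous (A h r) := fun h r => continuous_finsetSum _ fun z _ =>
    Complex.continuous_ofReal.comp ((cX h z r).norm.pow 2)
  have cB : ∀ h r, Continuous (B h r) := fun h r => continuous_finsetSum _ fun z _ =>
    continuous_finsetSum _ fun w _ => (cc (continuous_fderiv_comp (cU1 h z r)
      (continuous_vecMulVec_row _ w))).mul ((continuous_mulVec _ z).mul (cX h w r))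
  have cC : ∀ h r, Continuous (C h r) := fun h r => continuous_finsetSum _ fun w _ =>
    (cc (continuous_fderiv_comp (cdiv h r) (continuous_vecMulVec_row _ w))).mul (cX h w r)
  have hid : ∀ h r, ∫ U : QUnitary n, ((‖residual (X h · r) (ψ h) U.1‖ ^ 2 : ℝ) : ℂ)
      ∂haarUnitary n = (2 ^ n)⁻¹ * ∫ U, A h r U ∂haarUnitary n -
        (2 ^ n)⁻¹ * ∫ U, B h r U ∂haarUnitary n +
        (2 ^ n)⁻¹ ^ 2 * ∫ U, C h r U ∂haarUnitary n := by
    intro h r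
    simp only [hres]
    exact integral_sub_divergence (X := fun z M => X h z r fun _ => M) (hψ h) fun z => cU h z r
  have hsum : ((∫ U : QUnitary n, ∑ h, ∑ r, ‖residual (X h · r) (ψ h) U.1‖ ^ 2 ∂haarUnitary n : ℝ) :
      ℂ) = (2 ^ n)⁻¹ * ∫ U, ∑ h, ∑ r, A h r U ∂haarUnitary n -
        (2 ^ n)⁻¹ * ∫ U, ∑ h, ∑ r, B h r U ∂haarUnitary n +
        (2 ^ n)⁻¹ ^ 2 * ∫ U, ∑ h, ∑ r, C h r U ∂haarUnitary n := by
    have hswap : ∀ F : H → R → QUnitary n → ℂ, (∀ h r, Continuous (F h r)) →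
        ∫ U, ∑ h, ∑ r, F h r U ∂haarUnitary n = ∑ h, ∑ r, ∫ U, F h r U ∂haarUnitary n := by
      intro F hF
      rw [integral_finsetSum _ fun h _ => integrable_haar (continuous_finsetSum _ fun r _ => hF h r)]
      exact Finset.sum_congr rfl fun h _ => integral_finsetSum _ fun r _ => integrable_haar (hF h r)
    rw [← integral_complex_ofReal, hswap A cA, hswap B cB, hswap C cC]
    simp only [Complex.ofReal_sum]
    rw [hswap (fun h r U => ((‖residual (X h · r) (ψ h) U.1‖ ^ 2 : ℝ) : ℂ)) fun h r => Complex.continuous_ofReal.comp ((cres h r).norm.pow 2)]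
    simp only [hid, Finset.sum_add_distrib, Finset.sum_sub_distrib, Finset.mul_sum]
  have bA : ‖∫ U, ∑ h, ∑ r, A h r U ∂haarUnitary n‖ ≤ 1 := by
    refine (norm_integral_le_of_norm_le_const (C := 1) (.of_forall fun U => ?_)).trans (by simp)
    simp only [hA, ← Complex.ofReal_sum]
    rw [Complex.norm_real, Real.norm_of_nonneg (by positivity)]
    exact hB0 U
  have bB : ‖∫ U, ∑ h, ∑ r, B h r U ∂haarUnitary n‖ ≤ Fintype.card I * √(2 ^ n) := by
    refine (norm_integral_le_of_norm_le_const (C := Fintype.card I * √(2 ^ n))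
      (.of_forall fun U => ?_)).trans (by simp)
    simp only [hB, fderiv_multilinear_diag]
    exact norm_fst_error_le U (hB0 U) (hB1 U) fun h => (weight_mulVec U.2 _).trans (hψ h)
  have bC : ‖∫ U, ∑ h, ∑ r, C h r U ∂haarUnitary n‖ ≤
      (Fintype.card I : ℝ) ^ 2 * (2 ^ n * √(2 ^ n)) := by
    refine (norm_integral_le_of_norm_le_const (C := (Fintype.card I : ℝ) ^ 2 * (2 ^ n * √(2 ^ n)))
      (.of_forall fun U => ?_)).trans (by simp)
    simp only [hC, fderiv_divergence_multilinear (fun z => X _ z _)]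
    exact norm_snd_error_le U (hB0 U) (hB2 U) (fun h => (weight_mulVec U.2 _).trans (hψ h)) hψ
  have h0 : 0 ≤ ∫ U : QUnitary n, ∑ h, ∑ r, ‖residual (X h · r) (ψ h) U.1‖ ^ 2 ∂haarUnitary n :=
    integral_nonneg fun U => Finset.sum_nonneg fun h _ => Finset.sum_nonneg fun r _ => by positivity
  have hn : ‖((2 ^ n)⁻¹ : ℂ)‖ = (2 ^ n)⁻¹ := by simp
  have hs : √((2 : ℝ) ^ n) * √(2 ^ n) = 2 ^ n := Real.mul_self_sqrt (by positivity)
  have hs0 : 0 < √((2 : ℝ) ^ n) := Real.sqrt_pos.2 (by positivity)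
  rw [← Real.norm_of_nonneg h0, ← Complex.norm_real, hsum]
  -- The three terms of the second moment carry the weights 1/D, 1/D and 1/D², and have the bounds
  -- 1, q√D and q²D√D.
  calc _ ≤ (2 ^ n)⁻¹ * 1 + (2 ^ n)⁻¹ * (Fintype.card I * √(2 ^ n)) +
        (2 ^ n)⁻¹ ^ 2 * ((Fintype.card I : ℝ) ^ 2 * (2 ^ n * √(2 ^ n))) := by
        refine (norm_add_le _ _).trans (add_le_add ((norm_sub_le _ _).trans (add_le_add ?_ ?_)) ?_)
        all_goals
          rw [norm_mul]
          first | rw [norm_pow, hn] | rw [hn]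
          gcongr
    _ = _ := by
        generalize √((2 : ℝ) ^ n) = s at hs hs0
        rw [← hs]
        field_simp
        ring

end CoreBound

end QUnf

end

noncomputable section
namespace QUnf

open Matrix
open scoped ComplexConjugate

set_option linter.unusedSectionVars false

/-! ### Fidelity with a pure state and partial inner products. -/

section FidelityLemmas

open scoped ComplexOrder MatrixOrder

variable {ι : Type} [Fintype ι] [DecidableEq ι]

lemma pureState_posSemidef (ψ : Ket ι) : (pureState ψ).PosSemidef :=
  posSemidef_vecMulVec_self_star ψ

lemma pureState_mul_mul_pureState (ψ : Ket ι) (ρ : Op ι) :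
    pureState ψ * ρ * pureState ψ = (star ψ ⬝ᵥ ρ *ᵥ ψ) • pureState ψ := by
  rw [pureState, vecMulVec_mul, vecMulVec_mul_vecMulVec, ← dotProduct_mulVec]
  ext a b
  simp [vecMulVec_apply]
  ring

lemma star_dotProduct_self {ψ : Ket ι} (hψ : weight ψ = 1) : star ψ ⬝ᵥ ψ = 1 := by
  rw [← ofReal_weight, hψ, Complex.ofReal_one]

/-- The fidelity with a pure state. -/
lemma fidelity_pureState {ψ : Ket ι} (hψ : weight ψ = 1) {ρ : Op ι} (hρ : ρ.PosSemidef) :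
    fidelity (pureState ψ) ρ = (star ψ ⬝ᵥ ρ *ᵥ ψ).re := by
  have hself : pureState ψ * pureState ψ = pureState ψ := by
    rw [pureState, vecMulVec_mul_vecMulVec, star_dotProduct_self hψ]; simp
  -- A pure state is a projection, hence its own positive square root. Then √ρ σ √ρ is a scalar
  -- multiple of it, and both square roots are explicit.
  have hsqrt : CFC.sqrt (pureState ψ) = pureState ψ :=
    CFC.sqrt_unique hself (pureState_posSemidef ψ).nonneg
  have h0 := hρ.dotProduct_mulVec_nonneg ψ
  obtain ⟨h0r, h0i⟩ := Complex.nonneg_iff.1 h0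
  set c := (star ψ ⬝ᵥ ρ *ᵥ ψ).re with hc
  have hcc : star ψ ⬝ᵥ ρ *ᵥ ψ = (c : ℂ) := by
    apply Complex.ext
    · simp [hc]
    · simp [← h0i]
  have hsc : ((√c : ℝ) : ℂ) * ((√c : ℝ) : ℂ) = c := by
    rw [← Complex.ofReal_mul, Real.mul_self_sqrt h0r]
  have hsqrt2 : CFC.sqrt (pureState ψ * ρ * pureState ψ) = ((√c : ℝ) : ℂ) • pureState ψ := by
    refine CFC.sqrt_unique ?_ ?_
    · rw [pureState_mul_mul_pureState, hcc, smul_mul_smul_comm, hself, hsc]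
    · exact ((pureState_posSemidef ψ).smul (by
        rw [Complex.zero_le_real]; exact Real.sqrt_nonneg c)).nonneg
  rw [fidelity, hsqrt, hsqrt2, trace_smul, pureState, trace_vecMulVec, dotProduct_comm,
    star_dotProduct_self hψ]
  simp [Real.sq_sqrt h0r]

variable {k : ℕ}

/-- The partial inner product of the wires selected by `f` with `ψ`. -/
def contract (f : Fin k ↪ ι) (ψ : Ket (Fin k)) (φ : Ket ι) (r : Rest f) : ℂ :=
  ∑ z, conj (ψ z) * φ (join f z r)

lemma reducedState_eq (f : Fin k ↪ ι) (φ : Ket ι) :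
    reducedState f φ = ((weight φ)⁻¹ : ℂ) • ∑ r : Rest f, pureState fun a => φ (join f a r) := by
  ext a b
  rw [reducedState, Matrix.smul_apply, Matrix.sum_apply, smul_eq_mul, sum_join f]
  congr 1
  refine Finset.sum_congr rfl fun r _ => ?_
  rw [Finset.sum_eq_single a]
  · simp [pureState, vecMulVec_apply]
  · intro c _ hc
    simp [hc]
  · simp

lemma reducedState_posSemidef (f : Fin k ↪ ι) (φ : Ket ι) : (reducedState f φ).PosSemidef := by
  rw [reducedState_eq]
  refine (posSemidef_sum _ fun r _ => pureState_posSemidef _).smul ?_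
  rw [← Complex.ofReal_inv, Complex.zero_le_real]
  exact inv_nonneg.2 (weight_nonneg φ)

lemma reducedState_isDensity (f : Fin k ↪ ι) {φ : Ket ι} (hφ : weight φ ≠ 0) :
    IsDensity (reducedState f φ) := by
  refine ⟨reducedState_posSemidef f φ, ?_⟩
  rw [reducedState_eq, trace_smul, trace_sum]
  have : ∀ r : Rest f, (pureState fun a => φ (join f a r)).trace =
      ((∑ a, ‖φ (join f a r)‖ ^ 2 : ℝ) : ℂ) := by
    intro r
    rw [pureState, trace_vecMulVec, dotProduct_comm]
    exact (ofReal_weight fun a => φ (join f a r)).symm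
  rw [Finset.sum_congr rfl fun r _ => this r, ← Complex.ofReal_sum, ← weight_join, smul_eq_mul,
    inv_mul_cancel₀]
  exact_mod_cast hφ

/-- The reduced state is the normalised sum, over the labels of the other wires, of the pure states
of the slices of φ. Multiplication by the weight removes the normalisation, so the right side is
quadratic in φ. -/
lemma weight_mul_fidelity (f : Fin k ↪ ι) {ψ : Ket (Fin k)} (hψ : weight ψ = 1) {φ : Ket ι}
    (hφ : weight φ ≠ 0) :
    weight φ * fidelity (pureState ψ) (reducedState f φ) = ∑ r, ‖contract f ψ φ r‖ ^ 2 := by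
  rw [fidelity_pureState hψ (reducedState_posSemidef f φ), reducedState_eq, smul_mulVec,
    dotProduct_smul, sum_mulVec, dotProduct_sum]
  have h : ∀ r : Rest f, star ψ ⬝ᵥ (pureState fun a => φ (join f a r)) *ᵥ ψ =
      ((‖contract f ψ φ r‖ ^ 2 : ℝ) : ℂ) := by
    intro r
    have e : star ψ ⬝ᵥ (fun a => φ (join f a r)) = contract f ψ φ r := rfl
    have e' : star (fun a => φ (join f a r)) ⬝ᵥ ψ = conj (contract f ψ φ r) := by
      rw [contract, map_sum]
      exact Finset.sum_congr rfl fun z _ => by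
        rw [map_mul, Complex.conj_conj, mul_comm]; rfl
    rw [pureState, vecMulVec_mulVec, dotProduct_smul, e, e', Complex.ofReal_pow,
      ← Complex.conj_mul']
    simp [mul_comm]
  rw [Finset.sum_congr rfl fun r _ => h r, ← Complex.ofReal_sum, smul_eq_mul,
    ← Complex.ofReal_inv, ← Complex.ofReal_mul, Complex.ofReal_re, ← mul_assoc,
    mul_inv_cancel₀ hφ, one_mul]

lemma fidelity_nonneg (ρ σ : Op ι) : 0 ≤ fidelity ρ σ := sq_nonneg _

lemma sum_norm_contract_le (f : Fin k ↪ ι) {ψ : Ket (Fin k)} (hψ : weight ψ = 1) (φ : Ket ι) :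
    ∑ r, ‖contract f ψ φ r‖ ^ 2 ≤ weight φ := by
  rw [weight_join f]
  refine Finset.sum_le_sum fun r _ => ?_
  refine (norm_sum_mul_sq_le _ _).trans (le_of_eq ?_)
  have : ∑ z, ‖conj (ψ z)‖ ^ 2 = 1 := by simp only [RCLike.norm_conj]; exact hψ
  rw [this, one_mul]

end FidelityLemmas

/-! ### Acceptance probability as a function of the fidelity. -/

section Tests

variable {n : ℕ}

open scoped ComplexOrder

lemma tensorPow_diagonal {X : Type} [DecidableEq X] (κ : ℕ) (d : X → ℂ) :
    tensorPow κ (diagonal d) = diagonal fun a => ∏ i, d (a i) := by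
  ext a b
  rw [tensorPow]
  by_cases h : a = b
  · subst h; simp
  · rw [diagonal_apply_ne _ h]
    obtain ⟨i, hi⟩ := Function.ne_iff.1 h
    exact Finset.prod_eq_zero (Finset.mem_univ i) (diagonal_apply_ne _ hi)

lemma pureState_basisKet {ι : Type} [Fintype ι] [DecidableEq ι] (b : ι → Bool) :
    pureState (basisKet b) = diagonal fun x => if x = b then 1 else 0 := by
  ext x y
  by_cases h : x = y
  · subst h
    by_cases hb : x = b <;> simp [pureState, vecMulVec_apply, basisKet, hb]
  · rw [diagonal_apply_ne _ h]
    by_cases hb : x = b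
    · have : y ≠ b := fun e => h (hb.trans e.symm)
      simp [pureState, vecMulVec_apply, basisKet, this]
    · simp [pureState, vecMulVec_apply, basisKet, hb]

/-- The acceptance probability of a test as a polynomial in the fidelity. -/
lemma QuantumTest.f_eq_sum (T : QuantumTest n) (hn : 0 < n) (κ₁ κ₂ : ℕ) :
    ∃ e : (Fin κ₁ → Fin n → Bool) → ℝ, (∀ a, 0 ≤ e a ∧ e a ≤ 1) ∧ ∀ F, 0 ≤ F → F ≤ 1 →
      T.f κ₁ κ₂ F = ∑ a, e a * ∏ i, ((if a i = fun _ => false then F else 0) +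
        if a i = fun _ => true then 1 - F else 0) := by
  -- Since acceptance depends on the fidelity alone, it can be computed on commuting states: the
  -- reference |0…0⟩ and the mixture F|0…0⟩⟨0…0| + (1 − F)|1…1⟩⟨1…1|. All tensor powers are then
  -- diagonal, and only the diagonal entries of the effect at (a, o) matter.
  set o : Fin κ₂ → Fin n → Bool := fun _ _ => false
  refine ⟨fun a => (T.effect κ₁ κ₂ (a, o) (a, o)).re, fun a => ⟨?_, ?_⟩, fun F hF0 hF1 => ?_⟩
  · exact (Complex.nonneg_iff.1 ((T.effect_nonneg κ₁ κ₂).diag_nonneg)).1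
  · have h := (Complex.nonneg_iff.1 ((T.effect_le_one κ₁ κ₂).diag_nonneg (i := (a, o)))).1
    simp only [Matrix.sub_apply, one_apply_eq, Complex.sub_re, Complex.one_re] at h
    linarith
  set d : (Fin n → Bool) → ℝ := fun x => (if x = fun _ => false then F else 0) +
    if x = fun _ => true then 1 - F else 0 with hd
  -- With no qubits the two labels would coincide and the mixture would not have fidelity F.
  have hne : (fun _ : Fin n => false) ≠ fun _ => true := fun h =>
    Bool.false_ne_true (congrFun h ⟨0, hn⟩)
  have hd0 : ∀ x, 0 ≤ d x := by
    intro x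
    simp only [hd]
    refine add_nonneg ?_ ?_ <;> split_ifs <;> linarith
  have hdens : IsDensity (diagonal fun x => (d x : ℂ) : Op (Fin n)) := by
    refine ⟨PosSemidef.diagonal fun x => by
      simpa only [Pi.zero_apply, Complex.zero_le_real] using hd0 x, ?_⟩
    rw [trace_diagonal, ← Complex.ofReal_sum]
    simp [hd, Finset.sum_add_distrib]
  have hfid : fidelity (pureState (basisKet fun _ => false))
      (diagonal fun x => (d x : ℂ) : Op (Fin n)) = F := by
    rw [fidelity_pureState (weight_basisKet _) hdens.1]
    have : star (basisKet fun _ : Fin n => false) ⬝ᵥ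
        (diagonal fun x => (d x : ℂ)) *ᵥ basisKet (fun _ : Fin n => false) =
        (d fun _ => false : ℂ) := by
      simp only [dotProduct, mulVec_diagonal, Pi.star_apply, basisKet]
      simp
    rw [this, Complex.ofReal_re]
    simp [hd, hne]
  have h := T.accept_eq κ₁ κ₂ _ (basisKet fun _ => false) hdens (weight_basisKet _)
  rw [hfid, pureState_basisKet, tensorPow_diagonal, tensorPow_diagonal,
    Matrix.kronecker, kroneckerMap_diagonal_diagonal _ (by simp) (by simp)] at h
  have h' := congrArg Complex.re h
  rw [Complex.ofReal_re] at h'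
  rw [← h', Matrix.trace, Complex.re_sum, Fintype.sum_prod_type]
  refine Finset.sum_congr rfl fun a _ => ?_
  rw [Finset.sum_eq_single o]
  · have h1 : ∏ i, (if o i = fun _ => false then (1 : ℂ) else 0) = 1 :=
      Finset.prod_eq_one fun i _ => if_pos rfl
    rw [diag_apply, mul_diagonal, ← Complex.ofReal_prod, h1, mul_one, Complex.re_mul_ofReal]
  · intro b _ hb
    obtain ⟨i, hi⟩ := Function.ne_iff.1 hb
    have : ∏ i, (if b i = fun _ => false then (1 : ℂ) else 0) = 0 :=
      Finset.prod_eq_zero (Finset.mem_univ i) (if_neg hi)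
    rw [diag_apply, mul_diagonal, this]
    simp
  · simp

/-- In the diagonal model of `QuantumTest.f_eq_sum` all κ₁ copies of the tag are |1…1⟩ with
probability (1 − F)^κ₁, and then the test accepts as at fidelity 0. The remaining probability is at
most κ₁F by Bernoulli's inequality, and contributes at most itself. -/
lemma QuantumTest.f_zero_eq (T : QuantumTest n) (hn : 0 < n) (κ₁ κ₂ : ℕ) : 0 ≤ T.f κ₁ κ₂ 0 ∧
    ∀ F, 0 ≤ F → F ≤ 1 → T.f κ₁ κ₂ F ≤ T.f κ₁ κ₂ 0 + κ₁ * F := by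
  obtain ⟨e, he, hf⟩ := T.f_eq_sum hn κ₁ κ₂
  have hne : (fun _ : Fin n => false) ≠ fun _ => true := fun h =>
    Bool.false_ne_true (congrFun h ⟨0, hn⟩)
  set one : Fin κ₁ → Fin n → Bool := fun _ _ => true with hone
  have h0 : T.f κ₁ κ₂ 0 = e one := by
    rw [hf 0 le_rfl zero_le_one, Finset.sum_eq_single one]
    · simp [hone]
    · intro a _ ha
      obtain ⟨i, hi⟩ := Function.ne_iff.1 ha
      rw [Finset.prod_eq_zero (Finset.mem_univ i), mul_zero]
      have hi' : a i ≠ fun _ => true := hi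
      simp [hi']
    · simp
  refine ⟨h0 ▸ (he one).1, fun F hF0 hF1 => ?_⟩
  set d : (Fin n → Bool) → ℝ := fun x => (if x = fun _ => false then F else 0) +
    if x = fun _ => true then 1 - F else 0 with hd
  have hd0 : ∀ x, 0 ≤ d x := by
    intro x
    simp only [hd]
    refine add_nonneg ?_ ?_ <;> split_ifs <;> linarith
  have hsum : ∑ a : Fin κ₁ → Fin n → Bool, ∏ i, d (a i) = 1 := by
    have h := Finset.prod_univ_sum (κ := fun _ : Fin κ₁ => Fin n → Bool)
      (fun _ => Finset.univ) fun _ x => d x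
    rw [Fintype.piFinset_univ] at h
    rw [← h]
    simp [hd, Finset.sum_add_distrib]
  have hd1 : ∏ i, d (one i) = (1 - F) ^ κ₁ := by
    simp [hd, hone, hne.symm]
  have hb : 1 - κ₁ * F ≤ (1 - F) ^ κ₁ := by
    have := one_add_mul_le_pow (show (-2 : ℝ) ≤ -F by linarith) κ₁
    rw [sub_eq_add_neg 1 F]
    linarith
  have hp1 : (1 - F) ^ κ₁ ≤ 1 := pow_le_one₀ (by linarith) (by linarith)
  rw [hf F hF0 hF1, h0]
  change ∑ a, e a * ∏ i, d (a i) ≤ _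
  rw [← Finset.add_sum_erase _ _ (Finset.mem_univ one), hd1]
  rw [← Finset.add_sum_erase _ _ (Finset.mem_univ one), hd1] at hsum
  have hle : ∑ a ∈ Finset.univ.erase one, e a * ∏ i, d (a i) ≤
      ∑ a ∈ Finset.univ.erase one, ∏ i, d (a i) :=
    Finset.sum_le_sum fun a _ =>
      mul_le_of_le_one_left (Finset.prod_nonneg fun i _ => hd0 _) (he a).2
  have h1 : e one * (1 - F) ^ κ₁ ≤ e one := mul_le_of_le_one_right (he one).1 hp1
  linarith

/-- The weighted acceptance probability of a tag, in terms of its overlap with the answer. -/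
lemma QuantumTest.weight_mul_acceptProb_le (T : QuantumTest n) (hn : 0 < n) (κ₁ κ₂ : ℕ) {ι : Type}
    [Fintype ι] [DecidableEq ι] (f : Fin n ↪ ι) {v : Ket (Fin n)} (hv : weight v = 1) (φ : Ket ι) :
    weight φ * T.acceptProb κ₁ κ₂ (reducedState f φ) (pureState v) ≤
      weight φ * T.f κ₁ κ₂ 0 + κ₁ * ∑ r, ‖contract f v φ r‖ ^ 2 := by
  -- For the zero ket the reduced state is not a density matrix and the law of the test does not
  -- apply; both sides carry the factor 0 or are nonnegative.
  by_cases hφ : weight φ = 0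
  · rw [hφ, zero_mul, zero_mul, zero_add]; positivity
  · have hpos : 0 < weight φ := lt_of_le_of_ne (weight_nonneg φ) (Ne.symm hφ)
    have hF := weight_mul_fidelity f hv hφ
    rw [QuantumTest.acceptProb, T.accept_eq κ₁ κ₂ _ v (reducedState_isDensity f hφ) hv,
      Complex.ofReal_re, ← hF]
    have h1 : fidelity (pureState v) (reducedState f φ) ≤ 1 := by
      have := hF.le.trans (sum_norm_contract_le f hv φ)
      exact le_of_mul_le_mul_left (this.trans (mul_one _).ge) hpos
    have := (T.f_zero_eq hn κ₁ κ₂).2 _ (fidelity_nonneg _ _) h1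
    calc _ ≤ weight φ * (T.f κ₁ κ₂ 0 + κ₁ * fidelity (pureState v) (reducedState f φ)) := by gcongr
      _ = _ := by ring

end Tests

end QUnf

end

noncomputable section
namespace QUnf

open Matrix MeasureTheory
open scoped ComplexConjugate

set_option linter.unusedSectionVars false

/-! ### Finite sequences of answers. -/

section Extension

variable {n q : ℕ}

/-- A finite sequence of matrices, continued by the identity. -/
def extendOps (O : Fin q → Op (Fin n)) (k : ℕ) : Op (Fin n) := if h : k < q then O ⟨k, h⟩ else 1

lemma extendOps_update (O : Fin q → Op (Fin n)) (k : Fin q) (A : Op (Fin n)) :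
    extendOps (Function.update O k A) = Function.update (extendOps O) k A := by
  funext j
  by_cases hj : j = k
  · subst hj; simp [extendOps]
  · rw [Function.update_of_ne hj, extendOps, extendOps]
    split_ifs with h
    · exact Function.update_of_ne (fun e => hj (congrArg Fin.val e)) _ _
    · rfl

lemma extendOps_mem {O : Fin q → Op (Fin n)}
    (hO : ∀ k, O k ∈ Matrix.unitaryGroup (Fin n → Bool) ℂ) (k : ℕ) :
    extendOps O k ∈ Matrix.unitaryGroup (Fin n → Bool) ℂ := by
  rw [extendOps]
  split_ifs
  · exact hO _
  · exact one_mem _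

end Extension

/-! ### Branches of a run as a sum over measurement outcomes. -/

section Branches

variable {n : ℕ} {ι : Type} [Fintype ι] [DecidableEq ι]

/-- The states of the query register at the queries on a given path. -/
def queryStates (U : Op (Fin n)) : (c : List (Instr n ι)) → Hist c → Ket ι → List (Op (Fin n))
  | [], _, _ => []
  | .gate g :: c, h, φ => queryStates U c h (g.apply φ)
  | .query e :: c, h, φ => reducedState e φ :: queryStates U c h (applyOn e U φ)
  | .measure i :: c, h, φ => queryStates U c h.2 (projWire i h.1 φ)

lemma sum_map_run (U : QUnitary n) (c : List (Instr n ι)) (b : Branch n ι) (f : Branch n ι → ℝ) :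
    ((run U c b).map f).sum =
      ∑ h, f ⟨evolve c (fun _ => U.1) h b.state, b.queries ++ queryStates U.1 c h b.state⟩ := by
  induction c generalizing b with
  | nil =>
    refine Eq.trans ?_ (Fintype.sum_unique (ι := Unit) fun _ => f ⟨b.state, b.queries ++ []⟩).symm
    simp [run]
  | cons a c ih =>
    cases a with
    | gate g => exact ih _
    | query e =>
      refine (ih _).trans (Finset.sum_congr rfl fun h _ => ?_)
      rw [evolve, queryStates, List.append_assoc, List.singleton_append]
    | measure i =>
      rw [run, List.map_append, List.sum_append, ih, ih]
      exact (sum_hist_measure i c fun h => f ⟨evolve (.measure i :: c) (fun _ => U.1) h b.state,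
        b.queries ++ queryStates U.1 (.measure i :: c) h b.state⟩).symm

lemma evolve_zero (c : List (Instr n ι)) (O : ℕ → Op (Fin n)) (h : Hist c) :
    evolve c O h 0 = 0 := by simpa using evolve_smul c O h 0 0

lemma applyOn_ketBra_join (e : Fin n ↪ ι) (z : Fin n → Bool) (ψ : Ket (Fin n)) (φ : Ket ι)
    (a : Fin n → Bool) (r : Rest e) :
    applyOn e (ketBra z ψ) φ (join e a r) = if a = z then contract e ψ φ r else 0 := by
  rw [applyOn_join]
  by_cases h : a = z <;> simp [ketBra, contract, h]

/-- Zero fidelity means that every partial inner product of the query register with ψ vanishes, even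
when the register is entangled with the memory. A query of weight zero needs its own case, since its
reduced state is not normalised. -/
lemma applyOn_ketBra_eq_zero {e : Fin n ↪ ι} {ψ : Ket (Fin n)} (hψ : weight ψ = 1) {φ : Ket ι}
    (h : fidelity (pureState ψ) (reducedState e φ) ≤ 0) (z : Fin n → Bool) :
    applyOn e (ketBra z ψ) φ = 0 := by
  have hc : ∀ r, contract e ψ φ r = 0 := by
    have hs : ∑ r, ‖contract e ψ φ r‖ ^ 2 ≤ 0 := by
      by_cases hφ : weight φ = 0
      · exact (sum_norm_contract_le e hψ φ).trans hφ.le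
      · rw [← weight_mul_fidelity e hψ hφ]
        exact mul_nonpos_of_nonneg_of_nonpos (weight_nonneg φ) h
    have := (Finset.sum_eq_zero_iff_of_nonneg fun r _ => sq_nonneg _).1
      (hs.antisymm (Finset.sum_nonneg fun r _ => sq_nonneg ‖contract e ψ φ r‖))
    simpa using this
  funext x
  rw [← join_split e x, applyOn_ketBra_join, hc]
  simp

/-- If the queries on a path are orthogonal to `ψ`, the component along `ψ` of a query
vanishes. -/
lemma evolve_update_ketBra_eq_zero {ψ : Ket (Fin n)} (hψ : weight ψ = 1) (U : Op (Fin n))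
    (c : List (Instr n ι)) (h : Hist c) (φ : Ket ι)
    (hq : ∀ ρ ∈ queryStates U c h φ, fidelity (pureState ψ) ρ ≤ 0) (z : Fin n → Bool)
    (k : ℕ) (hk : k < numQueries c) :
    evolve c (Function.update (fun _ => U) k (ketBra z ψ)) h φ = 0 := by
  induction c generalizing φ k with
  | nil => simp [numQueries] at hk
  | cons a c ih =>
    cases a with
    | gate g => exact ih _ _ hq _ hk
    | query e =>
      cases k with
      | zero =>
        rw [evolve_query_update_zero, applyOn_ketBra_eq_zero hψ (hq _ List.mem_cons_self),
          evolve_zero]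
      | succ k =>
        rw [evolve_query_update_succ]
        exact ih _ _ (fun ρ hρ => hq ρ (List.mem_cons_of_mem _ hρ)) _
          (by simpa [numQueries] using hk)
    | measure i => exact ih _ _ hq _ hk

lemma projectOn_add {k : ℕ} (f : Fin k ↪ ι) (s : Fin k → Bool) (φ ψ : Ket ι) :
    projectOn f s (φ + ψ) = projectOn f s φ + projectOn f s ψ := by
  funext x; by_cases h : x ∘ f = s <;> simp [projectOn, h]

lemma projectOn_smul {k : ℕ} (f : Fin k ↪ ι) (s : Fin k → Bool) (c : ℂ) (φ : Ket ι) :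
    projectOn f s (c • φ) = c • projectOn f s φ := by
  funext x; by_cases h : x ∘ f = s <;> simp [projectOn, h]

lemma weight_applyGates (c : List (Gate ι)) (φ : Ket ι) : weight (applyGates c φ) = weight φ := by
  induction c generalizing φ with
  | nil => rfl
  | cons g c ih => exact (ih _).trans (weight_applyOn _ g.mat.2 _)

end Branches

/-! ### The final amplitudes of an adversary as multilinear forms. -/

namespace Adversary

variable {n : ℕ} (A : Adversary n)

/-- The queries of the adversary. -/
abbrev Ix : Type := Fin (numQueries A.phase₁) ⊕ Fin (numQueries A.phase₂)

/-- The measurement outcomes in a run of the adversary, with the submitted description. -/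
abbrev Path : Type := Hist A.phase₁ × (Fin A.descLen → Bool) × Hist A.phase₂

/-- The state before the second phase. -/
def middle (O : ℕ → Op (Fin n)) (h : Hist A.phase₁) (s : Fin A.descLen → Bool) : Ket A.Wire :=
  projectOn A.desc s (evolve A.phase₁ O h (basisKet fun _ => false))

/-- The unnormalised final state on a path when the `k`-th query is answered with `O k`. -/
def final (O : A.Ix → Op (Fin n)) (h : A.Path) : Ket A.Wire :=
  evolve A.phase₂ (extendOps (O ∘ Sum.inr)) h.2.2
    (A.middle (extendOps (O ∘ Sum.inl)) h.1 h.2.1)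

lemma final_update_inl (O : A.Ix → Op (Fin n)) (h : A.Path) (k : Fin (numQueries A.phase₁))
    (M : Op (Fin n)) : A.final (Function.update O (Sum.inl k) M) h =
      evolve A.phase₂ (extendOps (O ∘ Sum.inr)) h.2.2
        (A.middle (Function.update (extendOps (O ∘ Sum.inl)) k M) h.1 h.2.1) := by
  rw [final, Sum.update_inl_comp_inl, Sum.update_inl_comp_inr, extendOps_update]

lemma final_update_inr (O : A.Ix → Op (Fin n)) (h : A.Path) (k : Fin (numQueries A.phase₂))
    (M : Op (Fin n)) : A.final (Function.update O (Sum.inr k) M) h =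
      evolve A.phase₂ (Function.update (extendOps (O ∘ Sum.inr)) k M) h.2.2
        (A.middle (extendOps (O ∘ Sum.inl)) h.1 h.2.1) := by
  rw [final, Sum.update_inr_comp_inl, Sum.update_inr_comp_inr, extendOps_update]

/-- The amplitudes of the final state as multilinear forms in the answers to the queries. -/
def amp (h : A.Path) (z : Fin n → Bool) (r : Rest A.tag) :
    MultilinearMap ℂ (fun _ : A.Ix => Op (Fin n)) ℂ where
  toFun O := A.final O h (join A.tag z r)
  map_update_add' := by
    intro inst O i M N
    obtain rfl : inst = instDecidableEqSum := Subsingleton.elim _ _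
    rcases i with k | k
    · simp only [final_update_inl, middle]
      rw [evolve_update_add _ _ _ _ _ k.2, projectOn_add, evolve_add]; rfl
    · simp only [final_update_inr]
      rw [evolve_update_add _ _ _ _ _ k.2]; rfl
  map_update_smul' := by
    intro inst O i c M
    obtain rfl : inst = instDecidableEqSum := Subsingleton.elim _ _
    rcases i with k | k
    · simp only [final_update_inl, middle]
      rw [evolve_update_smul _ _ _ _ _ k.2, projectOn_smul, evolve_smul]; rfl
    · simp only [final_update_inr]
      rw [evolve_update_smul _ _ _ _ _ k.2]; rfl

lemma amp_apply (h : A.Path) (z : Fin n → Bool) (r : Rest A.tag) (O : A.Ix → Op (Fin n)) :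
    A.amp h z r O = A.final O h (join A.tag z r) := rfl

lemma sum_norm_amp (h : A.Path) (O : A.Ix → Op (Fin n)) :
    ∑ r, ∑ z, ‖A.amp h z r O‖ ^ 2 = weight (A.final O h) := (weight_join A.tag _).symm

lemma sum_path (F : A.Path → ℝ) : ∑ h, F h = ∑ h₁, ∑ s, ∑ h₂, F (h₁, s, h₂) := by
  rw [Fintype.sum_prod_type]
  exact Finset.sum_congr rfl fun _ _ => Fintype.sum_prod_type _

lemma sum_weight_middle (O : ℕ → Op (Fin n)) : ∑ h₁, ∑ s, weight (A.middle O h₁ s) =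
    ∑ h₁, weight (evolve A.phase₁ O h₁ (basisKet fun _ => false)) :=
  Finset.sum_congr rfl fun _ _ => sum_weight_projectOn _ _

lemma sum_weight_middle_eq_one {O : ℕ → Op (Fin n)}
    (hO : ∀ k, O k ∈ Matrix.unitaryGroup (Fin n → Bool) ℂ) :
    ∑ h₁, ∑ s, weight (A.middle O h₁ s) = 1 := by
  rw [sum_weight_middle, sum_weight_evolve _ hO, weight_basisKet]

lemma sum_weight_final {O : A.Ix → Op (Fin n)}
    (hO : ∀ i, O i ∈ Matrix.unitaryGroup (Fin n → Bool) ℂ) : ∑ h, weight (A.final O h) = 1 := by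
  have h1 := extendOps_mem (O := O ∘ Sum.inl) fun k => hO (Sum.inl k)
  have h2 := extendOps_mem (O := O ∘ Sum.inr) fun k => hO (Sum.inr k)
  simp only [sum_path, final]
  rw [← A.sum_weight_middle_eq_one h1]
  exact Finset.sum_congr rfl fun _ _ => Finset.sum_congr rfl fun _ _ => sum_weight_evolve _ h2 _

lemma sum_weight_final_one {O : A.Ix → Op (Fin n)}
    (hO : ∀ i, O i ∈ Matrix.unitaryGroup (Fin n → Bool) ℂ) (k : A.Ix) {V : Op (Fin n)}
    (hV : V ∈ Matrix.unitaryGroup (Fin n → Bool) ℂ) (y : Fin n → Bool) :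
    ∑ w, ∑ h, weight (A.final (Function.update O k (rowOp V y w)) h) = 1 := by
  have h1 := extendOps_mem (O := O ∘ Sum.inl) fun k => hO (Sum.inl k)
  have h2 := extendOps_mem (O := O ∘ Sum.inr) fun k => hO (Sum.inr k)
  rcases k with k | k
  · simp only [final_update_inl, sum_path]
    rw [← weight_basisKet (ι := A.Wire) fun _ => false,
      ← sum_weight_evolve_one A.phase₁ h1 _ _ k.2 hV y]
    refine Finset.sum_congr rfl fun w _ => ?_
    rw [← sum_weight_middle]
    exact Finset.sum_congr rfl fun _ _ => Finset.sum_congr rfl fun _ _ => sum_weight_evolve _ h2 _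
  · simp only [final_update_inr, sum_path]
    rw [← A.sum_weight_middle_eq_one h1, Finset.sum_comm]
    refine Finset.sum_congr rfl fun h₁ _ => ?_
    rw [Finset.sum_comm]
    exact Finset.sum_congr rfl fun s _ => sum_weight_evolve_one A.phase₂ h2 _ _ k.2 hV y

/-- Two queries in the same phase are covered by `sum_weight_evolve_two`. For queries in different
phases the one-query statement is applied in each phase, the measurement of the description in
between conserving the weight. -/
lemma sum_weight_final_two {O : A.Ix → Op (Fin n)}
    (hO : ∀ i, O i ∈ Matrix.unitaryGroup (Fin n → Bool) ℂ) (i k : A.Ix) (hik : k ≠ i)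
    {V W : Op (Fin n)} (hV : V ∈ Matrix.unitaryGroup (Fin n → Bool) ℂ)
    (hW : W ∈ Matrix.unitaryGroup (Fin n → Bool) ℂ) (x y : Fin n → Bool) :
    ∑ w', ∑ w, ∑ h, weight (A.final (Function.update (Function.update O i (rowOp V x w')) k
      (rowOp W y w)) h) = 1 := by
  have h1 := extendOps_mem (O := O ∘ Sum.inl) fun k => hO (Sum.inl k)
  have h2 := extendOps_mem (O := O ∘ Sum.inr) fun k => hO (Sum.inr k)
  have mixed : ∀ (k₁ : Fin (numQueries A.phase₁)) (k₂ : Fin (numQueries A.phase₂))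
      {V W : Op (Fin n)} (_ : V ∈ Matrix.unitaryGroup (Fin n → Bool) ℂ)
      (_ : W ∈ Matrix.unitaryGroup (Fin n → Bool) ℂ) (x y : Fin n → Bool),
      ∑ w', ∑ w, ∑ h, weight (A.final (Function.update (Function.update O (Sum.inl k₁)
        (rowOp V x w')) (Sum.inr k₂) (rowOp W y w)) h) = 1 := by
    intro k₁ k₂ V W hV hW x y
    rw [← weight_basisKet (ι := A.Wire) fun _ => false,
      ← sum_weight_evolve_one A.phase₁ h1 _ _ k₁.2 hV x]
    refine Finset.sum_congr rfl fun w' _ => ?_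
    simp only [final_update_inr, sum_path, Sum.update_inl_comp_inl, Sum.update_inl_comp_inr,
      extendOps_update]
    rw [← sum_weight_middle, Finset.sum_comm]
    refine Finset.sum_congr rfl fun h₁ _ => ?_
    rw [Finset.sum_comm]
    exact Finset.sum_congr rfl fun s _ => sum_weight_evolve_one A.phase₂ h2 _ _ k₂.2 hW y
  rcases i with i | i <;> rcases k with k | k
  · have hne : (i : ℕ) ≠ k := fun e => hik (congrArg Sum.inl (Fin.ext e.symm))
    simp only [final_update_inl, sum_path, Sum.update_inl_comp_inl, Sum.update_inl_comp_inr,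
      extendOps_update]
    rw [← weight_basisKet (ι := A.Wire) fun _ => false,
      ← sum_weight_evolve_two A.phase₁ h1 _ _ _ i.2 k.2 hne hV hW x y]
    refine Finset.sum_congr rfl fun w' _ => Finset.sum_congr rfl fun w _ => ?_
    rw [← sum_weight_middle]
    exact Finset.sum_congr rfl fun _ _ => Finset.sum_congr rfl fun _ _ => sum_weight_evolve _ h2 _
  · exact mixed i k hV hW x y
  -- Updates at different queries commute, so this is the mixed case with the roles exchanged.
  · rw [Finset.sum_comm]
    simp only [Function.update_comm hik.symm]
    exact mixed k i hW hV y x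
  · have hne : (i : ℕ) ≠ k := fun e => hik (congrArg Sum.inr (Fin.ext e.symm))
    simp only [final_update_inr, sum_path, Sum.update_inr_comp_inl, Sum.update_inr_comp_inr,
      extendOps_update]
    rw [← A.sum_weight_middle_eq_one h1]
    refine (Finset.sum_congr rfl fun w' _ => Finset.sum_comm).trans ?_
    rw [Finset.sum_comm]
    refine Finset.sum_congr rfl fun h₁ _ => ?_
    refine (Finset.sum_congr rfl fun w' _ => Finset.sum_comm).trans ?_
    rw [Finset.sum_comm]
    exact Finset.sum_congr rfl fun s _ =>
      sum_weight_evolve_two A.phase₂ h2 _ _ _ i.2 k.2 hne hV hW x y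

/-- The output wires of the preparation circuit. -/
def refWires : Fin n ↪ (Fin A.descLen ⊕ Fin n) ⊕ A.Anc :=
  Function.Embedding.inr.trans Function.Embedding.inl

/-- The final state of the preparation circuit. -/
def prepared (s : Fin A.descLen → Bool) : Ket ((Fin A.descLen ⊕ Fin n) ⊕ A.Anc) :=
  applyGates A.prep (basisKet (A.prepLabel s fun _ => false))

/-- The unnormalised state of the output wires of the preparation circuit when the other wires are
found in the state `g`. -/
def chal (s : Fin A.descLen → Bool) (g : Rest A.refWires) : Ket (Fin n) :=
  fun x => A.prepared s (join A.refWires x g)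

/-- The preparation circuit is unitary. This holds for every `s`, including those which do not
describe a pure challenge; the overlap test cannot exclude them and sums over all `g`. -/
lemma sum_weight_chal (s : Fin A.descLen → Bool) : ∑ g, weight (A.chal s g) = 1 := by
  rw [← weight_basisKet (A.prepLabel s fun _ => false), ← weight_applyGates A.prep,
    weight_join A.refWires]
  rfl

lemma challenge_eq_chal (s : Fin A.descLen → Bool) :
    A.challenge s = A.chal s (split A.refWires (A.prepLabel s fun _ => false)).2 := by
  funext x
  rw [chal, ← extend_eq_join]
  refine congrArg (A.prepared s) ?_
  funext i
  rcases i with (i | i) | i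
  · exact (Function.extend_apply' _ _ _ (by simp [refWires])).symm
  · exact (A.refWires.injective.extend_apply _ _ i).symm
  · exact (Function.extend_apply' _ _ _ (by simp [refWires])).symm

/-- The total weight of the part of the tag which overlaps with the answer to the challenge without
being handed through from a query. -/
def leakage (M : Op (Fin n)) : ℝ :=
  ∑ h : A.Path, ∑ g, ∑ r, ‖residual (A.amp h · r) (A.chal h.2.1 g) M‖ ^ 2

end Adversary

end QUnf

end

noncomputable section
namespace QUnf

open Matrix MeasureTheory
open scoped ComplexConjugate

set_option linter.unusedSectionVars false

/-! ### The winning probability is bounded by the leakage. -/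

namespace Adversary

variable {n : ℕ} (A : Adversary n)

lemma final_const (U : Op (Fin n)) (h : A.Path) : A.final (fun _ => U) h =
    evolve A.phase₂ (fun _ => U) h.2.2 (A.middle (fun _ => U) h.1 h.2.1) := by
  have e : ∀ q k, k < q → extendOps (fun _ : Fin q => U) k = U := fun q k hk => by
    simp [extendOps, hk]
  rw [final, middle, middle]
  refine (evolve_congr _ _ _ _ _ fun k hk => e _ k hk).trans ?_
  rw [evolve_congr A.phase₁ (extendOps ((fun _ : A.Ix => U) ∘ Sum.inl)) (fun _ => U) _ _
    fun k hk => e _ k hk]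

lemma final_update_const_inl (U : Op (Fin n)) (h : A.Path) (k : Fin (numQueries A.phase₁))
    (M : Op (Fin n)) : A.final (Function.update (fun _ => U) (Sum.inl k) M) h =
      evolve A.phase₂ (fun _ => U) h.2.2
        (A.middle (Function.update (fun _ => U) k M) h.1 h.2.1) := by
  have e : ∀ q k, k < q → extendOps (fun _ : Fin q => U) k = U := fun q k hk => by
    simp [extendOps, hk]
  rw [final_update_inl, middle, middle]
  refine (evolve_congr _ _ _ _ _ fun k hk => e _ k hk).trans ?_
  rw [evolve_congr A.phase₁]
  intro j hj
  rw [Function.update_apply, Function.update_apply]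
  split_ifs
  · rfl
  · exact e _ j hj

lemma final_update_const_inr (U : Op (Fin n)) (h : A.Path) (k : Fin (numQueries A.phase₂))
    (M : Op (Fin n)) : A.final (Function.update (fun _ => U) (Sum.inr k) M) h =
      evolve A.phase₂ (Function.update (fun _ => U) k M) h.2.2
        (A.middle (fun _ => U) h.1 h.2.1) := by
  have e : ∀ q k, k < q → extendOps (fun _ : Fin q => U) k = U := fun q k hk => by
    simp [extendOps, hk]
  rw [final_update_inr, middle, middle, evolve_congr A.phase₁
    (extendOps ((fun _ : A.Ix => U) ∘ Sum.inl)) (fun _ => U) _ _ fun k hk => e _ k hk]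
  refine evolve_congr _ _ _ _ _ fun j hj => ?_
  rw [Function.update_apply, Function.update_apply]
  split_ifs
  · rfl
  · exact e _ j hj

/-- On a path on which the challenge is orthogonal to all queries, the overlap of the tag with the
answer is not handed through from the queries. -/
lemma contract_eq_residual (U : Op (Fin n)) (h : A.Path) {ψ : Ket (Fin n)} (hψ : weight ψ = 1)
    (h1 : ∀ ρ ∈ queryStates U A.phase₁ h.1 (basisKet fun _ => false),
      fidelity (pureState ψ) ρ ≤ 0)
    (h2 : ∀ ρ ∈ queryStates U A.phase₂ h.2.2 (A.middle (fun _ => U) h.1 h.2.1),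
      fidelity (pureState ψ) ρ ≤ 0) (r : Rest A.tag) :
    contract A.tag (U *ᵥ ψ) (A.final (fun _ => U) h) r = residual (A.amp h · r) ψ U := by
  -- Every term of the correction contains ⟨ψ| acting on a query register orthogonal to ψ.
  have hz : ∀ z k, A.amp h z r (Function.update (fun _ => U) k (ketBra z ψ)) = 0 := by
    intro z k
    rw [amp_apply]
    rcases k with k | k
    · rw [final_update_const_inl, middle,
        evolve_update_ketBra_eq_zero hψ U _ _ _ h1 z k k.2]
      have : projectOn A.desc h.2.1 (0 : Ket A.Wire) = 0 := by
        funext x; simp [projectOn]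
      rw [this, evolve_zero]; rfl
    · rw [final_update_const_inr, evolve_update_ketBra_eq_zero hψ U _ _ _ h2 z k k.2]; rfl
  simp only [residual, hz, Finset.sum_const_zero, mul_zero, sub_zero]
  rfl

/-- On admissible paths the overlap of the tag with the answer is the residual. On the others the
winning contribution is 0, and the residuals are added as nonnegative terms, so that the condition
of the game disappears from the bound. -/
lemma winProb_le (T : QuantumTest n) (hn : 0 < n) (κ₁ κ₂ : ℕ) (U : QUnitary n) :
    A.winProb 1 T κ₁ κ₂ U ≤ T.f κ₁ κ₂ 0 + κ₁ * A.leakage U.1 := by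
  classical
  have hf := (T.f_zero_eq hn κ₁ κ₂).1
  have hU : ∀ _ : A.Ix, U.1 ∈ Matrix.unitaryGroup (Fin n → Bool) ℂ := fun _ => U.2
  have hsum := A.sum_weight_final hU
  have key : ∀ h : A.Path, (if A.ChallengeOK 1 h.2.1 ⟨A.final (fun _ => U.1) h,
        queryStates U.1 A.phase₁ h.1 (basisKet fun _ => false) ++
          queryStates U.1 A.phase₂ h.2.2 (A.middle (fun _ => U.1) h.1 h.2.1)⟩ then
        weight (A.final (fun _ => U.1) h) * T.acceptProb κ₁ κ₂
          (reducedState A.tag (A.final (fun _ => U.1) h))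
          (pureState (U.1 *ᵥ A.challenge h.2.1)) else 0) ≤
      weight (A.final (fun _ => U.1) h) * T.f κ₁ κ₂ 0 +
        κ₁ * ∑ g, ∑ r, ‖residual (A.amp h · r) (A.chal h.2.1 g) U.1‖ ^ 2 := by
    intro h
    have hnn : 0 ≤ weight (A.final (fun _ => U.1) h) * T.f κ₁ κ₂ 0 :=
      mul_nonneg (weight_nonneg _) hf
    have hnn' : ∀ g, 0 ≤ ∑ r, ‖residual (A.amp h · r) (A.chal h.2.1 g) U.1‖ ^ 2 := fun g =>
      Finset.sum_nonneg fun _ _ => sq_nonneg _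
    split_ifs with hok
    · obtain ⟨hw, hd⟩ := hok
      have hv : weight (U.1 *ᵥ A.challenge h.2.1) = 1 := (weight_mulVec U.2 _).trans hw
      refine (T.weight_mul_acceptProb_le hn κ₁ κ₂ A.tag hv _).trans ?_
      have hd' : ∀ ρ ∈ _, fidelity (pureState (A.challenge h.2.1)) ρ ≤ 0 := fun ρ hρ =>
        (hd ρ hρ).2.trans (sub_self _).le
      have hc := A.contract_eq_residual U.1 h hw
        (fun ρ hρ => hd' ρ (List.mem_append_left _ hρ))
        (fun ρ hρ => hd' ρ (List.mem_append_right _ hρ))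
      simp only [hc]
      gcongr
      -- A valid challenge is the component `chal s g` at one particular `g`; the other components
      -- only enlarge the sum.
      rw [challenge_eq_chal]
      exact Finset.single_le_sum (f := fun g => ∑ r, ‖residual (A.amp h · r)
        (A.chal h.2.1 g) U.1‖ ^ 2) (fun g _ => hnn' g) (Finset.mem_univ _)
    · exact add_nonneg hnn (mul_nonneg (Nat.cast_nonneg _) (Finset.sum_nonneg fun g _ => hnn' g))
  have hwin : A.winProb 1 T κ₁ κ₂ U = ∑ h : A.Path, if A.ChallengeOK 1 h.2.1
        ⟨A.final (fun _ => U.1) h, queryStates U.1 A.phase₁ h.1 (basisKet fun _ => false) ++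
          queryStates U.1 A.phase₂ h.2.2 (A.middle (fun _ => U.1) h.1 h.2.1)⟩ then
        weight (A.final (fun _ => U.1) h) * T.acceptProb κ₁ κ₂
          (reducedState A.tag (A.final (fun _ => U.1) h))
          (pureState (U.1 *ᵥ A.challenge h.2.1)) else 0 := by
    rw [winProb, sum_map_run, sum_path]
    refine Finset.sum_congr rfl fun h₁ _ => Finset.sum_congr rfl fun s _ => ?_
    rw [sum_map_run]
    refine Finset.sum_congr rfl fun h₂ _ => ?_
    simp only [final_const]
    congr
  rw [hwin]
  refine (Finset.sum_le_sum fun h _ => key h).trans (le_of_eq ?_)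
  rw [Finset.sum_add_distrib, ← Finset.sum_mul, ← Finset.mul_sum, hsum, one_mul, leakage]

end Adversary

/-! ### Homogeneity of the residual and reduction to unit vectors. -/

section Averages

variable {n : ℕ} {I : Type} [Fintype I] [DecidableEq I]

lemma ketBra_smul (z : Fin n → Bool) (c : ℂ) (ψ : Ket (Fin n)) :
    ketBra z (c • ψ) = conj c • ketBra z ψ := by
  ext a b; by_cases h : a = z <;> simp [ketBra, h]

lemma residual_smul (X : (Fin n → Bool) → MultilinearMap ℂ (fun _ : I => Op (Fin n)) ℂ) (c : ℂ)
    (ψ : Ket (Fin n)) (M : Op (Fin n)) : residual X (c • ψ) M = conj c * residual X ψ M := by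
  simp only [residual, mulVec_smul, Pi.smul_apply, smul_eq_mul, map_mul, ketBra_smul,
    MultilinearMap.map_update_smul, mul_sub, Finset.mul_sum]
  congr 1
  · exact Finset.sum_congr rfl fun z _ => by ring
  · exact Finset.sum_congr rfl fun z _ => Finset.sum_congr rfl fun k _ => by ring

lemma continuous_residual (X : (Fin n → Bool) → MultilinearMap ℂ (fun _ : I => Op (Fin n)) ℂ)
    (ψ : Ket (Fin n)) : Continuous fun U : QUnitary n => residual X ψ U.1 := by
  have h1 : ∀ z, Continuous fun U : QUnitary n => X z fun _ => U.1 := fun z =>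
    (continuous_multilinear (X z)).comp (continuous_pi fun _ => continuous_subtype_val)
  have h2 : ∀ z k, Continuous fun U : QUnitary n =>
      X z (Function.update (fun _ => U.1) k (ketBra z ψ)) := fun z k =>
    (continuous_multilinear (X z)).comp
      ((continuous_pi fun _ => continuous_subtype_val).update k continuous_const)
  have h3 : Continuous fun U : QUnitary n => U.1 *ᵥ ψ :=
    continuous_subtype_val.matrix_mulVec continuous_const
  unfold residual
  refine (continuous_finsetSum _ fun z _ => ?_).sub
    (continuous_const.mul (continuous_finsetSum _ fun z _ => continuous_finsetSum _ fun k _ =>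
      h2 z k))
  exact (Complex.continuous_conj.comp ((continuous_apply z).comp h3)).mul (h1 z)

/-- A nonnegative quadratic functional takes, on some unit vector, a value at least as large as its
sum over a family of total weight one. -/
lemma exists_unit_le {G : Type*} [Fintype G] (Q : Ket (Fin n) → ℝ)
    (hQ : ∀ (c : ℂ) ψ, Q (c • ψ) = ‖c‖ ^ 2 * Q ψ) (ψ : G → Ket (Fin n))
    (hψ : ∑ g, weight (ψ g) = 1) : ∃ φ, weight φ = 1 ∧ ∑ g, Q (ψ g) ≤ Q φ := by
  by_contra! hcon
  set S := ∑ g, Q (ψ g) with hS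
  -- If `Q` were below S at every unit vector, homogeneity would scale this to each nonzero ψ g;
  -- summation against the total weight one would give S < S.
  have hlt : ∀ g, weight (ψ g) ≠ 0 → Q (ψ g) < weight (ψ g) * S := by
    intro g hg
    have hpos : 0 < weight (ψ g) := (weight_nonneg _).lt_of_ne' hg
    set c : ℝ := √(weight (ψ g)) with hc
    have hc0 : 0 < c := Real.sqrt_pos.2 hpos
    have hc2 : c ^ 2 = weight (ψ g) := Real.sq_sqrt hpos.le
    have hn : ‖((c⁻¹ : ℝ) : ℂ)‖ ^ 2 = (weight (ψ g))⁻¹ := by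
      rw [Complex.norm_real, Real.norm_of_nonneg (inv_nonneg.2 hc0.le), inv_pow, hc2]
    have h := hcon (((c⁻¹ : ℝ) : ℂ) • ψ g) (by rw [weight_smul, hn, inv_mul_cancel₀ hg])
    rw [hQ, hn, inv_mul_lt_iff₀ hpos] at h
    exact h
  have hle : ∀ g, Q (ψ g) ≤ weight (ψ g) * S := by
    intro g
    by_cases hg : weight (ψ g) = 0
    · rw [hg, weight_eq_zero.1 hg, zero_mul]
      have := hQ 0 0
      simp at this
      exact this.le
    · exact (hlt g hg).le
  obtain ⟨g, hg⟩ : ∃ g, weight (ψ g) ≠ 0 := by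
    by_contra! h0
    simp [h0] at hψ
  have : S < S := by
    calc S < ∑ g, weight (ψ g) * S :=
          Finset.sum_lt_sum (fun g _ => hle g) ⟨g, Finset.mem_univ _, hlt g hg⟩
      _ = S := by rw [← Finset.sum_mul, hψ, one_mul]
  exact lt_irrefl _ this

end Averages

/-! ### The Haar average of the leakage. -/

namespace Adversary

variable {n : ℕ} (A : Adversary n)

/-- For a Haar random unitary, a tag has hardly any overlap with the answer to the challenge which
is not handed through from the queries. -/
theorem integral_leakage_le : ∫ U : QUnitary n, A.leakage U.1 ∂haarUnitary n ≤
    (2 ^ n)⁻¹ + (Fintype.card A.Ix + (Fintype.card A.Ix : ℝ) ^ 2) / √(2 ^ n) := by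
  have hi : ∀ (h : A.Path) ψ, Integrable (fun U : QUnitary n =>
      ∑ r, ‖residual (A.amp h · r) ψ U.1‖ ^ 2) (haarUnitary n) := fun h ψ =>
    integrable_haar (continuous_finsetSum _ fun _ _ => (continuous_residual _ _).norm.pow 2)
  -- The components `chal s g` are not normalised. For each path the sum over `g` of the averaged
  -- residuals is dominated by its value at one unit vector, chosen independently of U; the integral
  -- estimate allows such a choice for each path.
  have hex : ∀ h : A.Path, ∃ φ : Ket (Fin n), weight φ = 1 ∧
      ∑ g, ∫ U : QUnitary n, ∑ r, ‖residual (A.amp h · r) (A.chal h.2.1 g) U.1‖ ^ 2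
        ∂haarUnitary n ≤
      ∫ U : QUnitary n, ∑ r, ‖residual (A.amp h · r) φ U.1‖ ^ 2 ∂haarUnitary n := by
    intro h
    refine exists_unit_le (fun φ => ∫ U : QUnitary n, ∑ r, ‖residual (A.amp h · r) φ U.1‖ ^ 2
      ∂haarUnitary n) (fun c ψ => ?_) (A.chal h.2.1) (A.sum_weight_chal _)
    simp only [residual_smul, norm_mul, RCLike.norm_conj, mul_pow, ← Finset.mul_sum]
    exact integral_const_mul _ _
  choose φ hφ hle using hex
  have hU : ∀ (U : QUnitary n) (_ : A.Ix), U.1 ∈ Matrix.unitaryGroup (Fin n → Bool) ℂ :=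
    fun U _ => U.2
  refine le_trans ?_ (integral_residual_le (X := A.amp) ?_ ?_ ?_ hφ)
  · unfold leakage
    rw [integral_finsetSum _ fun h _ => integrable_finsetSum _ fun g _ => hi h _,
      integral_finsetSum _ fun h _ => hi h _]
    refine Finset.sum_le_sum fun h _ => ?_
    rw [integral_finsetSum _ fun g _ => hi h _]
    exact hle h
  · intro U
    simp only [sum_norm_amp]
    exact (A.sum_weight_final (hU U)).le
  · intro U k y
    simp only [sum_norm_amp]
    exact (A.sum_weight_final_one (hU U) k U.2 y).le
  · intro U i k hik x y
    refine le_of_eq (Eq.trans ?_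
      (A.sum_weight_final_two (hU U) i k hik (one_mem _) U.2 x y))
    refine Finset.sum_congr rfl fun w' _ => ?_
    have : ∀ h w, ∑ r, ∑ z, ‖A.amp h z r (Function.update (Function.update (fun _ => U.1) i
        (rowOp 1 x w')) k (rowOp U.1 y w))‖ ^ 2 = weight (A.final (Function.update
          (Function.update (fun _ => U.1) i (rowOp 1 x w')) k (rowOp U.1 y w)) h) :=
      fun h w => sum_norm_amp _ _ _
    simp only [← this]
    exact (Finset.sum_congr rfl fun h _ => Finset.sum_comm).trans Finset.sum_comm

end Adversary

end QUnf

end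

noncomputable section
namespace QUnf

open Matrix
open scoped ComplexConjugate

set_option linter.unusedSectionVars false

/-! ### Circuits on a part of a larger register. -/

section Embedding

variable {n : ℕ} {ι κ : Type} [Fintype ι] [DecidableEq ι] [Fintype κ] [DecidableEq κ]

lemma extend_trans {k : ℕ} (e : Fin k ↪ ι) (j : ι ↪ κ) (y : Fin k → Bool) (x : κ → Bool) :
    Function.extend (e.trans j) y x = Function.extend j (Function.extend e y (x ∘ j)) x := by
  funext w
  by_cases hw : ∃ i, j i = w
  · obtain ⟨i, rfl⟩ := hw
    rw [j.injective.extend_apply]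
    by_cases hi : ∃ a, e a = i
    · obtain ⟨a, rfl⟩ := hi
      rw [e.injective.extend_apply]
      exact (e.trans j).injective.extend_apply _ _ a
    · rw [Function.extend_apply' _ _ _ hi, Function.extend_apply']
      · rfl
      · rintro ⟨a, ha⟩
        exact hi ⟨a, j.injective ha⟩
  · rw [Function.extend_apply' _ _ _ hw, Function.extend_apply']
    rintro ⟨a, ha⟩
    exact hw ⟨_, ha⟩

lemma applyOn_trans {k : ℕ} (e : Fin k ↪ ι) (j : ι ↪ κ) (V : Op (Fin k)) (φ : Ket κ)
    (x : κ → Bool) : applyOn (e.trans j) V φ x =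
      applyOn e V (fun u => φ (Function.extend j u x)) (x ∘ j) := by
  simp only [applyOn, extend_trans]
  rfl

/-- A gate acting on the wires of a larger register. -/
def Gate.map (j : ι ↪ κ) (g : Gate ι) : Gate κ :=
  { g with wires := g.wires.trans j }

/-- An instruction acting on the wires of a larger register. -/
def Instr.map (j : ι ↪ κ) : Instr n ι → Instr n κ
  | .gate g => .gate (g.map j)
  | .query e => .query (e.trans j)
  | .measure i => .measure (j i)

end Embedding

/-! ### Classical reversible gates and the Hadamard gate. -/

section ClassicalGates

variable {ι : Type} [Fintype ι] [DecidableEq ι]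

/-- A gate which permutes the computational basis. -/
def permGate {m : ℕ} (hm : m ≤ 3) (f : Fin m ↪ ι) (σ : Equiv.Perm (Fin m → Bool)) : Gate ι where
  arity := m
  arity_le := hm
  wires := f
  mat := ⟨Matrix.of fun a b => if σ a = b then 1 else 0, by
    rw [Matrix.mem_unitaryGroup_iff]
    ext a b
    simp [Matrix.mul_apply, Matrix.one_apply, σ.injective.eq_iff, eq_comm]⟩

/-- The gate pulls amplitudes back along σ, so on basis states it acts as the inverse of σ. All
permutations used below are involutions. -/
lemma permGate_apply {m : ℕ} (hm : m ≤ 3) (f : Fin m ↪ ι) (σ : Equiv.Perm (Fin m → Bool))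
    (φ : Ket ι) (x x' : ι → Bool) (h1 : ∀ a, x' (f a) = σ (x ∘ f) a)
    (h2 : ∀ i, (∀ a, f a ≠ i) → x' i = x i) : (permGate hm f σ).apply φ x = φ x' := by
  have h : Function.extend f (σ (x ∘ f)) x = x' := by
    funext i
    by_cases hi : ∃ a, f a = i
    · obtain ⟨a, rfl⟩ := hi
      rw [f.injective.extend_apply, h1]
    · rw [Function.extend_apply' _ _ _ hi, h2 i fun a ha => hi ⟨a, ha⟩]
  change ∑ y, (if σ (x ∘ f) = y then (1 : ℂ) else 0) * φ (Function.extend f y x) = _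
  simp [h]

/-- The gate which flips the wire `v` if `b` holds. -/
def flipGate (b : Bool) (v : ι) : Gate ι :=
  permGate (m := 1) (by norm_num) ⟨fun _ => v, fun _ _ _ => Subsingleton.elim _ _⟩
    (Function.Involutive.toPerm (fun a i => a i ^^ b) fun a => by funext i; simp)

lemma flipGate_apply (b : Bool) (v : ι) (φ : Ket ι) (x : ι → Bool) :
    (flipGate b v).apply φ x = φ (Function.update x v (x v ^^ b)) := by
  refine permGate_apply _ _ _ _ _ _ (fun _ => Function.update_self ..) fun i hi => ?_
  exact Function.update_of_ne (hi 0).symm _ _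

/-- The controlled not gate. -/
def cnotGate (u v : ι) (h : u ≠ v) : Gate ι :=
  permGate (m := 2) (by norm_num) ⟨![u, v], fun i j hij => by
      fin_cases i <;> fin_cases j <;> simp_all [eq_comm]⟩
    (Function.Involutive.toPerm (fun a => ![a 0, a 1 ^^ a 0]) fun a => by
      funext i; fin_cases i <;> simp)

lemma cnotGate_apply (u v : ι) (h : u ≠ v) (φ : Ket ι) (x : ι → Bool) :
    (cnotGate u v h).apply φ x = φ (Function.update x v (x v ^^ x u)) := by
  refine permGate_apply _ _ _ _ _ _ (fun a => ?_) fun i hi => ?_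
  · fin_cases a
    · exact Function.update_of_ne h _ _
    · exact Function.update_self ..
  · exact Function.update_of_ne (hi 1).symm _ _

/-- The gate which exchanges `u` and `v` if the wire `c` has the value `b`. -/
def cswapGate (c : ι) (b : Bool) (u v : ι) (hu : c ≠ u) (hv : c ≠ v) (h : u ≠ v) : Gate ι :=
  permGate (m := 3) le_rfl ⟨![c, u, v], fun i j hij => by
      fin_cases i <;> fin_cases j <;> simp_all [eq_comm]⟩
    (Function.Involutive.toPerm (fun a => if a 0 = b then ![a 0, a 2, a 1] else a) fun a => by
      by_cases ha : a 0 = b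
      · funext i; fin_cases i <;> simp [ha]
      · simp [ha])

lemma cswapGate_apply (c : ι) (b : Bool) (u v : ι) (hu : c ≠ u) (hv : c ≠ v) (h : u ≠ v)
    (φ : Ket ι) (x : ι → Bool) : (cswapGate c b u v hu hv h).apply φ x =
      φ (if x c = b then x ∘ Equiv.swap u v else x) := by
  refine permGate_apply _ _ _ _ _ _ (fun a => ?_) fun i hi => ?_
  · change _ = (if x c = b then ![x c, x v, x u] else x ∘ ![c, u, v]) a
    split_ifs
    · fin_cases a
      · exact congrArg x (Equiv.swap_apply_of_ne_of_ne hu hv)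
      · exact congrArg x (Equiv.swap_apply_left u v)
      · exact congrArg x (Equiv.swap_apply_right u v)
    · rfl
  · split_ifs
    · exact congrArg x (Equiv.swap_apply_of_ne_of_ne (hi 1).symm (hi 2).symm)
    · rfl

end ClassicalGates

section Hadamard

variable {ι : Type} [Fintype ι] [DecidableEq ι]

lemma sum_fin_one {M : Type*} [AddCommMonoid M] (F : (Fin 1 → Bool) → M) :
    ∑ y, F y = F (fun _ => false) + F fun _ => true := by
  rw [← (Equiv.funUnique (Fin 1) Bool).symm.sum_comp, Fintype.sum_bool, add_comm]
  rfl

lemma inv_sqrt_two_mul_self : ((√2 : ℝ) : ℂ)⁻¹ * ((√2 : ℝ) : ℂ)⁻¹ = 1 / 2 := by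
  rw [← mul_inv, ← Complex.ofReal_mul, Real.mul_self_sqrt (by norm_num)]
  norm_num

/-- The Hadamard gate. -/
def hadamardGate (v : ι) : Gate ι where
  arity := 1
  arity_le := by norm_num
  wires := ⟨fun _ => v, fun _ _ _ => Subsingleton.elim _ _⟩
  mat := ⟨Matrix.of fun a b => ((√2 : ℝ) : ℂ)⁻¹ * if a 0 && b 0 then -1 else 1, by
    rw [Matrix.mem_unitaryGroup_iff]
    ext a b
    rw [Matrix.mul_apply, sum_fin_one]
    simp only [star_apply, Matrix.of_apply, star_mul', star_inv₀, RCLike.star_def, Complex.conj_ofReal]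
    have hab : a = b ↔ a 0 = b 0 := ⟨fun h => h ▸ rfl, fun h => funext fun i => by
      rw [Subsingleton.elim i 0, h]⟩
    have h2 := inv_sqrt_two_mul_self
    rw [Matrix.one_apply]
    simp only [hab]
    cases a 0 <;> cases b 0 <;> simp <;> linear_combination 2 * h2⟩

lemma hadamardGate_apply (v : ι) (φ : Ket ι) (x : ι → Bool) : (hadamardGate v).apply φ x =
    ((√2 : ℝ) : ℂ)⁻¹ * (φ (Function.update x v false) +
      (if x v then -1 else 1) * φ (Function.update x v true)) := by
  have h : ∀ y : Fin 1 → Bool, Function.extend (fun _ : Fin 1 => v) y x =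
      Function.update x v (y 0) := by
    intro y
    funext i
    by_cases h : i = v
    · subst h
      rw [Function.update_self]
      exact Function.Injective.extend_apply (f := fun _ : Fin 1 => i)
        (fun _ _ _ => Subsingleton.elim _ _) _ _ 0
    · rw [Function.update_of_ne h]
      exact Function.extend_apply' _ _ _ (by rintro ⟨a, ha⟩; exact h ha.symm)
  change ∑ y : Fin 1 → Bool, (((√2 : ℝ) : ℂ)⁻¹ * if x v && y 0 then -1 else 1) *
    φ (Function.extend (fun _ : Fin 1 => v) y x) = _
  rw [sum_fin_one, h, h]
  cases x v <;> simp <;> ring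

end Hadamard

/-! ### The Hadamard test with intermediate measurements. -/

section HadamardTest

variable {n : ℕ} {R : Type} [Fintype R] [DecidableEq R]

/-- An instruction of a circuit which depends on a control qubit: an instruction executed in any
case, or an exchange of two wires if the control qubit has the value `b`. -/
inductive PInstr (n : ℕ) (R : Type) where
  | both (i : Instr n R)
  | ctrl (b : Bool) (u v : R) (h : u ≠ v)

/-- The ket with two wires exchanged. -/
def swapKet (u v : R) (χ : Ket R) : Ket R := fun x => χ (x ∘ Equiv.swap u v)

/-- The sum over all measurement outcomes of `F` applied to the final states for the two values of
the control qubit. -/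
def psum (U : Op (Fin n)) : List (PInstr n R) → (Ket R → Ket R → ℝ) → Ket R → Ket R → ℝ
  | [], F, a, b => F a b
  | .both (.gate g) :: L, F, a, b => psum U L F (g.apply a) (g.apply b)
  | .both (.query e) :: L, F, a, b => psum U L F (applyOn e U a) (applyOn e U b)
  | .both (.measure i) :: L, F, a, b =>
      psum U L F (projWire i false a) (projWire i false b) +
        psum U L F (projWire i true a) (projWire i true b)
  | .ctrl c u v _ :: L, F, a, b =>
      psum U L F (if c then a else swapKet u v a) (if c then swapKet u v b else b)

lemma psum_append (U : Op (Fin n)) (L L' : List (PInstr n R)) (F : Ket R → Ket R → ℝ)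
    (a b : Ket R) : psum U (L ++ L') F a b = psum U L (psum U L' F) a b := by
  induction L generalizing a b with
  | nil => rfl
  | cons i L ih =>
    rcases i with ((g | e | i) | _) <;> simp only [List.cons_append, psum, ih]

lemma psum_add (U : Op (Fin n)) (L : List (PInstr n R)) (F G : Ket R → Ket R → ℝ) (a b : Ket R) :
    psum U L (fun a b => F a b + G a b) a b = psum U L F a b + psum U L G a b := by
  induction L generalizing a b with
  | nil => rfl
  | cons i L ih =>
    rcases i with ((g | e | i) | _) <;> simp only [psum, ih]
    ring

lemma psum_const_mul (U : Op (Fin n)) (L : List (PInstr n R)) (F : Ket R → Ket R → ℝ) (t : ℝ)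
    (a b : Ket R) : psum U L (fun a b => t * F a b) a b = t * psum U L F a b := by
  induction L generalizing a b with
  | nil => rfl
  | cons i L ih =>
    rcases i with ((g | e | i) | _) <;> simp only [psum, ih]
    ring

lemma swapKet_smul (u v : R) (c : ℂ) (χ : Ket R) : swapKet u v (c • χ) = c • swapKet u v χ := rfl

lemma weight_swapKet (u v : R) (χ : Ket R) : weight (swapKet u v χ) = weight χ :=
  (Equiv.arrowCongr (Equiv.swap u v) (Equiv.refl Bool)).sum_comp fun x => ‖χ x‖ ^ 2

lemma psum_smul (U : Op (Fin n)) (L : List (PInstr n R)) (F : Ket R → Ket R → ℝ) (c : ℂ)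
    (a b : Ket R) :
    psum U L F (c • a) (c • b) = psum U L (fun a b => F (c • a) (c • b)) a b := by
  induction L generalizing a b with
  | nil => rfl
  | cons i L ih =>
    rcases i with ((g | e | i) | ⟨t, u, v, h⟩)
    · simp only [psum, Gate.apply, applyOn_smul, ih]
    · simp only [psum, applyOn_smul, ih]
    · simp only [psum, projWire_smul, ih]
    · cases t <;> simp only [psum, swapKet_smul] <;> simp [ih]

lemma psum_weight_left (U : QUnitary n) (L : List (PInstr n R)) (a b : Ket R) :
    psum U.1 L (fun a _ => weight a) a b = weight a := by
  induction L generalizing a b with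
  | nil => rfl
  | cons i L ih =>
    rcases i with ((g | e | i) | ⟨t, u, v, h⟩)
    · simp only [psum, ih]; exact weight_applyOn _ g.mat.2 _
    · simp only [psum, ih]; exact weight_applyOn _ U.2 _
    · simp only [psum, ih, weight_projWire]
    · cases t <;> simp [psum, ih, weight_swapKet]

lemma psum_weight_right (U : QUnitary n) (L : List (PInstr n R)) (a b : Ket R) :
    psum U.1 L (fun _ b => weight b) a b = weight b := by
  induction L generalizing a b with
  | nil => rfl
  | cons i L ih =>
    rcases i with ((g | e | i) | ⟨t, u, v, h⟩)
    · simp only [psum, ih]; exact weight_applyOn _ g.mat.2 _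
    · simp only [psum, ih]; exact weight_applyOn _ U.2 _
    · simp only [psum, ih, weight_projWire]
    · cases t <;> simp [psum, ih, weight_swapKet]

/-- The wires of the register next to the control qubit. -/
def someEmb : R ↪ Option R := Function.Embedding.some

/-- The instruction of the circuit with control qubit `none`. -/
def PInstr.toInstr : PInstr n R → Instr n (Option R)
  | .both i => i.map someEmb
  | .ctrl b u v h => .gate (cswapGate none b (some u) (some v) (by simp) (by simp) (by simpa))

/-- The state with given components for the two values of the control qubit. -/
def glue (a b : Ket R) : Ket (Option R) := fun x => if x none then b (x ∘ some) else a (x ∘ some)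

lemma applyOn_glue {k : ℕ} (e : Fin k ↪ R) (V : Op (Fin k)) (a b : Ket R) :
    applyOn (e.trans someEmb) V (glue a b) = glue (applyOn e V a) (applyOn e V b) := by
  funext x
  rw [applyOn_trans]
  have h1 : ∀ u, Function.extend someEmb u x none = x none := fun u =>
    Function.extend_apply' _ _ _ (by rintro ⟨i, hi⟩; simp [someEmb] at hi)
  have h2 : ∀ u : R → Bool, Function.extend someEmb u x ∘ some = u := fun u =>
    Function.extend_comp (Option.some_injective R) u x
  simp only [glue, h1, h2]
  split_ifs <;> rfl

lemma projWire_glue (i : R) (t : Bool) (a b : Ket R) :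
    projWire (some i) t (glue a b) = glue (projWire i t a) (projWire i t b) := by
  funext x
  simp only [projWire, glue, Function.comp_apply]
  split_ifs <;> rfl

lemma cswapGate_apply_glue (c : Bool) (u v : R) (h1 h2 h3) (a b : Ket R) :
    (cswapGate none c (some u) (some v) h1 h2 h3).apply (glue a b) =
      glue (if c then a else swapKet u v a) (if c then swapKet u v b else b) := by
  funext x
  rw [cswapGate_apply]
  have e1 : (x ∘ Equiv.swap (some u) (some v)) none = x none := by
    rw [Function.comp_apply, Equiv.swap_apply_of_ne_of_ne h1 h2]
  have e2 : (x ∘ Equiv.swap (some u) (some v)) ∘ some = (x ∘ some) ∘ Equiv.swap u v := by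
    funext i
    simp only [Function.comp_apply, Equiv.swap_apply_def, Option.some_inj]
    split_ifs <;> rfl
  simp only [glue, apply_ite (fun y : Option R → Bool => y none),
    apply_ite (fun y : Option R → Bool => y ∘ some), e1, e2, ite_self]
  cases c <;> cases x none <;> simp [swapKet]

lemma hadamardGate_apply_glue (a b : Ket R) : (hadamardGate none).apply (glue a b) =
    glue (((√2 : ℝ) : ℂ)⁻¹ • (a + b)) (((√2 : ℝ) : ℂ)⁻¹ • (a - b)) := by
  funext x
  rw [hadamardGate_apply]
  have h : ∀ t, Function.update x none t ∘ some = x ∘ some := fun t => by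
    funext i; simp
  cases hx : x none <;> simp [glue, hx, h]
  ring

lemma sum_option {M : Type*} [AddCommMonoid M] (F : (Option R → Bool) → M) :
    ∑ x, F x = ∑ t : Bool, ∑ y : R → Bool, F fun i => i.elim t y := by
  rw [← (Equiv.piOptionEquivProd (β := fun _ : Option R => Bool)).symm.sum_comp,
    Fintype.sum_prod_type]
  refine Finset.sum_congr rfl fun t _ => Finset.sum_congr rfl fun y _ => congrArg F ?_
  funext i
  cases i <;> rfl

lemma sum_accept_glue (a b : Ket R) :
    (∑ x : Option R → Bool, if x none = true then ‖glue a b x‖ ^ 2 else 0) = weight b := by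
  rw [sum_option, Fintype.sum_bool]
  simp [glue, weight, Function.comp_def]

/-- No instruction of `L` mixes the two values of the control qubit, so the state keeps the form
`glue a b` and both components share their measurement outcomes. The continuation `c` leaves room
for the final Hadamard gate, which does mix them. -/
lemma sum_map_run_toInstr (U : QUnitary n) (L : List (PInstr n R)) (c : List (Instr n (Option R)))
    (a b : Ket R) (q : List (Op (Fin n))) (F : Ket R → Ket R → ℝ)
    (f : Branch n (Option R) → ℝ)
    (hf : ∀ a b q, ((run U c ⟨glue a b, q⟩).map f).sum = F a b) :
    ((run U (L.map PInstr.toInstr ++ c) ⟨glue a b, q⟩).map f).sum = psum U.1 L F a b := by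
  induction L generalizing a b q with
  | nil => exact hf a b q
  | cons i L ih =>
    rcases i with ((g | e | i) | ⟨t, u, v, h⟩)
    · refine Eq.trans ?_ (ih _ _ q)
      rw [Gate.apply, Gate.apply, ← applyOn_glue]; rfl
    · refine Eq.trans ?_ (ih _ _ (q ++ [reducedState (e.trans someEmb) (glue a b)]))
      rw [← applyOn_glue]; rfl
    · have h : ∀ t : Bool, ((run U (L.map PInstr.toInstr ++ c)
          ⟨projWire (some i) t (glue a b), q⟩).map f).sum =
            psum U.1 L F (projWire i t a) (projWire i t b) := fun t => by
        rw [projWire_glue]; exact ih _ _ _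
      rw [psum, ← h, ← h, ← List.sum_append, ← List.map_append]
      rfl
    · refine Eq.trans ?_ (ih _ _ q)
      rw [← cswapGate_apply_glue t u v (by simp) (by simp) (by simpa)]; rfl

/-- The Hadamard test for the overlap of the final states for the two values of the control
qubit. -/
def hadamardTest (L : List (PInstr n R)) : Distinguisher n where
  Wire := Option R
  circuit := .gate (hadamardGate none) :: (L.map PInstr.toInstr ++ [.gate (hadamardGate none)])
  out := none

lemma hadamardTest_size (L : List (PInstr n R)) :
    (hadamardTest L).size = Fintype.card R + 1 + (L.length + 2) := by
  have h : Fintype.card (hadamardTest L).Wire = Fintype.card R + 1 := Fintype.card_option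
  rw [Distinguisher.size, h]
  simp [hadamardTest]

/-- The inner product of two kets. -/
def innerKet (a b : Ket R) : ℂ := ∑ x, conj (a x) * b x

lemma weight_sub (a b : Ket R) : weight (a - b) = weight a + weight b - 2 * (innerKet a b).re := by
  simp only [weight, innerKet, Complex.re_sum, Finset.mul_sum, ← Finset.sum_add_distrib,
    ← Finset.sum_sub_distrib]
  refine Finset.sum_congr rfl fun x _ => ?_
  simp only [Pi.sub_apply, ← Complex.normSq_eq_norm_sq, Complex.normSq_apply, Complex.mul_re,
    Complex.sub_re, Complex.sub_im, Complex.conj_re, Complex.conj_im]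
  ring

/-- The last Hadamard gate puts (a − b)/2 on the outcome 1, when a and b are the states evolved for
the two control values. The weights of a and of b each sum to one over all outcomes, leaving the
real part of their inner products by polarisation. -/
theorem hadamardTest_acceptProb (U : QUnitary n) (L : List (PInstr n R)) :
    (hadamardTest L).acceptProb U = 1 / 2 - 1 / 2 * psum U.1 L (fun a b => (innerKet a b).re)
      (basisKet fun _ => false) (basisKet fun _ => false) := by
  set s : ℂ := ((√2 : ℝ) : ℂ)⁻¹ with hs
  have hs2 : ‖s‖ ^ 2 = 1 / 2 := by
    rw [hs, norm_inv, Complex.norm_real, Real.norm_of_nonneg (Real.sqrt_nonneg 2), inv_pow,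
      Real.sq_sqrt (by norm_num)]
    norm_num
  set o : Ket R := basisKet fun _ => false with ho
  have hinit : (hadamardGate none).apply (basisKet fun _ : Option R => false) =
      glue (s • o) (s • o) := by
    have : (basisKet fun _ : Option R => false) = glue o 0 := by
      funext x
      cases hx : x none
      · simp only [basisKet, glue, hx, ho, Bool.false_eq_true, if_false]
        refine if_congr ⟨fun h => ?_, fun h => ?_⟩ rfl rfl
        · subst h; rfl
        · funext i
          cases i
          · exact hx
          · exact congrFun h _
      · have hne : x ≠ fun _ => false := fun h => by rw [h] at hx; exact Bool.false_ne_true hx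
        simp [basisKet, glue, hx, hne]
    rw [this, hadamardGate_apply_glue, add_zero, sub_zero]
  have h1 : (hadamardTest L).acceptProb U =
      psum U.1 L (fun a b => weight (s • (a - b))) (s • o) (s • o) := by
    rw [← sum_map_run_toInstr U L [.gate (hadamardGate none)] (s • o) (s • o) []
      (fun a b => weight (s • (a - b)))
      (fun b => ∑ x : Option R → Bool, if x none = true then ‖b.state x‖ ^ 2 else 0), ← hinit]
    · rfl
    · intro a b q
      simp only [run, List.map_cons, List.map_nil, List.sum_singleton]
      rw [hadamardGate_apply_glue, sum_accept_glue]
  have h2 : (fun a b : Ket R => weight (s • (s • a - s • b))) = fun a b =>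
      1 / 4 * weight a + (1 / 4 * weight b + -(1 / 2) * (innerKet a b).re) := by
    funext a b
    rw [← smul_sub, weight_smul, weight_smul, hs2, weight_sub]
    ring
  rw [h1, psum_smul, h2, psum_add, psum_add, psum_const_mul, psum_const_mul, psum_const_mul,
    psum_weight_left, psum_weight_right, ho, weight_basisKet]
  ring

end HadamardTest

end QUnf

end

noncomputable section
namespace QUnf

open Matrix
open scoped ComplexConjugate

set_option linter.unusedSectionVars false

/-! ### Register-wise exchanges and controlled flips. -/

section Registers

variable {n m : ℕ} {R : Type} [Fintype R] [DecidableEq R]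

/-- The exchange of two registers if the control qubit has the value `c`. -/
def swaps (c : Bool) (f g : Fin m ↪ R) (h : ∀ i j, f i ≠ g j) : List (PInstr n R) :=
  (List.finRange m).map fun i => .ctrl c (f i) (g i) (h i i)

lemma swaps_length (c : Bool) (f g : Fin m ↪ R) (h : ∀ i j, f i ≠ g j) :
    (swaps (n := n) c f g h).length = m := by simp [swaps]

/-- The composed permutation is specified through its values on the wires, which determine it; no
closed formula is needed. Disjointness of the registers and the absence of repetitions make the
single exchanges independent. -/
lemma foldl_swapKet (f g : Fin m ↪ R) (h : ∀ i j, f i ≠ g j) (l : List (Fin m)) (hl : l.Nodup)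
    (χ : Ket R) (x : R → Bool) : ∃ y, l.foldl (fun χ i => swapKet (f i) (g i) χ) χ x = χ y ∧
      (∀ i ∈ l, y (f i) = x (g i) ∧ y (g i) = x (f i)) ∧
      ∀ w, (∀ i ∈ l, f i ≠ w ∧ g i ≠ w) → y w = x w := by
  induction l generalizing χ with
  | nil => exact ⟨x, rfl, by simp, by simp⟩
  | cons i l ih =>
    obtain ⟨hi, hl⟩ := List.nodup_cons.1 hl
    obtain ⟨y, h1, h2, h3⟩ := ih hl (swapKet (f i) (g i) χ)
    have hne : ∀ j ∈ l, f j ≠ f i ∧ g j ≠ g i := fun j hj =>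
      ⟨fun e => hi (f.injective e ▸ hj), fun e => hi (g.injective e ▸ hj)⟩
    refine ⟨y ∘ Equiv.swap (f i) (g i), h1, ?_, ?_⟩
    · intro j hj
      rcases List.mem_cons.1 hj with rfl | hj
      · simp only [Function.comp_apply, Equiv.swap_apply_left, Equiv.swap_apply_right]
        exact ⟨h3 _ fun k hk => ⟨h k j, (hne k hk).2⟩, h3 _ fun k hk => ⟨(hne k hk).1, (h j k).symm⟩⟩
      · simp only [Function.comp_apply]
        rw [Equiv.swap_apply_of_ne_of_ne (hne j hj).1 (h j i),
          Equiv.swap_apply_of_ne_of_ne (h i j).symm (hne j hj).2]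
        exact h2 j hj
    · intro w hw
      have := hw i List.mem_cons_self
      rw [Function.comp_apply, Equiv.swap_apply_of_ne_of_ne this.1.symm this.2.symm]
      exact h3 w fun k hk => hw k (List.mem_cons_of_mem _ hk)

lemma foldl_swapKet_finRange (f g : Fin m ↪ R) (h : ∀ i j, f i ≠ g j) (χ χ' : Ket R)
    (hχ : ∀ x y, (∀ i, y (f i) = x (g i)) → (∀ i, y (g i) = x (f i)) →
      (∀ w, (∀ i, f i ≠ w) → (∀ i, g i ≠ w) → y w = x w) → χ y = χ' x) :
    (List.finRange m).foldl (fun χ i => swapKet (f i) (g i) χ) χ = χ' := by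
  funext x
  obtain ⟨y, h1, h2, h3⟩ := foldl_swapKet f g h _ (List.nodup_finRange m) χ x
  rw [h1]
  exact hχ x y (fun i => (h2 i (List.mem_finRange i)).1) (fun i => (h2 i (List.mem_finRange i)).2)
    fun w hf hg => h3 w fun i _ => ⟨hf i, hg i⟩

lemma psum_swaps_false (U : Op (Fin n)) {f g : Fin m ↪ R} {h : ∀ i j, f i ≠ g j}
    (F : Ket R → Ket R → ℝ) (a b : Ket R) {a' : Ket R}
    (ha : ∀ x y, (∀ i, y (f i) = x (g i)) → (∀ i, y (g i) = x (f i)) →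
      (∀ w, (∀ i, f i ≠ w) → (∀ i, g i ≠ w) → y w = x w) → a y = a' x) :
    psum U (swaps false f g h) F a b = F a' b := by
  rw [← foldl_swapKet_finRange f g h a a' ha, swaps]
  generalize List.finRange m = l
  clear ha
  induction l generalizing a with
  | nil => rfl
  | cons i l ih => exact ih _

lemma psum_swaps_true (U : Op (Fin n)) {f g : Fin m ↪ R} {h : ∀ i j, f i ≠ g j}
    (F : Ket R → Ket R → ℝ) (a b : Ket R) {b' : Ket R}
    (hb : ∀ x y, (∀ i, y (f i) = x (g i)) → (∀ i, y (g i) = x (f i)) →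
      (∀ w, (∀ i, f i ≠ w) → (∀ i, g i ≠ w) → y w = x w) → b y = b' x) :
    psum U (swaps true f g h) F a b = F a b' := by
  rw [← foldl_swapKet_finRange f g h b b' hb, swaps]
  generalize List.finRange m = l
  clear hb
  induction l generalizing b with
  | nil => rfl
  | cons i l ih => exact ih _

/-- The gates `G i`, for all `i`, executed for both values of the control qubit. -/
def gates (G : Fin m → Gate R) : List (PInstr n R) :=
  (List.finRange m).map fun i => .both (.gate (G i))

lemma gates_length (G : Fin m → Gate R) : (gates (n := n) G).length = m := by simp [gates]

/-- By `hβ` the flipping bits do not depend on any of the target wires. Earlier flips therefore do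
not affect later ones, and all can be evaluated on the original label. -/
lemma foldl_xor (f : Fin m ↪ R) (β : Fin m → (R → Bool) → Bool) (G : Fin m → Gate R)
    (hG : ∀ i χ x, (G i).apply χ x = χ (Function.update x (f i) (x (f i) ^^ β i x)))
    (hβ : ∀ i x y, (∀ w, (∀ j, f j ≠ w) → y w = x w) → β i y = β i x) (l : List (Fin m))
    (hl : l.Nodup) (χ : Ket R) (x : R → Bool) :
    ∃ y, l.foldl (fun χ i => (G i).apply χ) χ x = χ y ∧
      (∀ i ∈ l, y (f i) = (x (f i) ^^ β i x)) ∧ ∀ w, (∀ i ∈ l, f i ≠ w) → y w = x w := by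
  induction l generalizing χ with
  | nil => exact ⟨x, rfl, by simp, by simp⟩
  | cons i l ih =>
    obtain ⟨hi, hl⟩ := List.nodup_cons.1 hl
    obtain ⟨y, h1, h2, h3⟩ := ih hl ((G i).apply χ)
    refine ⟨Function.update y (f i) (y (f i) ^^ β i y), ?_, ?_, ?_⟩
    · exact h1.trans (hG i χ y)
    · intro j hj
      rcases List.mem_cons.1 hj with rfl | hj
      · rw [Function.update_self, hβ j x y fun w hw => h3 w fun k _ => hw k,
          h3 (f j) fun k hk e => hi (by rwa [f.injective e] at hk)]
      · have hne : f j ≠ f i := fun e => hi (by rwa [f.injective e] at hj)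
        rw [Function.update_of_ne hne]
        exact h2 j hj
    · intro w hw
      rw [Function.update_of_ne (hw i List.mem_cons_self).symm]
      exact h3 w fun k hk => hw k (List.mem_cons_of_mem _ hk)

lemma psum_xor (U : Op (Fin n)) (f : Fin m ↪ R) (β : Fin m → (R → Bool) → Bool)
    {G : Fin m → Gate R}
    (hG : ∀ i χ x, (G i).apply χ x = χ (Function.update x (f i) (x (f i) ^^ β i x)))
    (hβ : ∀ i x y, (∀ w, (∀ j, f j ≠ w) → y w = x w) → β i y = β i x)
    (F : Ket R → Ket R → ℝ) (a b : Ket R) {a' b' : Ket R}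
    (ha : ∀ x y, (∀ i, y (f i) = (x (f i) ^^ β i x)) → (∀ w, (∀ i, f i ≠ w) → y w = x w) →
      a y = a' x)
    (hb : ∀ x y, (∀ i, y (f i) = (x (f i) ^^ β i x)) → (∀ w, (∀ i, f i ≠ w) → y w = x w) →
      b y = b' x) : psum U (gates G) F a b = F a' b' := by
  have key : ∀ χ χ' : Ket R, (∀ x y, (∀ i, y (f i) = (x (f i) ^^ β i x)) →
      (∀ w, (∀ i, f i ≠ w) → y w = x w) → χ y = χ' x) →
      (List.finRange m).foldl (fun χ i => (G i).apply χ) χ = χ' := by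
    intro χ χ' h
    funext x
    obtain ⟨y, h1, h2, h3⟩ := foldl_xor f β G hG hβ _ (List.nodup_finRange m) χ x
    rw [h1]
    exact h x y (fun i => h2 i (List.mem_finRange i)) fun w hw => h3 w fun i _ => hw i
  rw [← key a a' ha, ← key b b' hb, gates]
  generalize List.finRange m = l
  clear ha hb
  induction l generalizing a b with
  | nil => rfl
  | cons i l ih => exact ih _ _

end Registers

/-! ### Register layout of the overlap test. -/

section Layout

variable {n d : ℕ} {ι κ : Type} [Fintype ι] [DecidableEq ι] [Fintype κ] [DecidableEq κ]

/-- The wires of the overlap test: the wires `ι` of the adversary, the wires `κ` of the preparation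
circuit, a register for each of the two values of the control qubit, and a copy of the
description of the challenge. -/
abbrev Lay (n d : ℕ) (ι κ : Type) : Type := ι ⊕ κ ⊕ Fin n ⊕ Fin n ⊕ Fin d

def wMain : ι ↪ Lay n d ι κ := .inl
def wPrep : κ ↪ Lay n d ι κ := .trans .inl .inr
/-- The register of the control value `c`. -/
def wSide : Bool → Fin n ↪ Lay n d ι κ
  | false => .trans .inl (.trans .inr .inr)
  | true => .trans .inl (.trans .inr (.trans .inr .inr))
def wDesc : Fin d ↪ Lay n d ι κ := .trans .inr (.trans .inr (.trans .inr .inr))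

/-- Amplitudes in terms of the labels of the registers, the register which belongs to the control
value first. -/
abbrev Amp (n d : ℕ) (ι κ : Type) : Type :=
  (ι → Bool) → (κ → Bool) → (Fin n → Bool) → (Fin n → Bool) → (Fin d → Bool) → ℂ

/-- The ket with given amplitudes. -/
def pack (c : Bool) (G : Amp n d ι κ) : Ket (Lay n d ι κ) := fun x =>
  G (x ∘ wMain) (x ∘ wPrep) (x ∘ wSide c) (x ∘ wSide !c) (x ∘ wDesc)

lemma wMain_ne_wPrep (i : ι) (j : κ) : (wMain i : Lay n d ι κ) ≠ wPrep j := nofun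
lemma wMain_ne_wDesc (i : ι) (j : Fin d) : (wMain i : Lay n d ι κ) ≠ wDesc j := nofun
lemma wPrep_ne_wDesc (i : κ) (j : Fin d) : (wPrep i : Lay n d ι κ) ≠ wDesc j := nofun
lemma wMain_ne_wSide (i : ι) (c : Bool) (j : Fin n) : (wMain i : Lay n d ι κ) ≠ wSide c j := by
  cases c <;> nofun
lemma wPrep_ne_wSide (i : κ) (c : Bool) (j : Fin n) : (wPrep i : Lay n d ι κ) ≠ wSide c j := by
  cases c <;> nofun
lemma wDesc_ne_wSide (i : Fin d) (c : Bool) (j : Fin n) :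
    (wDesc i : Lay n d ι κ) ≠ wSide c j := by
  cases c <;> nofun
lemma wSide_ne_wSide_not (c : Bool) (i j : Fin n) : (wSide c i : Lay n d ι κ) ≠ wSide (!c) j := by
  cases c <;> nofun

lemma applyOn_pack_wMain {k : ℕ} (c : Bool) (e : Fin k ↪ ι) (V : Op (Fin k)) (G : Amp n d ι κ) :
    applyOn (e.trans wMain) V (pack c G) =
      pack c fun w p a o s => applyOn e V (fun w' => G w' p a o s) w := by
  funext x
  rw [applyOn_trans]
  have h1 : ∀ u : ι → Bool, Function.extend wMain u x ∘ wMain = u := fun u =>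
    Function.extend_comp wMain.injective u x
  have h2 : ∀ {J : Type} (f : J ↪ Lay n d ι κ) (_ : ∀ i j, wMain i ≠ f j) (u : ι → Bool),
      Function.extend wMain u x ∘ f = x ∘ f := fun f hf u => funext fun j =>
    Function.extend_apply' _ _ _ fun ⟨i, hi⟩ => hf i j hi
  simp only [pack, h1, h2 _ wMain_ne_wPrep, h2 _ wMain_ne_wDesc,
    h2 _ fun i j => wMain_ne_wSide i _ j]

lemma applyOn_pack_wPrep {k : ℕ} (c : Bool) (e : Fin k ↪ κ) (V : Op (Fin k)) (G : Amp n d ι κ) :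
    applyOn (e.trans wPrep) V (pack c G) =
      pack c fun w p a o s => applyOn e V (fun p' => G w p' a o s) p := by
  funext x
  rw [applyOn_trans]
  have h1 : ∀ u : κ → Bool, Function.extend wPrep u x ∘ wPrep = u := fun u =>
    Function.extend_comp wPrep.injective u x
  have h2 : ∀ {J : Type} (f : J ↪ Lay n d ι κ) (_ : ∀ i j, wPrep i ≠ f j) (u : κ → Bool),
      Function.extend wPrep u x ∘ f = x ∘ f := fun f hf u => funext fun j =>
    Function.extend_apply' _ _ _ fun ⟨i, hi⟩ => hf i j hi
  simp only [pack, h1, h2 _ wPrep_ne_wDesc, h2 _ fun i j => (wMain_ne_wPrep j i).symm,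
    h2 _ fun i j => wPrep_ne_wSide i _ j]

lemma gate_map_wMain_apply (c : Bool) (g : Gate ι) (G : Amp n d ι κ) :
    (g.map wMain).apply (pack c G) = pack c fun w p a o s => g.apply (fun w' => G w' p a o s) w :=
  applyOn_pack_wMain ..

lemma projWire_pack (c : Bool) (i : ι) (t : Bool) (G : Amp n d ι κ) :
    projWire (wMain i) t (pack c G) =
      pack c fun w p a o s => projWire i t (fun w' => G w' p a o s) w := rfl

lemma pack_congr (G : Amp n d ι κ) {w w' : ι → Bool} {p p' : κ → Bool}
    {a a' o o' : Fin n → Bool} {s s' : Fin d → Bool} (hw : w = w') (hp : p = p') (ha : a = a')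
    (ho : o = o') (hs : s = s') : G w p a o s = G w' p' a' o' s' := by
  subst hw hp ha ho hs; rfl

lemma comp_eq_extend {J : Type} {k : ℕ} (e : Fin k ↪ J) (j : J ↪ Lay n d ι κ)
    (x y : Lay n d ι κ → Bool) (u : Fin k → Bool) (h1 : ∀ i, y (j (e i)) = u i)
    (h2 : ∀ i, (∀ l, e l ≠ i) → y (j i) = x (j i)) :
    y ∘ j = Function.extend e u (x ∘ j) := by
  funext i
  by_cases hi : ∃ l, e l = i
  · obtain ⟨l, rfl⟩ := hi
    rw [e.injective.extend_apply]
    exact h1 l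
  · rw [Function.extend_apply' _ _ _ hi]
    exact h2 i fun l hl => hi ⟨l, hl⟩

/-- Exchange of the register of the control value with a part of the main register. -/
lemma pack_swap_side (c : Bool) (e : Fin n ↪ ι) (G : Amp n d ι κ) (x y : Lay n d ι κ → Bool)
    (h1 : ∀ i, y (e.trans wMain i) = x (wSide c i)) (h2 : ∀ i, y (wSide c i) = x (e.trans wMain i))
    (h3 : ∀ w, (∀ i, e.trans wMain i ≠ w) → (∀ i, wSide c i ≠ w) → y w = x w) :
    pack c G y = pack c (fun w p a o s => G (Function.extend e a w) p (w ∘ e) o s) x := by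
  refine pack_congr G ?_ ?_ ?_ ?_ ?_
  · refine comp_eq_extend e wMain x y _ h1 fun i hi => h3 _ (fun l hl => ?_)
      fun l => (wMain_ne_wSide i c l).symm
    exact hi l (wMain.injective hl)
  · exact funext fun j => h3 _ (fun i => wMain_ne_wPrep _ j) fun i => (wPrep_ne_wSide j c i).symm
  · exact funext h2
  · exact funext fun j => h3 _ (fun i => wMain_ne_wSide _ _ j) fun i => wSide_ne_wSide_not c i j
  · exact funext fun j => h3 _ (fun i => wMain_ne_wDesc _ j) fun i => (wDesc_ne_wSide j c i).symm

/-- Exchange of parts of the main register and of the preparation register. -/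
lemma pack_swap_prep (c : Bool) (e : Fin n ↪ ι) (f : Fin n ↪ κ) (G : Amp n d ι κ)
    (x y : Lay n d ι κ → Bool)
    (h1 : ∀ i, y (e.trans wMain i) = x (f.trans wPrep i))
    (h2 : ∀ i, y (f.trans wPrep i) = x (e.trans wMain i))
    (h3 : ∀ w, (∀ i, e.trans wMain i ≠ w) → (∀ i, f.trans wPrep i ≠ w) → y w = x w) :
    pack c G y = pack c (fun w p a o s =>
      G (Function.extend e (p ∘ f) w) (Function.extend f (w ∘ e) p) a o s) x := by
  refine pack_congr G ?_ ?_ ?_ ?_ ?_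
  · refine comp_eq_extend e wMain x y _ h1 fun i hi => h3 _ (fun l hl => ?_)
      fun l => (wMain_ne_wPrep i _).symm
    exact hi l (wMain.injective hl)
  · refine comp_eq_extend f wPrep x y _ h2 fun i hi => h3 _ (fun l => wMain_ne_wPrep _ i)
      fun l hl => ?_
    exact hi l (wPrep.injective hl)
  · exact funext fun j => h3 _ (fun i => wMain_ne_wSide _ _ j) fun i => wPrep_ne_wSide _ _ j
  · exact funext fun j => h3 _ (fun i => wMain_ne_wSide _ _ j) fun i => wPrep_ne_wSide _ _ j
  · exact funext fun j => h3 _ (fun i => wMain_ne_wDesc _ j) fun i => wPrep_ne_wDesc _ j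

lemma sum_lay {M : Type*} [AddCommMonoid M] (F : (ι → Bool) → (κ → Bool) → (Fin n → Bool) →
    (Fin n → Bool) → (Fin d → Bool) → M) :
    ∑ x : Lay n d ι κ → Bool, F (x ∘ wMain) (x ∘ wPrep) (x ∘ wSide false) (x ∘ wSide true)
      (x ∘ wDesc) = ∑ w, ∑ p, ∑ a, ∑ b, ∑ s, F w p a b s := by
  have h : ∀ {J K : Type} [Fintype J] [Fintype K] [DecidableEq J] [DecidableEq K]
      (G : (J → Bool) → (K → Bool) → M),
      ∑ x : J ⊕ K → Bool, G (x ∘ Sum.inl) (x ∘ Sum.inr) = ∑ u, ∑ v, G u v := by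
    intro J K _ _ _ _ G
    rw [← (Equiv.sumArrowEquivProdArrow J K Bool).symm.sum_comp, Fintype.sum_prod_type]
    rfl
  refine (h fun w x => F w (x ∘ Sum.inl) (x ∘ Sum.inr ∘ Sum.inl) (x ∘ Sum.inr ∘ Sum.inr ∘ Sum.inl)
    (x ∘ Sum.inr ∘ Sum.inr ∘ Sum.inr)).trans (Finset.sum_congr rfl fun w _ => ?_)
  refine (h fun p x => F w p (x ∘ Sum.inl) (x ∘ Sum.inr ∘ Sum.inl)
    (x ∘ Sum.inr ∘ Sum.inr)).trans (Finset.sum_congr rfl fun p _ => ?_)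
  refine (h fun a x => F w p a (x ∘ Sum.inl) (x ∘ Sum.inr)).trans
    (Finset.sum_congr rfl fun a _ => ?_)
  exact h fun b s => F w p a b s

end Layout

/-! ### Exchanging the answer to a single query with a side register. -/

section Lift

variable {n d : ℕ} {ι κ : Type} [Fintype ι] [DecidableEq ι] [Fintype κ] [DecidableEq κ]

/-- The index of a query as seen after the first query. -/
def dropFirst : Option ℕ → Option ℕ
  | some (k + 1) => some k
  | _ => none

/-- The exchange of the wires `e` with the register of the control value `c`, for this control
value. -/
def sideSwap (c : Bool) (e : Fin n ↪ ι) : List (PInstr n (Lay n d ι κ)) :=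
  swaps c (e.trans wMain) (wSide c) fun i j => wMain_ne_wSide (e i) c j

/-- A circuit on the main register in which, for the control value `c`, the answer to the query with
index `t c` is exchanged with the register of this control value. -/
def lift (κ : Type) [Fintype κ] [DecidableEq κ] (d : ℕ) :
    List (Instr n ι) → (Bool → Option ℕ) → List (PInstr n (Lay n d ι κ))
  | [], _ => []
  | .gate g :: c, t => .both (.gate (g.map wMain)) :: lift κ d c t
  | .query e :: c, t => .both (.query (e.trans wMain)) ::
      ((if t false = some 0 then sideSwap false e else []) ++
        ((if t true = some 0 then sideSwap true e else []) ++ lift κ d c (dropFirst ∘ t)))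
  | .measure i :: c, t => .both (.measure (wMain i)) :: lift κ d c t

/-- The effect of a lifted circuit on the main register and the register of one control value. -/
def side (U : Op (Fin n)) : (c : List (Instr n ι)) → Option ℕ → Hist c →
    ((ι → Bool) → (Fin n → Bool) → ℂ) → (ι → Bool) → (Fin n → Bool) → ℂ
  | [], _, _, G => G
  | .gate g :: c, t, h, G => side U c t h fun w a => g.apply (fun w' => G w' a) w
  | .query e :: c, t, h, G => side U c (dropFirst t) h (if t = some 0 then
      fun w a => applyOn e U (fun w' => G w' (w ∘ e)) (Function.extend e a w)
      else fun w a => applyOn e U (fun w' => G w' a) w)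
  | .measure i :: c, t, h, G => side U c t h.2 fun w a => projWire i h.1 (fun w' => G w' a) w

lemma lift_length (c : List (Instr n ι)) (t : Bool → Option ℕ) :
    (lift κ d c t).length ≤ (1 + 2 * n) * c.length := by
  induction c generalizing t with
  | nil => simp [lift]
  | cons i c ih =>
    rcases i with g | e | i
    · have := ih t; simp only [lift, List.length_cons]; nlinarith
    · have := ih (dropFirst ∘ t)
      have h : ∀ b, (if t b = some 0 then sideSwap (κ := κ) (d := d) b e else []).length ≤ n := by
        intro b
        split_ifs
        · exact (swaps_length ..).le
        · simp
      have h1 := h false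
      have h2 := h true
      simp only [lift, List.length_cons, List.length_append]
      nlinarith
    · have := ih t; simp only [lift, List.length_cons]; nlinarith

lemma psum_sideSwap_false (U : Op (Fin n)) (e : Fin n ↪ ι)
    (F : Ket (Lay n d ι κ) → Ket (Lay n d ι κ) → ℝ) (G : Amp n d ι κ) (b : Ket (Lay n d ι κ)) :
    psum U (sideSwap false e) F (pack false G) b =
      F (pack false fun w p a o s => G (Function.extend e a w) p (w ∘ e) o s) b :=
  psum_swaps_false U F _ _ fun x y h1 h2 h3 => pack_swap_side false e G x y h1 h2 h3

lemma psum_sideSwap_true (U : Op (Fin n)) (e : Fin n ↪ ι)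
    (F : Ket (Lay n d ι κ) → Ket (Lay n d ι κ) → ℝ) (G : Amp n d ι κ) (a : Ket (Lay n d ι κ)) :
    psum U (sideSwap true e) F a (pack true G) =
      F a (pack true fun w p a o s => G (Function.extend e a w) p (w ∘ e) o s) :=
  psum_swaps_true U F _ _ fun x y h1 h2 h3 => pack_swap_side true e G x y h1 h2 h3

/-- For each control value the lifted circuit touches only the main register and the register of
that value; all other labels are mere parameters. Measurement outcomes are common to both values,
whence a single sum over `h`. -/
lemma psum_lift (U : Op (Fin n)) (c : List (Instr n ι)) (t : Bool → Option ℕ)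
    (F : Ket (Lay n d ι κ) → Ket (Lay n d ι κ) → ℝ) (G : Bool → Amp n d ι κ) :
    psum U (lift κ d c t) F (pack false (G false)) (pack true (G true)) =
      ∑ h : Hist c,
        F (pack false fun w p a o s =>
            side U c (t false) h (fun w' a' => G false w' p a' o s) w a)
          (pack true fun w p a o s =>
            side U c (t true) h (fun w' a' => G true w' p a' o s) w a) := by
  induction c generalizing t G with
  | nil => exact (Fintype.sum_unique (ι := Unit) fun _ => F (pack false (G false))
      (pack true (G true))).symm
  | cons i c ih =>
    rcases i with g | e | i
    · rw [lift, psum, gate_map_wMain_apply, gate_map_wMain_apply]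
      exact ih t fun b w p a o s => g.apply (fun w' => G b w' p a o s) w
    · rw [lift, psum, applyOn_pack_wMain, applyOn_pack_wMain, psum_append]
      have h0 : ∀ (F : Ket (Lay n d ι κ) → Ket (Lay n d ι κ) → ℝ) (G : Amp n d ι κ) b,
          psum U (if t false = some 0 then sideSwap false e else []) F (pack false G) b =
          F (pack false (if t false = some 0 then
            fun w p a o s => G (Function.extend e a w) p (w ∘ e) o s else G)) b := by
        intro F G b
        split_ifs
        · exact psum_sideSwap_false ..
        · rfl
      have h1 : ∀ (F : Ket (Lay n d ι κ) → Ket (Lay n d ι κ) → ℝ) (G : Amp n d ι κ) a,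
          psum U (if t true = some 0 then sideSwap true e else []) F a (pack true G) =
          F a (pack true (if t true = some 0 then
            fun w p a o s => G (Function.extend e a w) p (w ∘ e) o s else G)) := by
        intro F G b
        split_ifs
        · exact psum_sideSwap_true ..
        · rfl
      rw [h0, psum_append, h1]
      refine (ih (dropFirst ∘ t) fun b => if t b = some 0 then
          fun w p a o s => applyOn e U (fun w' => G b w' p (w ∘ e) o s) (Function.extend e a w)
        else fun w p a o s => applyOn e U (fun w' => G b w' p a o s) w).trans ?_
      have hs : ∀ b (h : Hist c) (w : ι → Bool) (p : κ → Bool) (a o : Fin n → Bool)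
          (s : Fin d → Bool), side U c ((dropFirst ∘ t) b) h (fun w' a' => (if t b = some 0 then
          fun w p a o s => applyOn e U (fun w' => G b w' p (w ∘ e) o s) (Function.extend e a w)
        else fun w p a o s => applyOn e U (fun w' => G b w' p a o s) w : Amp n d ι κ)
          w' p a' o s) w a =
        side U (.query e :: c) (t b) h (fun w' a' => G b w' p a' o s) w a := by
        intro b h w p a o s
        rw [side, Function.comp_apply]
        split_ifs <;> rfl
      simp only [hs]
    · rw [lift, psum, projWire_pack, projWire_pack, projWire_pack, projWire_pack]
      rw [ih t fun b w p a o s => projWire i false (fun w' => G b w' p a o s) w,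
        ih t fun b w p a o s => projWire i true (fun w' => G b w' p a o s) w]
      exact (sum_hist_measure i c fun h => F
        (pack false fun w p a o s =>
          side U (.measure i :: c) (t false) h (fun w' a' => G false w' p a' o s) w a)
        (pack true fun w p a o s =>
          side U (.measure i :: c) (t true) h (fun w' a' => G true w' p a' o s) w a)).symm

lemma side_none (U : Op (Fin n)) (c : List (Instr n ι)) (h : Hist c)
    (G : (ι → Bool) → (Fin n → Bool) → ℂ) (w : ι → Bool) (a : Fin n → Bool) :
    side U c none h G w a = evolve c (fun _ => U) h (fun w' => G w' a) w := by
  induction c generalizing G with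
  | nil => rfl
  | cons i c ih =>
    rcases i with g | e | i
    · exact ih h _
    · exact ih h _
    · exact ih h.2 _

/-- The side register starts in y. The exchange after the k-th query puts y on the query wires and
stores the true answer in the register; on the component where it is found as a, the query has acted
as |y⟩⟨a|U. -/
lemma side_some (U : Op (Fin n)) (c : List (Instr n ι)) (h : Hist c) (k : ℕ)
    (hk : k < numQueries c) (y : Fin n → Bool) (φ : Ket ι) (w : ι → Bool) (a : Fin n → Bool) :
    side U c (some k) h (fun w a => if a = y then φ w else 0) w a =
      evolve c (Function.update (fun _ => U) k (rowOp U y a)) h φ w := by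
  induction c generalizing k φ with
  | nil => simp [numQueries] at hk
  | cons i c ih =>
    have hif : ∀ {k : ℕ} (e : Fin k ↪ ι) (V : Op (Fin k)) (a : Fin n → Bool) (φ : Ket ι),
        applyOn e V (fun w' => if a = y then φ w' else 0) =
          fun w => if a = y then applyOn e V φ w else 0 := by
      intro k e V a φ
      split_ifs
      · rfl
      · funext w; simp [applyOn]
    rcases i with g | e | i
    · refine Eq.trans ?_ (ih h k hk (g.apply φ))
      simp only [side, Gate.apply, hif]
    · rcases k with _ | k
      · rw [evolve_query_update_zero, side, if_pos rfl, dropFirst, side_none]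
        · refine congrFun (congrArg _ (funext fun w' => ?_)) w
          simp only [applyOn, rowOp, Function.extend_comp e.injective, ite_mul, zero_mul]
          split_ifs with hw
          · refine Finset.sum_congr rfl fun z _ => ?_
            congr 2
            rw [extend_eq_join, extend_eq_join, extend_eq_join e z w', join, join, join,
              Equiv.apply_symm_apply]
          · simp
        · exact fun _ => nofun
      · rw [evolve_query_update_succ]
        refine Eq.trans ?_ (ih h k (by simpa [numQueries] using hk) (applyOn e U φ))
        rw [side, if_neg (by simp)]
        simp only [hif, dropFirst]
    · refine Eq.trans ?_ (ih h.2 k hk (projWire i h.1 φ))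
      rw [side]
      congr 1
      funext w a
      simp only [projWire]
      split_ifs <;> rfl

end Lift

end QUnf

end

noncomputable section
namespace QUnf

open Matrix
open scoped ComplexConjugate

set_option linter.unusedSectionVars false

/-! ### The stages of the overlap test. -/

section Stages

variable {n d : ℕ} {ι κ : Type} [Fintype ι] [DecidableEq ι] [Fintype κ] [DecidableEq κ]

lemma side_const_mul (U : Op (Fin n)) (c : List (Instr n ι)) (t : Option ℕ) (h : Hist c) (z : ℂ)
    (G : (ι → Bool) → (Fin n → Bool) → ℂ) :
    side U c t h (fun w a => z * G w a) = fun w a => z * side U c t h G w a := by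
  have hz : ∀ {k : ℕ} (e : Fin k ↪ ι) (V : Op (Fin k)) (φ : Ket ι),
      applyOn e V (fun w' => z * φ w') = fun w => z * applyOn e V φ w := fun e V φ =>
    applyOn_smul e V z φ
  induction c generalizing t G with
  | nil => rfl
  | cons i c ih =>
    rcases i with g | e | i
    · refine Eq.trans ?_ (ih t h _)
      simp only [side, Gate.apply, hz]
    · refine Eq.trans ?_ (ih (dropFirst t) h _)
      simp only [side, hz]
      congr 1
      split_ifs <;> rfl
    · refine Eq.trans ?_ (ih t h.2 _)
      simp only [side, projWire, mul_ite, mul_zero]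

/-- The amplitudes of a product state of the preparation register and of the main register with the
register of the control value, given the description, when the other register is in the state
`y`. -/
def stage (ξ : (Fin d → Bool) → Ket κ) (y : Fin n → Bool)
    (S : (Fin d → Bool) → (ι → Bool) → (Fin n → Bool) → ℂ) : Amp n d ι κ :=
  fun w p a o s => (if o = y then ξ s p else 0) * S s w a

lemma psum_lift_stage (U : Op (Fin n)) (c : List (Instr n ι)) (t : Bool → Option ℕ)
    (F : Ket (Lay n d ι κ) → Ket (Lay n d ι κ) → ℝ) (ξ : (Fin d → Bool) → Ket κ)
    (y : Bool → Fin n → Bool) (S : Bool → (Fin d → Bool) → (ι → Bool) → (Fin n → Bool) → ℂ) :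
    psum U (lift κ d c t) F (pack false (stage ξ (y true) (S false)))
        (pack true (stage ξ (y false) (S true))) =
      ∑ h : Hist c, F (pack false (stage ξ (y true) fun s => side U c (t false) h (S false s)))
        (pack true (stage ξ (y false) fun s => side U c (t true) h (S true s))) := by
  refine (psum_lift U c t F fun b => stage ξ (y !b) (S b)).trans
    (Finset.sum_congr rfl fun h _ => ?_)
  simp only [stage, side_const_mul]
  rfl

lemma psum_tag_stage (U : Op (Fin n)) (e : Fin n ↪ ι) (t : Bool → Prop) [∀ b, Decidable (t b)]
    (F : Ket (Lay n d ι κ) → Ket (Lay n d ι κ) → ℝ) (ξ : (Fin d → Bool) → Ket κ)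
    (y : Bool → Fin n → Bool) (S : Bool → (Fin d → Bool) → (ι → Bool) → (Fin n → Bool) → ℂ) :
    psum U ((if t false then sideSwap false e else []) ++ if t true then sideSwap true e else [])
        F (pack false (stage ξ (y true) (S false))) (pack true (stage ξ (y false) (S true))) =
      F (pack false (stage ξ (y true) fun s w a =>
          if t false then S false s (Function.extend e a w) (w ∘ e) else S false s w a))
        (pack true (stage ξ (y false) fun s w a =>
          if t true then S true s (Function.extend e a w) (w ∘ e) else S true s w a)) := by
  rw [psum_append]
  by_cases h0 : t false <;> by_cases h1 : t true <;>
    simp only [h0, h1, if_true, if_false, psum_sideSwap_false, psum_sideSwap_true, psum] <;> rfl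

lemma pack_stage_applyOn (c : Bool) {k : ℕ} (e : Fin k ↪ κ) (V : Op (Fin k))
    (ξ : (Fin d → Bool) → Ket κ) (y : Fin n → Bool)
    (S : (Fin d → Bool) → (ι → Bool) → (Fin n → Bool) → ℂ) :
    applyOn (e.trans wPrep) V (pack c (stage ξ y S)) =
      pack c (stage (fun s => applyOn e V (ξ s)) y S) := by
  rw [applyOn_pack_wPrep]
  congr 1
  funext w p a o s
  simp only [stage]
  split_ifs
  · have := congrFun (applyOn_smul e V (S s w a) (ξ s)) p
    simp only [Pi.smul_apply, smul_eq_mul] at this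
    rw [mul_comm, ← this]
    congr 1
    funext p'
    simp [mul_comm]
  · simp [applyOn]

lemma psum_prep_stage (U : Op (Fin n)) (c : List (Gate κ))
    (F : Ket (Lay n d ι κ) → Ket (Lay n d ι κ) → ℝ) (ξ : (Fin d → Bool) → Ket κ)
    (y y' : Fin n → Bool) (S S' : (Fin d → Bool) → (ι → Bool) → (Fin n → Bool) → ℂ) :
    psum U (c.map fun g => .both (.gate (g.map wPrep))) F (pack false (stage ξ y S))
        (pack true (stage ξ y' S')) =
      F (pack false (stage (fun s => applyGates c (ξ s)) y S))
        (pack true (stage (fun s => applyGates c (ξ s)) y' S')) := by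
  induction c generalizing ξ with
  | nil => rfl
  | cons g c ih =>
    refine Eq.trans ?_ (ih fun s => g.apply (ξ s))
    rw [List.map_cons, psum]
    have h : ∀ b (y : Fin n → Bool) (S : (Fin d → Bool) → (ι → Bool) → (Fin n → Bool) → ℂ),
        (g.map wPrep).apply (pack b (stage ξ y S)) =
        pack b (stage (fun s => g.apply (ξ s)) y S) := fun b y S => pack_stage_applyOn ..
    rw [h, h]

/-- Preparation of the registers of the two control values. -/
def initCircuit (ι κ : Type) [Fintype ι] [DecidableEq ι] [Fintype κ] [DecidableEq κ] (d : ℕ)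
    (y : Bool → Fin n → Bool) : List (PInstr n (Lay n d ι κ)) :=
  gates (fun i => flipGate (y false i) (wSide false i)) ++
    gates fun i => flipGate (y true i) (wSide true i)

lemma psum_initCircuit (U : Op (Fin n)) (y : Bool → Fin n → Bool)
    (F : Ket (Lay n d ι κ) → Ket (Lay n d ι κ) → ℝ) :
    psum U (initCircuit ι κ d y) F (basisKet fun _ => false) (basisKet fun _ => false) =
      F (pack false (stage (fun s p => if s = (fun _ => false) then basisKet (fun _ => false) p
          else 0) (y true) fun _ w a => if a = y false then basisKet (fun _ => false) w else 0))
        (pack true (stage (fun s p => if s = (fun _ => false) then basisKet (fun _ => false) p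
          else 0) (y false) fun _ w a => if a = y true then basisKet (fun _ => false) w else 0)) := by
  set Z : (Fin n → Bool) → (Fin n → Bool) → Amp n d ι κ := fun y y' =>
    stage (fun s p => if s = (fun _ => false) then basisKet (fun _ => false) p
      else 0) y' fun _ w a => if a = y then basisKet (fun _ => false) w else 0 with hZ
  have h0 : ∀ c, (basisKet fun _ => false : Ket (Lay n d ι κ)) =
      pack c (Z (fun _ => false) fun _ => false) := by
    intro c
    funext x
    have hx : x = (fun _ => false) ↔ (x ∘ wMain = fun _ => false) ∧ (x ∘ wPrep = fun _ => false) ∧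
        (x ∘ wSide c = fun _ => false) ∧ (x ∘ wSide (!c) = fun _ => false) ∧
        x ∘ wDesc = fun _ => false := by
      constructor
      · rintro rfl
        exact ⟨rfl, rfl, rfl, rfl, rfl⟩
      · rintro ⟨h1, h2, h3, h4, h5⟩
        funext i
        rcases i with i | i | i | i | i
        · exact congrFun h1 i
        · exact congrFun h2 i
        · cases c
          · exact congrFun h3 i
          · exact congrFun h4 i
        · cases c
          · exact congrFun h4 i
          · exact congrFun h3 i
        · exact congrFun h5 i
    simp only [basisKet, pack, hZ, stage, hx]
    split_ifs <;> simp_all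
  have hxor : ∀ (b : Fin n → Bool) (a z : Fin n → Bool), (fun i => a i ^^ b i) = z ↔
      a = fun i => z i ^^ b i := by
    intro b a z
    simp only [funext_iff]
    refine forall_congr' fun i => ?_
    cases a i <;> cases b i <;> cases z i <;> simp
  -- The amplitudes list the register of the own control value first. A flip of register b hence
  -- changes the first label if b = c and the second otherwise.
  have hstep : ∀ (c b : Bool) (v : Fin n → Bool) (z z' : Fin n → Bool) (x x' : Lay n d ι κ → Bool),
      (∀ i, x' (wSide b i) = (x (wSide b i) ^^ v i)) →
      (∀ w, (∀ i, wSide b i ≠ w) → x' w = x w) → pack c (Z z z') x' =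
        pack c (Z (if b = c then fun i => z i ^^ v i else z)
          (if b = c then z' else fun i => z' i ^^ v i)) x := by
    intro c b v z z' x x' h1 h2
    have e1 : x' ∘ wMain = x ∘ wMain := funext fun j => h2 _ fun i => (wMain_ne_wSide j b i).symm
    have e2 : x' ∘ wPrep = x ∘ wPrep := funext fun j => h2 _ fun i => (wPrep_ne_wSide j b i).symm
    have e3 : x' ∘ wDesc = x ∘ wDesc := funext fun j => h2 _ fun i => (wDesc_ne_wSide j b i).symm
    have e4 : x' ∘ wSide b = fun i => (x ∘ wSide b) i ^^ v i := funext h1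
    have e5 : x' ∘ wSide (!b) = x ∘ wSide (!b) := funext fun j => h2 _ fun i =>
      wSide_ne_wSide_not b i j
    by_cases hb : b = c
    · subst hb
      simp only [pack, hZ, stage, e1, e2, e3, e4, e5, hxor, if_true]
    · obtain rfl : c = !b := by cases b <;> cases c <;> simp_all
      simp only [Bool.not_not, pack, hZ, stage, e1, e2, e3, e4, e5, hxor, if_neg hb]
  have hone : ∀ (b : Bool) (v z z' : Fin n → Bool) (F : Ket (Lay n d ι κ) → Ket (Lay n d ι κ) → ℝ),
      psum U (gates fun i => flipGate (v i) (wSide b i)) F (pack false (Z z z'))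
        (pack true (Z z' z)) =
      F (pack false (Z (if b = false then fun i => z i ^^ v i else z)
          (if b = false then z' else fun i => z' i ^^ v i)))
        (pack true (Z (if b = true then fun i => z' i ^^ v i else z')
          (if b = true then z else fun i => z i ^^ v i))) := by
    intro b v z z' F
    exact psum_xor U (wSide b) (fun i _ => v i) (fun i χ x => flipGate_apply _ _ χ x)
      (fun _ _ _ _ => rfl) F _ _ (fun x x' h1 h2 => hstep false b v z z' x x' h1 h2)
      fun x x' h1 h2 => hstep true b v z' z x x' h1 h2
  rw [initCircuit, psum_append]
  nth_rewrite 1 [h0 false]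
  rw [h0 true, hone]
  refine (hone true _ _ _ F).trans ?_
  simp [hZ]

/-- The description of the challenge, found on the wires `f`, is copied to the preparation register
and to the description register. -/
def copyCircuit (f : Fin d ↪ ι) (e : Fin d ↪ κ) : List (PInstr n (Lay n d ι κ)) :=
  gates (fun j => cnotGate (wMain (f j)) (wDesc j) (wMain_ne_wDesc _ _)) ++
    gates fun j => cnotGate (wMain (f j)) (wPrep (e j)) (wMain_ne_wPrep _ _)

/-- The measurement of the description is replaced by coherent copies. The copy in the description
register is never changed again, so components with different s stay orthogonal and every inner
product becomes a sum over s, as after a measurement. -/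
lemma psum_copyCircuit (U : Op (Fin n)) (f : Fin d ↪ ι) (e : Fin d ↪ κ)
    (F : Ket (Lay n d ι κ) → Ket (Lay n d ι κ) → ℝ) (y y' : Fin n → Bool)
    (S S' : (ι → Bool) → (Fin n → Bool) → ℂ) :
    psum U (copyCircuit f e) F
        (pack false (stage (fun s p => if s = (fun _ => false) then basisKet (fun _ => false) p
          else 0) y fun _ => S))
        (pack true (stage (fun s p => if s = (fun _ => false) then basisKet (fun _ => false) p
          else 0) y' fun _ => S')) =
      F (pack false (stage (fun s => basisKet (Function.extend e s fun _ => false)) y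
          fun s w a => projectOn f s (fun w' => S w' a) w))
        (pack true (stage (fun s => basisKet (Function.extend e s fun _ => false)) y'
          fun s w a => projectOn f s (fun w' => S' w' a) w)) := by
  have h1 : ∀ (c : Bool) (G : Amp n d ι κ) (x x' : Lay n d ι κ → Bool),
      (∀ j, x' (wDesc j) = (x (wDesc j) ^^ x (wMain (f j)))) →
      (∀ w, (∀ j, wDesc j ≠ w) → x' w = x w) →
      pack c G x' = pack c (fun w p a o s => G w p a o fun j => s j ^^ w (f j)) x := by
    intro c G x x' h1 h2
    refine pack_congr G ?_ ?_ ?_ ?_ (funext h1)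
    · exact funext fun j => h2 _ fun i => (wMain_ne_wDesc j i).symm
    · exact funext fun j => h2 _ fun i => (wPrep_ne_wDesc j i).symm
    · exact funext fun j => h2 _ fun i => wDesc_ne_wSide i _ j
    · exact funext fun j => h2 _ fun i => wDesc_ne_wSide i _ j
  have h2 : ∀ (c : Bool) (G : Amp n d ι κ) (x x' : Lay n d ι κ → Bool),
      (∀ j, x' (e.trans wPrep j) = (x (e.trans wPrep j) ^^ x (wMain (f j)))) →
      (∀ w, (∀ j, e.trans wPrep j ≠ w) → x' w = x w) →
      pack c G x' = pack c (fun w p a o s =>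
        G w (Function.extend e (fun j => p (e j) ^^ w (f j)) p) a o s) x := by
    intro c G x x' h1 h2
    refine pack_congr G ?_ ?_ ?_ ?_ ?_
    · exact funext fun j => h2 _ fun i => (wMain_ne_wPrep j _).symm
    · refine comp_eq_extend e wPrep x x' _ h1 fun i hi => h2 _ fun l hl => ?_
      exact hi l (wPrep.injective hl)
    · exact funext fun j => h2 _ fun i => wPrep_ne_wSide _ _ j
    · exact funext fun j => h2 _ fun i => wPrep_ne_wSide _ _ j
    · exact funext fun j => h2 _ fun i => wPrep_ne_wDesc _ j
  have h3 : ∀ (c : Bool) (y : Fin n → Bool) (S : (ι → Bool) → (Fin n → Bool) → ℂ),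
      (pack c fun w p a o s => (stage (fun s p => if s = (fun _ => false) then
          basisKet (fun _ => false) p else 0) y fun _ => S : Amp n d ι κ) w
          (Function.extend e (fun j => p (e j) ^^ w (f j)) p) a o fun j => s j ^^ w (f j)) =
        pack c (stage (fun s => basisKet (Function.extend e s fun _ => false)) y
          fun s w a => projectOn f s (fun w' => S w' a) w) := by
    intro c y S
    congr 1
    funext w p a o s
    have hs : (fun j => s j ^^ w (f j)) = (fun _ => false) ↔ w ∘ f = s := by
      simp only [funext_iff, Function.comp_apply]
      refine forall_congr' fun i => ?_
      cases s i <;> cases w (f i) <;> simp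
    simp only [stage, hs, projectOn]
    split_ifs with ho hw
    · subst hw
      congr 1
      simp only [basisKet]
      refine if_congr ⟨fun h => ?_, fun h => ?_⟩ rfl rfl
      · funext i
        have hi := congrFun h i
        by_cases he : ∃ j, e j = i
        · obtain ⟨j, rfl⟩ := he
          rw [e.injective.extend_apply] at hi ⊢
          simpa using hi
        · rw [Function.extend_apply' _ _ _ he] at hi ⊢
          exact hi
      · subst h
        funext i
        by_cases he : ∃ j, e j = i
        · obtain ⟨j, rfl⟩ := he
          rw [e.injective.extend_apply, e.injective.extend_apply]
          simp
        · rw [Function.extend_apply' _ _ _ he, Function.extend_apply' _ _ _ he]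
    all_goals simp
  rw [copyCircuit, psum_append]
  refine (psum_xor U wDesc (fun j x => x (wMain (f j))) (fun j χ x => cnotGate_apply _ _ _ χ x)
    (fun j x x' h => h _ fun i => (wMain_ne_wDesc _ i).symm) _ _ _ (h1 false _) (h1 true _)).trans ?_
  refine (psum_xor U (e.trans wPrep) (fun j x => x (wMain (f j)))
    (fun j χ x => cnotGate_apply _ _ _ χ x)
    (fun j x x' h => h _ fun i => (wMain_ne_wPrep _ _).symm) _ _ _ (h2 false _) (h2 true _)).trans ?_
  rw [h3, h3]

/-- The overlap of the final states of the overlap test. -/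
lemma innerKet_stage (e : Fin n ↪ ι) (f : Fin n ↪ κ) (ξ : (Fin d → Bool) → Ket κ)
    (y y' : Fin n → Bool) (S S' : (Fin d → Bool) → (ι → Bool) → (Fin n → Bool) → ℂ) :
    innerKet (pack false (stage ξ y' S)) (pack true fun w p a o s =>
      (stage ξ y S' : Amp n d ι κ) (Function.extend e (p ∘ f) w) (Function.extend f (w ∘ e) p)
        a o s) =
      ∑ s, ∑ g : Rest f, ∑ r : Rest e,
        conj (∑ t, conj (ξ s (join f t g)) * S s (join e t r) y) *
          ∑ t, conj (ξ s (join f t g)) * S' s (join e t r) y' := by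
  have h1 := sum_lay fun (w : ι → Bool) (p : κ → Bool) (a b : Fin n → Bool) (s : Fin d → Bool) =>
    conj ((if b = y' then ξ s p else 0) * S s w a) *
      ((if a = y then ξ s (Function.extend f (w ∘ e) p) else 0) *
        S' s (Function.extend e (p ∘ f) w) b)
  refine h1.trans ?_
  have h2 : ∀ (w : ι → Bool) (p : κ → Bool), (∑ a : Fin n → Bool, ∑ b : Fin n → Bool,
      ∑ s : Fin d → Bool, conj ((if b = y' then ξ s p else 0) * S s w a) *
      ((if a = y then ξ s (Function.extend f (w ∘ e) p) else 0) *
        S' s (Function.extend e (p ∘ f) w) b)) = ∑ s, conj (ξ s p * S s w y) *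
        (ξ s (Function.extend f (w ∘ e) p) * S' s (Function.extend e (p ∘ f) w) y') := by
    -- The register of each control value is untouched in the component of the other value. The
    -- inner product therefore projects it onto its initial label, y or y'. With these labels fixed,
    -- the exchange of the tag with the reference register in one component factors the overlap, as
    -- in the swap test.
    intro w p
    rw [Finset.sum_eq_single y, Finset.sum_eq_single y']
    · simp
    · intro b _ hb; simp [hb]
    · simp
    · intro a _ ha; simp [ha]
    · simp
  simp only [h2]
  have h3 : ∀ w : ι → Bool, ∑ p : κ → Bool, ∑ s, conj (ξ s p * S s w y) *
        (ξ s (Function.extend f (w ∘ e) p) * S' s (Function.extend e (p ∘ f) w) y') =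
      ∑ s, ∑ g : Rest f, ∑ x : Fin n → Bool, conj (ξ s (join f x g) * S s w y) *
        (ξ s (join f (w ∘ e) g) * S' s (Function.extend e x w) y') := by
    intro w
    rw [Finset.sum_comm]
    refine Finset.sum_congr rfl fun s _ => ?_
    rw [sum_join f]
    simp only [extend_join, join_comp]
  simp only [h3]
  rw [Finset.sum_comm]
  refine Finset.sum_congr rfl fun s _ => ?_
  rw [Finset.sum_comm]
  refine Finset.sum_congr rfl fun g _ => ?_
  rw [sum_join e]
  simp only [extend_join, join_comp]
  refine Finset.sum_congr rfl fun r _ => ?_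
  rw [map_sum, Finset.sum_mul_sum]
  refine Finset.sum_congr rfl fun t _ => Finset.sum_congr rfl fun x _ => ?_
  simp only [map_mul, Complex.conj_conj]
  ring

end Stages

end QUnf

end

/-! ### The overlap test and its acceptance probability. -/

noncomputable section
namespace QUnf

open Matrix MeasureTheory
open scoped ComplexConjugate

set_option linter.unusedSectionVars false

/-- Contracting the stored true answer of a query with Uψ reproduces ⟨ψ|, since ⟨Uψ|U = ⟨ψ|. In this
way the correction terms arise from a circuit that queries U only forward. -/
lemma sum_conj_smul_rowOp {n : ℕ} (U : QUnitary n) (ψ : Ket (Fin n)) (y : Fin n → Bool) :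
    ∑ t, conj ((U.1 *ᵥ ψ) t) • rowOp U.1 y t = ketBra y ψ := by
  have h : star (U.1 *ᵥ ψ) ᵥ* U.1 = star ψ := by
    rw [star_mulVec, vecMul_vecMul, ← star_eq_conjTranspose, Unitary.coe_star_mul_self, vecMul_one]
  ext a b
  have hb := congrFun h b
  simp only [vecMul, dotProduct, Pi.star_apply, RCLike.star_def] at hb
  simp only [Matrix.sum_apply, Matrix.smul_apply, smul_eq_mul, ketBra, rowOp]
  split_ifs
  · exact hb
  · simp

namespace Adversary

variable {n : ℕ} (A : Adversary n)

/-- The position in the first phase of a query. -/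
def index₁ : Option A.Ix → Option ℕ
  | some (.inl k) => some k
  | _ => none

/-- The position in the second phase of a query. -/
def index₂ : Option A.Ix → Option ℕ
  | some (.inr k) => some k
  | _ => none

/-- The wires of the preparation circuit which hold the description. -/
def descWires : Fin A.descLen ↪ (Fin A.descLen ⊕ Fin n) ⊕ A.Anc :=
  Function.Embedding.inl.trans Function.Embedding.inl

/-- The circuit which compares, for the two values of a control qubit, the overlap of the tag with
the answer (if `τ` is `none`) or the answer to the query `τ`, found in the state `y`. -/
def overlapCircuit (τ : Bool → Option A.Ix) (y : Bool → Fin n → Bool) :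
    List (PInstr n (Lay n A.descLen A.Wire ((Fin A.descLen ⊕ Fin n) ⊕ A.Anc))) :=
  initCircuit _ _ _ y ++ (lift _ _ A.phase₁ (A.index₁ ∘ τ) ++ (copyCircuit A.desc A.descWires ++
    (lift _ _ A.phase₂ (A.index₂ ∘ τ) ++
      (((if (τ false).isSome then sideSwap false A.tag else []) ++
          if (τ true).isSome then sideSwap true A.tag else []) ++
        ((A.prep.map fun g => .both (.gate (g.map wPrep))) ++
          .both (.query (A.refWires.trans wPrep)) ::
            swaps true (A.tag.trans wMain) (A.refWires.trans wPrep)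
              fun _ _ => wMain_ne_wPrep _ _)))))

/-- The amplitude of the tag in the direction of the answer to the challenge, or of a query whose
answer `y` is handed through. -/
def through (U : Op (Fin n)) (h : A.Path) (g : Rest A.refWires) (r : Rest A.tag)
    (y : Fin n → Bool) : Option A.Ix → ℂ
  | none => ∑ z, conj ((U *ᵥ A.chal h.2.1 g) z) * A.amp h z r fun _ => U
  | some i => A.amp h y r (Function.update (fun _ => U) i (ketBra y (A.chal h.2.1 g)))

/-- The state before the exchange of the tag. -/
def sideState (U : Op (Fin n)) (h : A.Path) (y : Fin n → Bool) (τ : Option A.Ix)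
    (w : A.Wire → Bool) (a : Fin n → Bool) : ℂ :=
  side U A.phase₂ (A.index₂ τ) h.2.2 (fun w a => projectOn A.desc h.2.1 (fun w' =>
    side U A.phase₁ (A.index₁ τ) h.1 (fun w a => if a = y then basisKet (fun _ => false) w else 0)
      w' a) w) w a

lemma sideState_none (U : Op (Fin n)) (h : A.Path) (y a : Fin n → Bool) (w : A.Wire → Bool) :
    A.sideState U h y none w a = if a = y then A.final (fun _ => U) h w else 0 := by
  have h1 : A.index₁ none = none := rfl
  have h2 : A.index₂ none = none := rfl
  rw [sideState, h1, h2, side_none]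
  simp only [side_none]
  rw [final_const]
  split_ifs
  · rfl
  · have h0 : (fun _ => 0 : Ket A.Wire) = 0 := rfl
    have h1 : ∀ s, projectOn A.desc s (0 : Ket A.Wire) = 0 := fun s => by
      funext x; simp [projectOn]
    rw [h0, evolve_zero]
    change evolve A.phase₂ _ _ (projectOn A.desc h.2.1 0) w = 0
    rw [h1, evolve_zero]
    rfl

lemma sideState_some (U : Op (Fin n)) (h : A.Path) (y a : Fin n → Bool) (i : A.Ix)
    (w : A.Wire → Bool) : A.sideState U h y (some i) w a =
      A.final (Function.update (fun _ => U) i (rowOp U y a)) h w := by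
  rcases i with k | k
  · have h1 : A.index₁ (some (.inl k)) = some (k : ℕ) := rfl
    have h2 : A.index₂ (some (.inl k)) = none := rfl
    rw [sideState, h1, h2, side_none, final_update_const_inl]
    simp only [side_some U A.phase₁ h.1 k k.2]
    rfl
  · have h1 : A.index₁ (some (.inr k)) = none := rfl
    have h2 : A.index₂ (some (.inr k)) = some (k : ℕ) := rfl
    rw [sideState, h1, h2, final_update_const_inr, ← side_some U A.phase₂ h.2.2 k k.2]
    congr 1
    funext w a
    simp only [side_none]
    rw [middle]
    split_ifs
    · rfl
    · have h0 : (fun _ => 0 : Ket A.Wire) = 0 := rfl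
      rw [h0, evolve_zero]
      simp [projectOn]

/-- If a query τ is selected, the final exchange places its stored answer t on the tag wires, while
the side register receives the tag and is projected onto y. Summation over t against Uψ turns
|y⟩⟨t|U into |y⟩⟨ψ|. If none is selected, the tag itself is compared with Uψ. -/
lemma sum_sideState (U : QUnitary n) (h : A.Path) (g : Rest A.refWires) (r : Rest A.tag)
    (y : Fin n → Bool) (τ : Option A.Ix) :
    (∑ t, conj ((U.1 *ᵥ A.chal h.2.1 g) t) * if τ.isSome then
      A.sideState U.1 h y τ (Function.extend A.tag y (join A.tag t r)) (join A.tag t r ∘ A.tag)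
      else A.sideState U.1 h y τ (join A.tag t r) y) = A.through U.1 h g r y τ := by
  rcases τ with _ | i
  · simp [sideState_none, through, amp_apply]
  · simp only [Option.isSome_some, if_true, sideState_some, extend_join, join_comp, through]
    rw [← sum_conj_smul_rowOp U, MultilinearMap.map_update_sum]
    simp only [MultilinearMap.map_update_smul, smul_eq_mul, amp_apply]

lemma extend_descWires (s : Fin A.descLen → Bool) :
    Function.extend A.descWires s (fun _ => false) = A.prepLabel s fun _ => false := by
  funext i
  rcases i with (i | i) | i
  · exact A.descWires.injective.extend_apply _ _ i
  · exact Function.extend_apply' _ _ _ (by simp [descWires])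
  · exact Function.extend_apply' _ _ _ (by simp [descWires])

lemma applyOn_prepared (U : Op (Fin n)) (s : Fin A.descLen → Bool) (t : Fin n → Bool)
    (g : Rest A.refWires) :
    applyOn A.refWires U (A.prepared s) (join A.refWires t g) = (U *ᵥ A.chal s g) t := by
  rw [applyOn_join]; rfl

/-- Both control values share the path, the reference state and the copied description. Exchanging
tag and reference for one value factors each inner product into the amplitudes for the two terms,
summed over the other labels. -/
theorem psum_overlapCircuit (U : QUnitary n) (τ : Bool → Option A.Ix)
    (y : Bool → Fin n → Bool) :
    psum U.1 (A.overlapCircuit τ y) (fun a b => (innerKet a b).re) (basisKet fun _ => false)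
        (basisKet fun _ => false) =
      ∑ h : A.Path, ∑ g, ∑ r, (conj (A.through U.1 h g r (y false) (τ false)) *
        A.through U.1 h g r (y true) (τ true)).re := by
  rw [overlapCircuit, psum_append, psum_initCircuit, psum_append]
  refine (psum_lift_stage U.1 A.phase₁ (A.index₁ ∘ τ) _ _ y fun b _ w a =>
    if a = y b then basisKet (fun _ => false) w else 0).trans ?_
  rw [sum_path]
  refine Finset.sum_congr rfl fun h₁ _ => ?_
  rw [psum_append, psum_copyCircuit, psum_append]
  refine (psum_lift_stage U.1 A.phase₂ (A.index₂ ∘ τ) _ _ y fun b s w a =>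
    projectOn A.desc s (fun w' => side U.1 A.phase₁ (A.index₁ (τ b)) h₁
      (fun w a => if a = y b then basisKet (fun _ => false) w else 0) w' a) w).trans ?_
  rw [Finset.sum_comm]
  refine Finset.sum_congr rfl fun h₂ _ => ?_
  rw [psum_append]
  refine (psum_tag_stage U.1 A.tag (fun b => (τ b).isSome = true) _ _ y fun b s w a =>
    A.sideState U.1 (h₁, s, h₂) (y b) (τ b) w a).trans ?_
  rw [psum_append, psum_prep_stage, psum, pack_stage_applyOn, pack_stage_applyOn]
  refine (psum_swaps_true U.1 _ _ _ fun x x' h1 h2 h3 =>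
    pack_swap_prep true A.tag A.refWires _ x x' h1 h2 h3).trans ?_
  rw [innerKet_stage, Complex.re_sum]
  refine Finset.sum_congr rfl fun s _ => ?_
  rw [Complex.re_sum]
  refine Finset.sum_congr rfl fun g _ => ?_
  rw [Complex.re_sum]
  refine Finset.sum_congr rfl fun r _ => ?_
  have h := fun b => A.sum_sideState U (h₁, s, h₂) g r (y b) (τ b)
  rw [← h false, ← h true]
  have e : ∀ t, applyOn A.refWires U.1 (applyGates A.prep
      (basisKet (Function.extend A.descWires s fun _ => false))) (join A.refWires t g) =
      (U.1 *ᵥ A.chal s g) t := fun t => by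
    rw [extend_descWires]; exact A.applyOn_prepared U.1 s t g
  simp only [e]

/-- A contribution to the residual overlap. -/
abbrev Term : Type := Option A.Ix × (Fin n → Bool)

/-- The Hadamard test for the overlap circuit. -/
def overlapTest (p q : A.Term) : Distinguisher n :=
  hadamardTest (A.overlapCircuit (fun b => (bif b then q else p).1) fun b => (bif b then q else p).2)

lemma overlapTest_acceptProb (p q : A.Term) (U : QUnitary n) : ∑ h : A.Path, ∑ g, ∑ r,
    (conj (A.through U.1 h g r p.2 p.1) * A.through U.1 h g r q.2 q.1).re =
      1 - 2 * (A.overlapTest p q).acceptProb U := by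
  rw [overlapTest, hadamardTest_acceptProb, psum_overlapCircuit]
  simp only [cond_true, cond_false]
  ring

/-- The sign of a contribution to the residual overlap. -/
def sgn : Option A.Ix → ℝ
  | none => 1
  | some _ => -1

/-- The term without a selected query does not depend on y, so its sum over y is D times the overlap
and compensates the common factor 1/D. All terms thus carry the same weight up to sign. -/
lemma residual_eq_sum_through (U : Op (Fin n)) (h : A.Path) (g : Rest A.refWires)
    (r : Rest A.tag) : residual (A.amp h · r) (A.chal h.2.1 g) U =
      (2 ^ n)⁻¹ * ∑ p : A.Term, (A.sgn p.1 : ℂ) * A.through U h g r p.2 p.1 := by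
  have hD : ((2 : ℂ) ^ n) ≠ 0 := pow_ne_zero _ two_ne_zero
  rw [Fintype.sum_prod_type, Fintype.sum_option]
  simp only [through, sgn, residual, Complex.ofReal_one, one_mul, Complex.ofReal_neg, neg_mul,
    Finset.sum_neg_distrib]
  rw [Finset.sum_const, Finset.card_univ, Fintype.card_fun, Fintype.card_bool, Fintype.card_fin,
    nsmul_eq_mul, mul_add, Nat.cast_pow, Nat.cast_ofNat, inv_mul_cancel_left₀ hD,
    Finset.sum_comm (s := (Finset.univ : Finset A.Ix)), mul_neg, ← sub_eq_add_neg]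

lemma leakage_eq (U : QUnitary n) : A.leakage U.1 = ((2 ^ n)⁻¹) ^ 2 *
    ∑ p : A.Term, ∑ q : A.Term,
      A.sgn p.1 * A.sgn q.1 * (1 - 2 * (A.overlapTest p q).acceptProb U) := by
  have hnorm : ∀ (h : A.Path) g r, ‖residual (A.amp h · r) (A.chal h.2.1 g) U.1‖ ^ 2 =
      ((2 ^ n)⁻¹) ^ 2 * ∑ p : A.Term, ∑ q : A.Term, A.sgn p.1 * A.sgn q.1 *
        (conj (A.through U.1 h g r p.2 p.1) * A.through U.1 h g r q.2 q.1).re := by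
    intro h g r
    have hc : ‖((2 : ℂ) ^ n)⁻¹‖ = (2 ^ n)⁻¹ := by simp
    have hs : ∀ z : ℂ, ‖z‖ ^ 2 = (conj z * z).re := fun z => by
      rw [Complex.conj_mul', ← Complex.ofReal_pow, Complex.ofReal_re]
    rw [residual_eq_sum_through, norm_mul, mul_pow, hc, hs, map_sum, Finset.sum_mul_sum,
      Complex.re_sum]
    congr 1
    refine Finset.sum_congr rfl fun p _ => ?_
    rw [Complex.re_sum]
    refine Finset.sum_congr rfl fun q _ => ?_
    rw [map_mul, Complex.conj_ofReal, mul_mul_mul_comm, ← Complex.ofReal_mul,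
      Complex.re_ofReal_mul]
  simp only [leakage, hnorm, ← Finset.mul_sum, ← overlapTest_acceptProb]
  congr 1
  have comm : ∀ {J : Type} [Fintype J] (F : J → A.Term → A.Term → ℝ),
      ∑ j, ∑ p, ∑ q, F j p q = ∑ p, ∑ q, ∑ j, F j p q := fun F => by
    rw [Finset.sum_comm]
    exact Finset.sum_congr rfl fun p _ => Finset.sum_comm
  simp only [comm, Finset.mul_sum]

/-- The tag and description wires embed in the register of the adversary, so `n` and `descLen` are
bounded by its size. The product in the bound stems from up to 2n controlled exchanges after each
query. -/
lemma overlapTest_size (p q : A.Term) : (A.overlapTest p q).size ≤ 20 * (A.size + 1) ^ 2 := by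
  have hn : n ≤ Fintype.card A.Wire := by
    simpa using Fintype.card_le_of_embedding A.tag
  have hd : A.descLen ≤ Fintype.card A.Wire := by
    simpa using Fintype.card_le_of_embedding A.desc
  have h1 := lift_length (κ := (Fin A.descLen ⊕ Fin n) ⊕ A.Anc) (d := A.descLen) A.phase₁
    (A.index₁ ∘ fun b => (bif b then q else p).1)
  have h2 := lift_length (κ := (Fin A.descLen ⊕ Fin n) ⊕ A.Anc) (d := A.descLen) A.phase₂
    (A.index₂ ∘ fun b => (bif b then q else p).1)
  have h3 : ∀ (b : Bool) (P : Prop) [Decidable P], (if P then sideSwap (d := A.descLen)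
      (κ := (Fin A.descLen ⊕ Fin n) ⊕ A.Anc) b A.tag else []).length ≤ n := by
    intro b P _
    split_ifs
    · exact (swaps_length ..).le
    · simp
  have h4 := h3 false ((fun b => (bif b then q else p).1) false).isSome
  have h5 := h3 true ((fun b => (bif b then q else p).1) true).isSome
  have hc : Fintype.card (Lay n A.descLen A.Wire ((Fin A.descLen ⊕ Fin n) ⊕ A.Anc)) =
      Fintype.card A.Wire + (A.descLen + n + Fintype.card A.Anc + (n + (n + A.descLen))) := by
    simp
  have hs : A.size = Fintype.card A.Wire + Fintype.card A.Anc + A.prep.length +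
    A.phase₁.length + A.phase₂.length := rfl
  rw [overlapTest, hadamardTest_size, hc, overlapCircuit]
  simp only [List.length_append, List.length_cons, List.length_map, initCircuit,
    copyCircuit, gates_length]
  have h7 : (swaps (n := n) true (A.tag.trans (wMain (n := n) (d := A.descLen)))
      (A.refWires.trans wPrep) fun _ _ => wMain_ne_wPrep _ _).length = n := swaps_length ..
  simp only [h7]
  have h6 : n * (A.phase₁.length + A.phase₂.length) ≤ A.size * A.size :=
    Nat.mul_le_mul (by omega) (by omega)
  nlinarith

end Adversary

end QUnf

end

noncomputable section
namespace QUnf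

open Matrix MeasureTheory Filter
open scoped ComplexConjugate

set_option linter.unusedSectionVars false

/-! ### Comparison of random keys with Haar random unitaries. -/

namespace Adversary

variable {n : ℕ} (A : Adversary n)

lemma continuous_through (h : A.Path) (g : Rest A.refWires) (r : Rest A.tag) (y : Fin n → Bool)
    (τ : Option A.Ix) : Continuous fun U : QUnitary n => A.through U.1 h g r y τ := by
  rcases τ with _ | i
  · have h1 : ∀ z, Continuous fun U : QUnitary n => A.amp h z r fun _ => U.1 := fun z =>
      (continuous_multilinear (A.amp h z r)).comp (continuous_pi fun _ => continuous_subtype_val)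
    have h3 : Continuous fun U : QUnitary n => U.1 *ᵥ A.chal h.2.1 g :=
      continuous_subtype_val.matrix_mulVec continuous_const
    exact continuous_finsetSum _ fun z _ =>
      (Complex.continuous_conj.comp ((continuous_apply z).comp h3)).mul (h1 z)
  · exact (continuous_multilinear (A.amp h y r)).comp
      ((continuous_pi fun _ => continuous_subtype_val).update i continuous_const)

/-- Continuity makes the acceptance probability Haar integrable. It is read off from the formula in
terms of amplitudes rather than from the run of the circuit. -/
lemma continuous_overlapTest (p q : A.Term) :
    Continuous fun U : QUnitary n => (A.overlapTest p q).acceptProb U := by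
  have h : (fun U : QUnitary n => (A.overlapTest p q).acceptProb U) = fun U =>
      1 / 2 * (1 - ∑ h : A.Path, ∑ g, ∑ r,
        (conj (A.through U.1 h g r p.2 p.1) * A.through U.1 h g r q.2 q.1).re) := by
    funext U
    rw [overlapTest_acceptProb]
    ring
  rw [h]
  refine continuous_const.mul (continuous_const.sub ?_)
  refine continuous_finsetSum _ fun h _ => continuous_finsetSum _ fun g _ =>
    continuous_finsetSum _ fun r _ => Complex.continuous_re.comp ?_
  exact (Complex.continuous_conj.comp (A.continuous_through ..)).mul (A.continuous_through ..)

lemma abs_sgn (τ : Option A.Ix) : |A.sgn τ| = 1 := by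
  cases τ <;> simp [sgn]

/-- The average leakage for a random key is bounded by the one for a Haar random unitary and the
advantages of the overlap tests. -/
lemma average_leakage_le {K : Type} [Fintype K] [Nonempty K] (V : K → QUnitary n) {δ : ℝ}
    (hδ : ∀ p q, |(∑ k, (A.overlapTest p q).acceptProb (V k)) / (Fintype.card K : ℝ) -
      ∫ U, (A.overlapTest p q).acceptProb U ∂haarUnitary n| ≤ δ) :
    (∑ k, A.leakage (V k).1) / (Fintype.card K : ℝ) ≤
      ∫ U : QUnitary n, A.leakage U.1 ∂haarUnitary n + 2 * (Fintype.card A.Ix + 1) ^ 2 * δ := by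
  have hK : (Fintype.card K : ℝ) ≠ 0 := by simp
  set acc : A.Term → A.Term → QUnitary n → ℝ := fun p q U => (A.overlapTest p q).acceptProb U
  have hint : ∀ p q, Integrable (acc p q) (haarUnitary n) := fun p q =>
    integrable_haar (A.continuous_overlapTest p q)
  have h1 : (∑ k, A.leakage (V k).1) / (Fintype.card K : ℝ) = ((2 ^ n)⁻¹) ^ 2 *
      ∑ p : A.Term, ∑ q : A.Term, A.sgn p.1 * A.sgn q.1 *
        (1 - 2 * ((∑ k, acc p q (V k)) / (Fintype.card K : ℝ))) := by
    simp only [leakage_eq]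
    rw [← Finset.mul_sum, mul_div_assoc, Finset.sum_comm, Finset.sum_div]
    congr 1
    refine Finset.sum_congr rfl fun p _ => ?_
    rw [Finset.sum_comm, Finset.sum_div]
    refine Finset.sum_congr rfl fun q _ => ?_
    rw [← Finset.mul_sum, mul_div_assoc, Finset.sum_sub_distrib, sub_div, ← Finset.mul_sum,
      mul_div_assoc]
    simp [hK, acc]
  have h2 : ∫ U : QUnitary n, A.leakage U.1 ∂haarUnitary n = ((2 ^ n)⁻¹) ^ 2 *
      ∑ p : A.Term, ∑ q : A.Term, A.sgn p.1 * A.sgn q.1 *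
        (1 - 2 * ∫ U, acc p q U ∂haarUnitary n) := by
    simp only [leakage_eq]
    have hi : ∀ p q : A.Term, Integrable (fun U => A.sgn p.1 * A.sgn q.1 * (1 - 2 * acc p q U))
        (haarUnitary n) := fun p q =>
      ((integrable_const 1).sub ((hint p q).const_mul 2)).const_mul _
    rw [integral_const_mul, integral_finsetSum _ fun p _ => integrable_finsetSum _ fun q _ => hi p q]
    congr 1
    refine Finset.sum_congr rfl fun p _ => ?_
    rw [integral_finsetSum _ fun q _ => hi p q]
    refine Finset.sum_congr rfl fun q _ => ?_
    rw [integral_const_mul, integral_sub (integrable_const 1) ((hint p q).const_mul 2),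
      integral_const_mul, integral_const, probReal_univ, one_smul]
  rw [← sub_le_iff_le_add', h1, h2, ← mul_sub, ← Finset.sum_sub_distrib]
  simp only [← Finset.sum_sub_distrib]
  have hle : ∀ p q : A.Term, A.sgn p.1 * A.sgn q.1 *
      (1 - 2 * ((∑ k, acc p q (V k)) / (Fintype.card K : ℝ))) -
      A.sgn p.1 * A.sgn q.1 * (1 - 2 * ∫ U, acc p q U ∂haarUnitary n) ≤ 2 * δ := by
    intro p q
    refine (le_abs_self _).trans ?_
    have : A.sgn p.1 * A.sgn q.1 * (1 - 2 * ((∑ k, acc p q (V k)) / (Fintype.card K : ℝ))) -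
        A.sgn p.1 * A.sgn q.1 * (1 - 2 * ∫ U, acc p q U ∂haarUnitary n) =
        A.sgn p.1 * A.sgn q.1 * (-2 * ((∑ k, acc p q (V k)) / (Fintype.card K : ℝ) -
          ∫ U, acc p q U ∂haarUnitary n)) := by ring
    rw [this, abs_mul, abs_mul, abs_mul, abs_sgn, abs_sgn, one_mul, one_mul, abs_neg,
      abs_of_pos (two_pos : (0 : ℝ) < 2)]
    exact mul_le_mul_of_nonneg_left (hδ p q) two_pos.le
  have hcard : (Fintype.card A.Term : ℝ) = (Fintype.card A.Ix + 1) * 2 ^ n := by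
    rw [Fintype.card_prod, Fintype.card_option, Fintype.card_fun, Fintype.card_bool,
      Fintype.card_fin]
    push_cast
    rfl
  -- There are ((q + 1)D)² pairs of terms, q being the number of queries; the prefactor D⁻² removes
  -- the exponential part.
  calc _ ≤ ((2 ^ n : ℝ)⁻¹) ^ 2 * ∑ p : A.Term, ∑ q : A.Term, 2 * δ := by
        refine mul_le_mul_of_nonneg_left ?_ (by positivity)
        exact Finset.sum_le_sum fun p _ => Finset.sum_le_sum fun q _ => hle p q
    _ = _ := by
        simp only [Finset.sum_const, Finset.card_univ, nsmul_eq_mul, hcard]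
        have : (2 : ℝ) ^ n ≠ 0 := by positivity
        field_simp

end Adversary

/-! ### Negligible and polynomially bounded functions. -/

section Negligible

lemma IsNegligible.mono {f g : ℕ → ℝ} (hf : IsNegligible f) (hg : ∀ lam, 0 ≤ g lam)
    (h : ∀ᶠ lam in atTop, g lam ≤ f lam) : IsNegligible g :=
  ⟨hg, fun c => by filter_upwards [h, hf.2 c] with lam h1 h2 using h1.trans h2⟩

lemma IsNegligible.add {f g : ℕ → ℝ} (hf : IsNegligible f) (hg : IsNegligible g) :
    IsNegligible fun lam => f lam + g lam := by
  refine ⟨fun lam => add_nonneg (hf.1 lam) (hg.1 lam), fun c => ?_⟩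
  filter_upwards [hf.2 (c + 1), hg.2 (c + 1), eventually_ge_atTop 2] with lam h1 h2 h3
  have h3' : (2 : ℝ) ≤ lam := by exact_mod_cast h3
  have hpos : (0 : ℝ) < lam := by linarith
  refine (add_le_add h1 h2).trans ?_
  rw [← add_div, pow_succ, div_le_div_iff₀ (by positivity) (by positivity), one_mul, mul_comm]
  have : (0 : ℝ) ≤ (lam : ℝ) ^ c := by positivity
  nlinarith

lemma eventually_eval_le (p : Polynomial ℕ) : ∃ d : ℕ, ∀ᶠ lam : ℕ in atTop, p.eval lam ≤ lam ^ d := by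
  induction p using Polynomial.induction_on' with
  | add p q hp hq =>
    obtain ⟨d, hd⟩ := hp
    obtain ⟨e, he⟩ := hq
    refine ⟨max d e + 1, ?_⟩
    filter_upwards [hd, he, eventually_ge_atTop 2] with lam h1 h2 h3
    have h4 : lam ^ d ≤ lam ^ max d e := Nat.pow_le_pow_right (by omega) (le_max_left _ _)
    have h5 : lam ^ e ≤ lam ^ max d e := Nat.pow_le_pow_right (by omega) (le_max_right _ _)
    rw [Polynomial.eval_add, pow_succ]
    nlinarith
  | monomial k a =>
    refine ⟨k + 1, ?_⟩
    filter_upwards [eventually_ge_atTop a] with lam h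
    rw [Polynomial.eval_monomial, pow_succ, mul_comm]
    exact Nat.mul_le_mul_left _ h

lemma IsNegligible.poly_mul {f : ℕ → ℝ} (hf : IsNegligible f) {p : ℕ → ℕ} (hp : PolyBounded p) :
    IsNegligible fun lam => (p lam : ℝ) * f lam := by
  refine ⟨fun lam => mul_nonneg (Nat.cast_nonneg _) (hf.1 lam), fun c => ?_⟩
  obtain ⟨P, hP⟩ := hp
  obtain ⟨d, hd⟩ := eventually_eval_le P
  filter_upwards [hd, hf.2 (c + d), eventually_ge_atTop 1] with lam h1 h2 h3
  have hpos : (0 : ℝ) < lam := by exact_mod_cast h3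
  have h4 : (p lam : ℝ) ≤ (lam : ℝ) ^ d := by exact_mod_cast (hP lam).trans h1
  calc (p lam : ℝ) * f lam ≤ (lam : ℝ) ^ d * (1 / (lam : ℝ) ^ (c + d)) :=
        mul_le_mul h4 h2 (hf.1 lam) (by positivity)
    _ = 1 / (lam : ℝ) ^ c := by
        rw [pow_add]
        field_simp

lemma IsNegligible.sqrt {f : ℕ → ℝ} (hf : IsNegligible f) : IsNegligible fun lam => √(f lam) := by
  refine ⟨fun lam => Real.sqrt_nonneg _, fun c => ?_⟩
  filter_upwards [hf.2 (c * 2)] with lam h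
  refine Real.sqrt_le_iff.2 ⟨by positivity, ?_⟩
  rwa [div_pow, one_pow, ← pow_mul]

lemma PolyBounded.add {f g : ℕ → ℕ} (hf : PolyBounded f) (hg : PolyBounded g) :
    PolyBounded fun lam => f lam + g lam := by
  obtain ⟨p, hp⟩ := hf
  obtain ⟨q, hq⟩ := hg
  exact ⟨p + q, fun lam => by rw [Polynomial.eval_add]; exact add_le_add (hp lam) (hq lam)⟩

lemma PolyBounded.mul {f g : ℕ → ℕ} (hf : PolyBounded f) (hg : PolyBounded g) :
    PolyBounded fun lam => f lam * g lam := by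
  obtain ⟨p, hp⟩ := hf
  obtain ⟨q, hq⟩ := hg
  exact ⟨p * q, fun lam => by rw [Polynomial.eval_mul]; exact Nat.mul_le_mul (hp lam) (hq lam)⟩

lemma PolyBounded.const (c : ℕ) : PolyBounded fun _ => c :=
  ⟨Polynomial.C c, fun lam => by rw [Polynomial.eval_C]⟩

lemma PolyBounded.mono {f g : ℕ → ℕ} (hf : PolyBounded f) (h : ∀ lam, g lam ≤ f lam) :
    PolyBounded g := by
  obtain ⟨p, hp⟩ := hf
  exact ⟨p, fun lam => (h lam).trans (hp lam)⟩

end Negligible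

/-! ### Asymptotic conclusion. -/

/-- If the evaluation is pseudorandom, then a forger wins the game with orthogonal challenges with
at most the probability of a wrong answer of the test, up to a negligible term. -/
theorem gameProb_le_overlapProb_add (P : QuantumPrimitive) (hPRU : IsPRU P.qubits P.Key P.eval)
    (hdim : IsNegligible fun lam => 1 / (2 : ℝ) ^ P.qubits lam) (hcopies : PolyBounded P.copies₁)
    (A : ∀ lam, Adversary (P.qubits lam)) (hA : PolyBounded fun lam => (A lam).size) :
    ∃ ε : ℕ → ℝ, IsNegligible ε ∧
      ∀ lam, P.gameProb 1 lam (A lam) ≤ P.overlapProb 1 lam + ε lam := by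
  set adv : ∀ lam, (A lam).Term → (A lam).Term → ℝ := fun lam p q =>
    |(∑ k : P.Key lam, ((A lam).overlapTest p q).acceptProb (P.eval lam k)) /
      (Fintype.card (P.Key lam) : ℝ) -
      ∫ V, ((A lam).overlapTest p q).acceptProb V ∂(haarUnitary (P.qubits lam))|
  -- The number of tests is exponential, but distinguishers may be non-uniform: the pair with the
  -- largest advantage is chosen for each security parameter, and pseudorandomness is applied to
  -- that single family.
  have hmax : ∀ lam, ∃ m : (A lam).Term × (A lam).Term, ∀ p q, adv lam p q ≤ adv lam m.1 m.2 := by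
    intro lam
    obtain ⟨m, hm⟩ := Finite.exists_max fun m : (A lam).Term × (A lam).Term => adv lam m.1 m.2
    exact ⟨m, fun p q => hm (p, q)⟩
  choose m hm using hmax
  have hsize : PolyBounded fun lam => 20 * ((A lam).size + 1) ^ 2 := by
    simp only [pow_two]
    exact (PolyBounded.const 20).mul
      ((hA.add (PolyBounded.const 1)).mul (hA.add (PolyBounded.const 1)))
  have hδ : IsNegligible fun lam => adv lam (m lam).1 (m lam).2 :=
    hPRU (fun lam => (A lam).overlapTest (m lam).1 (m lam).2)
      (hsize.mono fun lam => (A lam).overlapTest_size _ _)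
  set q : ℕ → ℕ := fun lam => Fintype.card (A lam).Ix
  have hq : PolyBounded q := by
    refine hA.mono fun lam => ?_
    have h1 := numQueries_le (A lam).phase₁
    have h2 := numQueries_le (A lam).phase₂
    have h3 : q lam = numQueries (A lam).phase₁ + numQueries (A lam).phase₂ := by
      simp [q]
    rw [h3, Adversary.size]
    omega
  set B : ℕ → ℝ := fun lam =>
    ((P.copies₁ lam * (2 * ((q lam + 1) * (q lam + 1))) : ℕ) : ℝ) * adv lam (m lam).1 (m lam).2 +
    ((P.copies₁ lam : ℝ) * (1 / 2 ^ P.qubits lam) +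
      ((P.copies₁ lam * (q lam + q lam * q lam) : ℕ) : ℝ) * √(1 / 2 ^ P.qubits lam)) with hB
  have hBn : IsNegligible B :=
    (hδ.poly_mul (hcopies.mul ((PolyBounded.const 2).mul
      ((hq.add (PolyBounded.const 1)).mul (hq.add (PolyBounded.const 1)))))).add
    ((hdim.poly_mul hcopies).add (hdim.sqrt.poly_mul (hcopies.mul (hq.add (hq.mul hq)))))
  -- With no qubits 2^{-n} would be 1, which exceeds 1/λ for λ ≥ 2.
  have hpos : ∀ᶠ lam in atTop, 0 < P.qubits lam := by
    filter_upwards [hdim.2 1, eventually_ge_atTop 2] with lam h1 h2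
    by_contra h0
    have h0' : P.qubits lam = 0 := by omega
    have h2' : (2 : ℝ) ≤ lam := by exact_mod_cast h2
    rw [h0', pow_zero, pow_one, div_one, le_div_iff₀ (by linarith)] at h1
    linarith
  have hle : ∀ lam, 0 < P.qubits lam → P.gameProb 1 lam (A lam) ≤ P.overlapProb 1 lam + B lam := by
    intro lam hn
    have hK : (0 : ℝ) < Fintype.card (P.Key lam) := by exact_mod_cast Fintype.card_pos
    have h1 := (A lam).average_leakage_le (P.eval lam) (hm lam)
    have h2 := (A lam).integral_leakage_le
    have h3 : P.gameProb 1 lam (A lam) ≤ P.overlapProb 1 lam + P.copies₁ lam *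
        ((∑ k, (A lam).leakage (P.eval lam k).1) / (Fintype.card (P.Key lam) : ℝ)) := by
      rw [QuantumPrimitive.gameProb, div_le_iff₀ hK]
      refine (Finset.sum_le_sum fun k _ => (A lam).winProb_le (P.test lam) hn (P.copies₁ lam)
        (P.copies₂ lam) (P.eval lam k)).trans (le_of_eq ?_)
      rw [Finset.sum_add_distrib, Finset.sum_const, Finset.card_univ, nsmul_eq_mul,
        ← Finset.mul_sum, QuantumPrimitive.overlapProb, sub_self]
      field_simp
    have h4 : √(1 / 2 ^ P.qubits lam : ℝ) = 1 / √(2 ^ P.qubits lam) := by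
      rw [Real.sqrt_div zero_le_one, Real.sqrt_one]
    refine h3.trans (add_le_add_right (le_trans (mul_le_mul_of_nonneg_left
      (h1.trans (add_le_add_left h2 _)) (Nat.cast_nonneg _)) (le_of_eq ?_)) _)
    rw [hB]
    simp only [h4]
    push_cast
    ring
  -- The bound by `B` holds only where n > 0, that is eventually, whereas the claim concerns every
  -- security parameter. The positive part of the excess satisfies it by definition and is
  -- eventually dominated by `B`.
  refine ⟨fun lam => max 0 (P.gameProb 1 lam (A lam) - P.overlapProb 1 lam),
    hBn.mono (fun lam => le_max_left _ _) ?_, fun lam => ?_⟩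
  · filter_upwards [hpos] with lam hn
    exact max_le (hBn.1 lam) (by linarith [hle lam hn])
  · linarith [le_max_right 0 (P.gameProb 1 lam (A lam) - P.overlapProb 1 lam)]

end QUnf

end

theorem mainTheorem7 (P : QUnf.QuantumPrimitive)
    (hPRU : QUnf.IsPRU P.qubits P.Key P.eval)
    (hdim : QUnf.IsNegligible fun lam => 1 / (2 : ℝ) ^ P.qubits lam)
    (hcopies : QUnf.PolyBounded P.copies₁) :
    P.QGSU 1 ∧ (QUnf.IsNegligible (P.overlapProb 1) → P.QGEU 1) := by
  refine ⟨fun A hA _ => QUnf.gameProb_le_overlapProb_add P hPRU hdim hcopies A hA,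
    fun hov A hA => ?_⟩
  obtain ⟨ε, hε, h⟩ := QUnf.gameProb_le_overlapProb_add P hPRU hdim hcopies A hA
  exact ⟨_, hov.add hε, h⟩
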